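/- Let $n\ge 1$ and let $F_n=\pi_1(R_n)$ be the fundamental group of the rose $R_n$ with $n$ petals. A marked metric graph $A$ of rank $n$ is a finite connected graph, all of whose vertices have valence at least two, with a positive length on every edge and the induced path metric, together with a homotopy equivalence (the marking) $\tau_A:R_n\to A$. For $w\in F_n$ let $l_A(w)$ be the translation length of $w$ on the universal cover of $A$, that is, the infimum of the lengths of the loops in $A$ in the free homotopy class determined by $\tau_A(w)$, and for marked metric graphs $A$, $B$ of rank $n$ put $$\Lambda_R(A,B)=\sup_{1\ne w\in F_n}\frac{l_B(w)}{l_A(w)} .$$ A PL map $f:A\to B$ is a continuous map that is linear on edges: on every edge $e$, parametrised by arc length, $f$ is a local geodesic traversed at a constant speed $S_{f,e}\ge 0$ (constant if $S_{f,e}=0$). Put $S_f=\max_e S_{f,e}$ and let $A_{max}(f)$ be the subgraph of $A$ that is the union of the closed edges $e$ with $S_{f,e}=S_f$. A loop in a graph is cyclically reduced if, as a map from the circle, it is an immersion (locally injective). Then for any marked metric graphs $A$, $B$ of rank $n$ there is a PL map $f:A\to B$ with $f\circ\tau_A\simeq\tau_B$ (free homotopy) and a cyclically reduced loop $\gamma$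 in $A$, contained in $A_{max}(f)$, such that the loop $f\circ\gamma$ is cyclically reduced in $B$. Moreover, for this map $f$, $$\Lambda_R(A,B)=S_f,$$ $f$ is $S_f$-Lipschitz, and $S_f\le K$ for every $K$-Lipschitz map $g:A\to B$ with $g\circ\tau_A\simeq\tau_B$; that is, $\Lambda_R(A,B)=S_f$ is the minimal Lipschitz constant in the homotopy class $\tau_B\tau_A^{-1}$. -/

import Mathlib

open Set
open scoped NNReal ENNReal unitInterval

noncomputable section

/-- A finite connected metric graph: finitely many vertices and (arbitrarily oriented) edges,
loops and multiple edges allowed, with a positive length on every edge. -/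
structure MetricGraph where
  V : Type
  E : Type
  [fintypeV : Fintype V]
  [fintypeE : Fintype E]
  src : E → V
  tgt : E → V
  len : E → ℝ
  len_pos : ∀ e, 0 < len e
  connected : ∀ u v : V, Relation.EqvGen (fun a b => ∃ e, src e = a ∧ tgt e = b) u v

namespace MetricGraph

attribute [instance] MetricGraph.fintypeV MetricGraph.fintypeE

/-- The valence of a vertex: the number of ends of edges at that vertex (a loop counts twice). -/
def valence (G : MetricGraph) (v : G.V) : ℕ :=
  Nat.card {e : G.E // G.src e = v} + Nat.card {e : G.E // G.tgt e = v}

/-- The points of the geometric realisation of `G`: the vertices and the points in the interiors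
of the edges; `inner e t` lies on `e` at distance `t` along `e` from its source. -/
inductive Space (G : MetricGraph) : Type
  | vertex (v : G.V) : Space G
  | inner (e : G.E) (t : Ioo (0 : ℝ) (G.len e)) : Space G

variable {G : MetricGraph}

open Classical in
/-- The arc length parametrisation of the closed edge `e` by `[0, len e]`
(extended to the real line by constants). -/
def pt (G : MetricGraph) (e : G.E) (t : ℝ) : G.Space :=
  if h₀ : t ≤ 0 then Space.vertex (G.src e)
  else if h₁ : G.len e ≤ t then Space.vertex (G.tgt e)
  else Space.inner e ⟨t, not_le.mp h₀, not_le.mp h₁⟩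

/-- The closed edge `e` as a subset of the realisation. -/
def closedEdge (G : MetricGraph) (e : G.E) : Set G.Space :=
  G.pt e '' Icc 0 (G.len e)

/-- `Joined x y L`: some concatenation of finitely many segments, each of them contained in a
closed edge, leads from `x` to `y` and has total length `L`. -/
inductive Joined (x : G.Space) : G.Space → ℝ → Prop
  | refl : Joined x x 0
  | step {L : ℝ} (e : G.E) {s t : ℝ} (hs : s ∈ Icc 0 (G.len e)) (ht : t ∈ Icc 0 (G.len e))
      (h : Joined x (G.pt e s) L) : Joined x (G.pt e t) (L + |s - t|)

theorem pt_zero (e : G.E) : G.pt e 0 = Space.vertex (G.src e) := by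
  simp [pt]

theorem pt_len (e : G.E) : G.pt e (G.len e) = Space.vertex (G.tgt e) := by
  simp [pt, not_le.mpr (G.len_pos e)]

theorem pt_inner (e : G.E) (t : Ioo (0 : ℝ) (G.len e)) : G.pt e t = Space.inner e t := by
  simp [pt, not_le.mpr t.2.1, not_le.mpr t.2.2]

theorem Joined.nonneg {x y : G.Space} {L : ℝ} (h : Joined x y L) : 0 ≤ L := by
  induction h with
  | refl => exact le_rfl
  | step e hs ht h ih => positivity

theorem Joined.trans {x y z : G.Space} {L M : ℝ} (h : Joined x y L) (h' : Joined y z M) :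
    Joined x z (L + M) := by
  induction h' with
  | refl => simpa using h
  | step e hs ht h' ih => rw [← add_assoc]; exact Joined.step e hs ht ih

theorem Joined.single (e : G.E) {s t : ℝ} (hs : s ∈ Icc 0 (G.len e))
    (ht : t ∈ Icc 0 (G.len e)) : Joined (G.pt e s) (G.pt e t) |s - t| := by
  simpa using Joined.step e hs ht Joined.refl

theorem Joined.symm {x y : G.Space} {L : ℝ} (h : Joined x y L) : Joined y x L := by
  induction h with
  | refl => exact Joined.refl
  | step e hs ht h ih =>
    rw [add_comm, abs_sub_comm]
    exact (Joined.single e ht hs).trans ih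

theorem zero_mem (e : G.E) : (0 : ℝ) ∈ Icc 0 (G.len e) := ⟨le_rfl, (G.len_pos e).le⟩

theorem len_mem (e : G.E) : G.len e ∈ Icc 0 (G.len e) := ⟨(G.len_pos e).le, le_rfl⟩

theorem exists_joined (x y : G.Space) : ∃ L, Joined x y L := by
  have key : ∀ u v : G.V, ∃ L, Joined (Space.vertex u) (Space.vertex v) L := by
    intro u v
    induction G.connected u v with
    | rel u v h =>
      obtain ⟨e, rfl, rfl⟩ := h
      exact ⟨_, by simpa only [pt_zero, pt_len] using Joined.single e (zero_mem e) (len_mem e)⟩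
    | refl u => exact ⟨0, Joined.refl⟩
    | symm u v _ ih => exact ⟨_, ih.choose_spec.symm⟩
    | trans u v w _ _ ih ih' => exact ⟨_, ih.choose_spec.trans ih'.choose_spec⟩
  have near : ∀ z : G.Space, ∃ (v : G.V) (L : ℝ), Joined z (Space.vertex v) L := by
    rintro (v | ⟨e, t⟩)
    · exact ⟨v, 0, Joined.refl⟩
    · refine ⟨G.src e, |(t : ℝ) - 0|, ?_⟩
      rw [← pt_inner, ← pt_zero]
      exact Joined.single e ⟨t.2.1.le, t.2.2.le⟩ (zero_mem e)
  obtain ⟨u, L, hL⟩ := near x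
  obtain ⟨v, M, hM⟩ := near y
  obtain ⟨K, hK⟩ := key u v
  exact ⟨_, (hL.trans hK).trans hM.symm⟩

theorem Joined.abs_sub_le (φ : G.Space → ℝ)
    (hφ : ∀ e, ∀ s ∈ Icc 0 (G.len e), ∀ t ∈ Icc 0 (G.len e),
      |φ (G.pt e s) - φ (G.pt e t)| ≤ |s - t|)
    {x y : G.Space} {L : ℝ} (h : Joined x y L) : |φ x - φ y| ≤ L := by
  induction h with
  | refl => simp
  | step e hs ht h ih =>
    exact (_root_.abs_sub_le _ _ _).trans (add_le_add ih (hφ e _ hs _ ht))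

theorem pt_cases (e : G.E) {s : ℝ} (hs : s ∈ Icc 0 (G.len e)) :
    (s = 0 ∧ G.pt e s = Space.vertex (G.src e)) ∨
    (s = G.len e ∧ G.pt e s = Space.vertex (G.tgt e)) ∨
    ∃ h : s ∈ Ioo 0 (G.len e), G.pt e s = Space.inner e ⟨s, h⟩ := by
  rcases hs.1.eq_or_lt with h | h
  · subst h; exact Or.inl ⟨rfl, pt_zero e⟩
  rcases hs.2.eq_or_lt with h' | h'
  · subst h'; exact Or.inr (Or.inl ⟨rfl, pt_len e⟩)
  · exact Or.inr (Or.inr ⟨⟨h, h'⟩, pt_inner e ⟨s, h, h'⟩⟩)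

theorem exists_test_inner (e₀ : G.E) (t₀ : Ioo (0 : ℝ) (G.len e₀)) :
    ∃ φ : G.Space → ℝ, (∀ e, ∀ s ∈ Icc 0 (G.len e), ∀ t ∈ Icc 0 (G.len e),
      |φ (G.pt e s) - φ (G.pt e t)| ≤ |s - t|) ∧
      ∀ y, φ (Space.inner e₀ t₀) = φ y → Space.inner e₀ t₀ = y := by
  classical
  obtain ⟨t₀, h₀, h₁⟩ := t₀
  set r := min t₀ (G.len e₀ - t₀) with hr
  have hrpos : 0 < r := lt_min h₀ (sub_pos.mpr h₁)
  have hr1 : r ≤ t₀ := min_le_left _ _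
  have hr2 : r ≤ G.len e₀ - t₀ := min_le_right _ _
  let φ : G.Space → ℝ := fun x => match x with
    | Space.vertex _ => 0
    | Space.inner e t => if e = e₀ then max 0 (r - |(t : ℝ) - t₀|) else 0
  have hφ : ∀ e, ∀ s ∈ Icc 0 (G.len e),
      φ (G.pt e s) = if e = e₀ then max 0 (r - |s - t₀|) else 0 := by
    intro e s hs
    rcases pt_cases e hs with ⟨rfl, h⟩ | ⟨rfl, h⟩ | ⟨hs', h⟩
    · rw [h]
      split_ifs with he
      · rw [zero_sub, abs_neg, abs_of_pos h₀, max_eq_left (by linarith)]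
      · rfl
    · rw [h]
      split_ifs with he
      · subst he
        rw [abs_of_pos (by linarith), max_eq_left (by linarith)]
      · rfl
    · rw [h]
  refine ⟨φ, ?_, ?_⟩
  · intro e s hs t ht
    rw [hφ e s hs, hφ e t ht]
    split_ifs with he
    · refine (abs_max_sub_max_le_max _ _ _ _).trans ?_
      rw [sub_self, abs_zero, max_eq_right (abs_nonneg _)]
      rw [sub_sub_sub_cancel_left, abs_sub_comm s t]
      refine (abs_abs_sub_abs_le_abs_sub _ _).trans ?_
      rw [sub_sub_sub_cancel_right]
    · simp
  · intro y hy
    have hx : φ (Space.inner e₀ ⟨t₀, h₀, h₁⟩) = r := by simp [φ, hrpos.le]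
    rw [hx] at hy
    rcases y with v | ⟨e, t⟩
    · exact absurd hy hrpos.ne'
    · by_cases he : e = e₀
      · subst he
        simp only [φ, if_true] at hy
        have h0 : |(t : ℝ) - t₀| = 0 := by
          rcases max_choice 0 (r - |(t : ℝ) - t₀|) with h | h <;> rw [h] at hy <;> linarith
        have : (t : ℝ) = t₀ := sub_eq_zero.mp (abs_eq_zero.mp h0)
        congr 1
        exact Subtype.ext this.symm
      · simp only [φ, if_neg he] at hy
        exact absurd hy hrpos.ne'

theorem exists_test_vertex (v : G.V) :
    ∃ φ : G.Space → ℝ, (∀ e, ∀ s ∈ Icc 0 (G.len e), ∀ t ∈ Icc 0 (G.len e),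
      |φ (G.pt e s) - φ (G.pt e t)| ≤ |s - t|) ∧
      ∀ u, φ (Space.vertex v) = φ (Space.vertex u) → v = u := by
  classical
  obtain ⟨c, hc, hcl⟩ : ∃ c : ℝ, 0 < c ∧ ∀ e, c ≤ G.len e := by
    rcases isEmpty_or_nonempty G.E with h | h
    · exact ⟨1, one_pos, fun e => h.elim e⟩
    · obtain ⟨e, he⟩ := Finite.exists_min G.len
      exact ⟨G.len e, G.len_pos e, he⟩
  let a : G.V → ℝ := fun u => if u = v then 1 else 0
  let φ : G.Space → ℝ := fun x => match x with
    | Space.vertex u => c * a u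
    | Space.inner e t =>
      c * (a (G.src e) + (a (G.tgt e) - a (G.src e)) * ((t : ℝ) / G.len e))
  have hφ : ∀ e, ∀ s ∈ Icc 0 (G.len e),
      φ (G.pt e s) = c * (a (G.src e) + (a (G.tgt e) - a (G.src e)) * (s / G.len e)) := by
    intro e s hs
    rcases pt_cases e hs with ⟨rfl, h⟩ | ⟨rfl, h⟩ | ⟨hs', h⟩
    · rw [h]; simp [φ]
    · rw [h, div_self (G.len_pos e).ne']; simp [φ]
    · rw [h]
  refine ⟨φ, ?_, ?_⟩
  · intro e s hs t ht
    rw [hφ e s hs, hφ e t ht]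
    have hl := G.len_pos e
    have h1 : |a (G.tgt e) - a (G.src e)| ≤ 1 := by
      simp only [a]; split_ifs <;> simp
    have h2 : c * (a (G.src e) + (a (G.tgt e) - a (G.src e)) * (s / G.len e)) -
        c * (a (G.src e) + (a (G.tgt e) - a (G.src e)) * (t / G.len e)) =
        (c / G.len e) * (a (G.tgt e) - a (G.src e)) * (s - t) := by
      field_simp; ring
    rw [h2, abs_mul, abs_mul, abs_of_pos (div_pos hc hl)]
    have h3 : c / G.len e ≤ 1 := (div_le_one hl).mpr (hcl e)
    have h4 : c / G.len e * |a (G.tgt e) - a (G.src e)| ≤ 1 :=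
      mul_le_one₀ h3 (abs_nonneg _) h1
    exact mul_le_of_le_one_left (abs_nonneg _) h4
  · intro u hu
    by_contra hne
    simp [φ, a, Ne.symm hne, hc.ne'] at hu

theorem bddBelow_joined (x y : G.Space) : BddBelow {L | Joined x y L} :=
  ⟨0, fun _ h => Joined.nonneg h⟩

/-- The path metric: the distance between two points is the infimum of the lengths of the
piecewise linear paths that join them. -/
instance instMetricSpaceSpace (G : MetricGraph) : MetricSpace G.Space where
  dist x y := sInf {L | Joined x y L}
  dist_self x := le_antisymm (csInf_le (bddBelow_joined x x) Joined.refl)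
    (Real.sInf_nonneg fun _ h => Joined.nonneg h)
  dist_comm x y := by
    congr 1
    exact Set.ext fun L => ⟨Joined.symm, Joined.symm⟩
  dist_triangle x y z := by
    refine le_of_forall_pos_le_add fun ε hε => ?_
    obtain ⟨L, hL, hL'⟩ := Real.lt_sInf_add_pos (exists_joined x y) (half_pos hε)
    obtain ⟨M, hM, hM'⟩ := Real.lt_sInf_add_pos (exists_joined y z) (half_pos hε)
    have := csInf_le (bddBelow_joined x z) (Joined.trans hL hM)
    change sInf {L | Joined x z L} ≤ sInf {L | Joined x y L} + sInf {L | Joined y z L} + ε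
    change L < sInf {L | Joined x y L} + ε / 2 at hL'
    change M < sInf {L | Joined y z L} + ε / 2 at hM'
    linarith
  eq_of_dist_eq_zero := by
    intro x y h
    change sInf {L | Joined x y L} = 0 at h
    have key : ∀ φ : G.Space → ℝ, (∀ e, ∀ s ∈ Icc 0 (G.len e), ∀ t ∈ Icc 0 (G.len e),
        |φ (G.pt e s) - φ (G.pt e t)| ≤ |s - t|) → φ x = φ y := by
      intro φ hφ
      have h1 : |φ x - φ y| ≤ sInf {L | Joined x y L} :=
        le_csInf (exists_joined x y) fun L hL => Joined.abs_sub_le φ hφ hL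
      rw [h] at h1
      exact sub_eq_zero.mp (abs_eq_zero.mp (le_antisymm h1 (abs_nonneg _)))
    rcases x with v | ⟨e, t⟩
    · rcases y with u | ⟨e', t'⟩
      · obtain ⟨φ, h1, h2⟩ := exists_test_vertex v
        rw [h2 u (key φ h1)]
      · obtain ⟨φ, h1, h2⟩ := exists_test_inner e' t'
        exact (h2 _ (key φ h1).symm).symm
    · obtain ⟨φ, h1, h2⟩ := exists_test_inner e t
      exact h2 _ (key φ h1)

/-- The rose with `n` petals. -/
def rose (n : ℕ) : MetricGraph where
  V := Unit
  E := Fin n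
  src _ := ()
  tgt _ := ()
  len _ := 1
  len_pos _ := one_pos
  connected _ _ := Relation.EqvGen.refl _

/-- The base point of the rose, its vertex. -/
def roseBase (n : ℕ) : (rose n).Space := Space.vertex ()

end MetricGraph

open MetricGraph

/-- The free group `F_n`, as the fundamental group of the rose with `n` petals. -/
abbrev RoseGroup (n : ℕ) : Type := FundamentalGroup (rose n).Space (roseBase n)

/-- A marked metric graph of rank `n`: a finite connected metric graph all of whose vertices have
valence at least two, with a homotopy equivalence from the rose with `n` petals, the marking. -/
structure MarkedMetricGraph (n : ℕ) extends MetricGraph where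
  two_le_valence : ∀ v, 2 ≤ toMetricGraph.valence v
  marking : ContinuousMap.HomotopyEquiv (rose n).Space toMetricGraph.Space

/-- Free homotopy of two loops: a homotopy through loops, the base point being allowed to move. -/
def FreelyHomotopic {X : Type*} [TopologicalSpace X] {x y : X} (p : Path x x) (q : Path y y) :
    Prop :=
  ContinuousMap.HomotopicWith p.toContinuousMap q.toContinuousMap (fun c : C(I, X) => c 0 = c 1)

/-- The length of a path in a metric space. -/
def pathLength {X : Type*} [MetricSpace X] {x y : X} (p : Path x y) : ℝ≥0∞ :=
  eVariationOn (p : I → X) univ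

namespace MarkedMetricGraph

variable {n : ℕ}

/-- `l_A(w)`: the infimum of the lengths of the loops in `A` in the free homotopy class that
corresponds to `w` under the marking. (A point of the universal cover `T_A` over `x` is a homotopy
class of paths ending at `x`, and its distance to its translate by `w` is the infimum of the
lengths of the loops at `x` in the corresponding class, so this is the translation length of `w`
in `T_A`.) -/
def translationLength (A : MarkedMetricGraph n) (w : RoseGroup n) : ℝ≥0∞ :=
  ⨅ (p : Path (roseBase n) (roseBase n))
    (_ : FundamentalGroup.fromPath (Path.Homotopic.Quotient.mk p) = w)
    (y : A.Space) (q : Path y y)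
    (_ : FreelyHomotopic (p.map A.marking.toFun.continuous) q), pathLength q

/-- The right hand factor `Λ_R(A, B) = sup_{1 ≠ w} l_B(w) / l_A(w)`. -/
def rightFactor (A B : MarkedMetricGraph n) : ℝ≥0∞ :=
  ⨆ (w : RoseGroup n) (_ : w ≠ 1), B.translationLength w / A.translationLength w

/-- `f : A → B` is in the homotopy class of `τ_B τ_A⁻¹`: the triangle formed by `f` and the two
markings commutes up to free homotopy. -/
def RespectsMarkings (A B : MarkedMetricGraph n) (f : C(A.Space, B.Space)) : Prop :=
  (f.comp A.marking.toFun).Homotopic B.marking.toFun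

end MarkedMetricGraph

/-- A `PL`-map: a continuous map that is linear on every edge, that is, on every edge `e`,
parametrised by arc length, it is a local geodesic traversed at a constant speed `speed e ≥ 0`
(constant if `speed e = 0`). The speeds are determined by the map. -/
structure PLMap (A B : MetricGraph) where
  toMap : C(A.Space, B.Space)
  speed : A.E → ℝ≥0
  linear : ∀ e, ∀ t ∈ Icc 0 (A.len e), ∃ ε > 0, ∀ x ∈ Icc 0 (A.len e), ∀ y ∈ Icc 0 (A.len e),
    |x - t| < ε → |y - t| < ε →
      dist (toMap (A.pt e x)) (toMap (A.pt e y)) = speed e * |x - y|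

namespace PLMap

variable {A B : MetricGraph}

/-- `S_f`, the stretching factor of `f`: the maximum of the speeds on the edges. -/
def stretch (f : PLMap A B) : ℝ≥0 := Finset.univ.sup f.speed

/-- `A_max(f)`, the subgraph of `A` whose edges are stretched maximally. -/
def maxSubgraph (f : PLMap A B) : Set A.Space :=
  ⋃ (e : A.E) (_ : f.speed e = f.stretch), A.closedEdge e

end PLMap

/-- A loop, as a map from the circle to a graph, is cyclically reduced if it is an immersion, that
is, locally injective. -/
def CyclicallyReduced {G : MetricGraph} (γ : C(AddCircle (1 : ℝ), G.Space)) : Prop :=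
  IsLocallyInjective γ

end

noncomputable section

open Filter Topology

/-- In polar coordinates around `c`, the ball of radius `ρ` looks like a star:
`dir` records the arm on which a point lies. -/
def IsStar {X D : Type*} [MetricSpace X] (c : X) (ρ : ℝ) (dir : X → D) : Prop :=
  ∀ y z, dist c y < ρ → dist c z < ρ →
    (dir y = dir z → dist y z = |dist c y - dist c z|) ∧
    (dir y ≠ dir z → dist y z = dist c y + dist c z)

namespace MetricGraph

variable {G : MetricGraph}

theorem dist_le_of_joined {x y : G.Space} {L : ℝ} (h : Joined x y L) : dist x y ≤ L :=
  csInf_le (bddBelow_joined x y) h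

theorem exists_joined_lt {x y : G.Space} {L : ℝ} (h : dist x y < L) :
    ∃ M < L, Joined x y M := by
  obtain ⟨M, hM, hM'⟩ := exists_lt_of_csInf_lt (exists_joined x y) h
  exact ⟨M, hM', hM⟩

theorem dist_pt_le (e : G.E) {s t : ℝ} (hs : s ∈ Icc 0 (G.len e)) (ht : t ∈ Icc 0 (G.len e)) :
    dist (G.pt e s) (G.pt e t) ≤ |s - t| :=
  dist_le_of_joined (Joined.single e hs ht)

theorem dist_map_le {Y : Type*} [PseudoMetricSpace Y] {K : ℝ} (hK : 0 ≤ K) (F : G.Space → Y)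
    (hF : ∀ e, ∀ s ∈ Icc 0 (G.len e), ∀ t ∈ Icc 0 (G.len e),
      dist (F (G.pt e s)) (F (G.pt e t)) ≤ K * |s - t|) (x y : G.Space) :
    dist (F x) (F y) ≤ K * dist x y := by
  have key : ∀ {x y : G.Space} {L : ℝ}, Joined x y L → dist (F x) (F y) ≤ K * L := by
    intro x y L h
    induction h with
    | refl => simp
    | step e hs ht h ih =>
      rw [mul_add]
      exact (dist_triangle _ _ _).trans (add_le_add ih (hF e _ hs _ ht))
  refine le_of_forall_pos_le_add fun ε hε => ?_
  obtain ⟨M, hM, hJ⟩ := exists_joined_lt (x := x) (y := y) (L := dist x y + ε / (K + 1))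
    (by have := div_pos hε (show 0 < K + 1 by linarith); linarith)
  have h1 : K * M ≤ K * (dist x y + ε / (K + 1)) := by gcongr
  have h2 : K * (ε / (K + 1)) ≤ ε := by
    rw [mul_div_assoc', div_le_iff₀ (by linarith)]; nlinarith
  have := key hJ
  linarith [mul_add K (dist x y) (ε / (K + 1))]

theorem abs_sub_le_dist (φ : G.Space → ℝ)
    (hφ : ∀ e, ∀ s ∈ Icc 0 (G.len e), ∀ t ∈ Icc 0 (G.len e),
      |φ (G.pt e s) - φ (G.pt e t)| ≤ |s - t|) (x y : G.Space) : |φ x - φ y| ≤ dist x y := by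
  have := dist_map_le zero_le_one φ (by simpa [Real.dist_eq] using hφ) x y
  simpa [Real.dist_eq] using this

/-- The map on the realisation with given values on the vertices and on the edges. -/
def edgeMap {Y : Type*} (a : G.V → Y) (q : G.E → ℝ → Y) : G.Space → Y
  | Space.vertex v => a v
  | Space.inner e t => q e t

theorem edgeMap_pt {Y : Type*} {a : G.V → Y} {q : G.E → ℝ → Y}
    (h0 : ∀ e, q e 0 = a (G.src e)) (h1 : ∀ e, q e (G.len e) = a (G.tgt e)) (e : G.E) {t : ℝ}
    (ht : t ∈ Icc 0 (G.len e)) : edgeMap a q (G.pt e t) = q e t := by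
  rcases pt_cases e ht with ⟨rfl, h⟩ | ⟨rfl, h⟩ | ⟨h', h⟩ <;> rw [h]
  · exact (h0 e).symm
  · exact (h1 e).symm
  · rfl

theorem exists_radius (G : MetricGraph) : ∃ ρ > 0, ∀ e, 4 * ρ ≤ G.len e := by
  rcases isEmpty_or_nonempty G.E with h | h
  · exact ⟨1, one_pos, fun e => h.elim e⟩
  · obtain ⟨e, he⟩ := Finite.exists_min G.len
    exact ⟨G.len e / 4, by have := G.len_pos e; positivity, fun e' => by linarith [he e']⟩

/-- A radius at which the stars around the vertices are disjoint. -/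
def rad (G : MetricGraph) : ℝ := (exists_radius G).choose

theorem rad_pos (G : MetricGraph) : 0 < G.rad := (exists_radius G).choose_spec.1

theorem four_rad_le (e : G.E) : 4 * G.rad ≤ G.len e := (exists_radius G).choose_spec.2 e

/-- The vertex at which a half-edge starts. -/
def base (h : G.E × Bool) : G.V := if h.2 then G.tgt h.1 else G.src h.1

/-- The half-edge `h` followed from its starting point. -/
def arm (h : G.E × Bool) (s : ℝ) : G.Space := G.pt h.1 (if h.2 then G.len h.1 - s else s)

/-- The oppositely oriented half-edge. -/
def opp (h : G.E × Bool) : G.E × Bool := (h.1, !h.2)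

theorem arm_zero (h : G.E × Bool) : arm h 0 = Space.vertex (base h) := by
  rcases h with ⟨e, _ | _⟩ <;> simp [arm, base, pt_zero, pt_len]

theorem arm_opp (h : G.E × Bool) (s : ℝ) : arm (opp h) s = arm h (G.len h.1 - s) := by
  rcases h with ⟨e, _ | _⟩ <;> simp [arm, opp]

theorem arm_mem {h : G.E × Bool} {s : ℝ} (hs : s ∈ Icc 0 (G.len h.1)) :
    (if h.2 then G.len h.1 - s else s) ∈ Icc 0 (G.len h.1) := by
  split_ifs
  · exact ⟨by linarith [hs.2], by linarith [hs.1]⟩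
  · exact hs

theorem arm_sub (h : G.E × Bool) (s t : ℝ) :
    |(if h.2 then G.len h.1 - s else s) - (if h.2 then G.len h.1 - t else t)| = |s - t| := by
  split_ifs
  · rw [sub_sub_sub_cancel_left, abs_sub_comm]
  · rfl

theorem dist_arm_le (h : G.E × Bool) {s t : ℝ} (hs : s ∈ Icc 0 (G.len h.1))
    (ht : t ∈ Icc 0 (G.len h.1)) : dist (arm h s) (arm h t) ≤ |s - t| := by
  have := dist_pt_le h.1 (arm_mem hs) (arm_mem ht)
  rwa [arm_sub] at this

theorem abs_tent_sub_le (ρ s t : ℝ) :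
    |max 0 (ρ - |s - ρ|) - max 0 (ρ - |t - ρ|)| ≤ |s - t| := by
  refine (abs_max_sub_max_le_max _ _ _ _).trans ?_
  rw [sub_self, abs_zero, max_eq_right (abs_nonneg _), sub_sub_sub_cancel_left, abs_sub_comm s t]
  refine (abs_abs_sub_abs_le_abs_sub _ _).trans ?_
  rw [sub_sub_sub_cancel_right]

theorem exists_arm_test (w : G.E × Bool → ℝ) (hw : ∀ h, |w h| ≤ 1) :
    ∃ φ : G.Space → ℝ, (∀ x y, |φ x - φ y| ≤ dist x y) ∧
      ∀ h, ∀ s ∈ Icc 0 G.rad, φ (arm h s) = w h * s := by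
  set ρ := G.rad with hρ
  have hρ0 : 0 < ρ := G.rad_pos
  let T : ℝ → ℝ := fun u => max 0 (ρ - |u - ρ|)
  have T0 : T 0 = 0 := by simp [T, abs_of_pos hρ0]
  have Tbig : ∀ u, 2 * ρ ≤ u → T u = 0 := by
    intro u hu
    simp only [T]
    rw [abs_of_nonneg (by linarith), max_eq_left (by linarith)]
  have Tsmall : ∀ u ∈ Icc 0 ρ, T u = u := by
    intro u hu
    simp only [T]
    rw [abs_of_nonpos (by linarith [hu.2]), max_eq_right (by linarith [hu.1])]; ring
  let q : G.E → ℝ → ℝ := fun e t => w (e, false) * T t + w (e, true) * T (G.len e - t)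
  have q0 : ∀ e, q e 0 = 0 := fun e => by
    simp [q, T0, Tbig (G.len e) (by linarith [four_rad_le e])]
  have q1 : ∀ e, q e (G.len e) = 0 := fun e => by
    simp [q, T0, Tbig (G.len e) (by linarith [four_rad_le e])]
  have hpt := fun e t ht => edgeMap_pt (a := fun _ => (0 : ℝ)) q0 q1 e (t := t) ht
  have half : ∀ h : G.E × Bool, ∀ s ∈ Icc 0 (G.len h.1 / 2),
      edgeMap (fun _ => 0) q (arm h s) = w h * T s := by
    rintro ⟨e, _ | _⟩ s ⟨hs0, hs1⟩ <;> have h4 := four_rad_le e <;> dsimp only at hs1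
    · rw [arm, hpt _ _ (by constructor <;> simp <;> linarith)]
      simp [q, Tbig (G.len e - s) (by linarith)]
    · rw [arm, hpt _ _ (by constructor <;> simp <;> linarith)]
      simp [q, Tbig (G.len e - s) (by linarith)]
  refine ⟨edgeMap (fun _ => 0) q, abs_sub_le_dist _ ?_, ?_⟩
  · have hh : ∀ h : G.E × Bool, ∀ s ∈ Icc 0 (G.len h.1 / 2), ∀ t ∈ Icc 0 (G.len h.1 / 2),
        |edgeMap (fun _ => 0) q (arm h s) - edgeMap (fun _ => 0) q (arm h t)| ≤ |s - t| := by
      intro h s hs t ht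
      rw [half h s hs, half h t ht, ← mul_sub, abs_mul]
      exact (mul_le_of_le_one_left (abs_nonneg _) (hw h)).trans (abs_tent_sub_le _ _ _)
    intro e
    have hl := G.len_pos e
    have c1 : ∀ s ∈ Icc 0 (G.len e / 2), ∀ t ∈ Icc 0 (G.len e / 2),
        |edgeMap (fun _ => 0) q (G.pt e s) - edgeMap (fun _ => 0) q (G.pt e t)| ≤ |s - t| :=
      hh (e, false)
    have c2 : ∀ s ∈ Icc (G.len e / 2) (G.len e), ∀ t ∈ Icc (G.len e / 2) (G.len e),
        |edgeMap (fun _ => 0) q (G.pt e s) - edgeMap (fun _ => 0) q (G.pt e t)| ≤ |s - t| := by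
      intro s hs t ht
      have := hh (e, true) (G.len e - s) ⟨by linarith [hs.2], by dsimp; linarith [hs.1]⟩
        (G.len e - t) ⟨by linarith [ht.2], by dsimp; linarith [ht.1]⟩
      simp only [arm, if_true, sub_sub_cancel] at this
      rwa [sub_sub_sub_cancel_left, abs_sub_comm t s] at this
    have c3 : ∀ s ∈ Icc 0 (G.len e), ∀ t ∈ Icc 0 (G.len e), s ≤ t →
        |edgeMap (fun _ => 0) q (G.pt e s) - edgeMap (fun _ => 0) q (G.pt e t)| ≤ |s - t| := by
      intro s hs t ht hst
      rcases le_total t (G.len e / 2) with h | h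
      · exact c1 s ⟨hs.1, hst.trans h⟩ t ⟨ht.1, h⟩
      rcases le_total (G.len e / 2) s with h' | h'
      · exact c2 s ⟨h', hs.2⟩ t ⟨h, ht.2⟩
      · have a1 := c1 s ⟨hs.1, h'⟩ (G.len e / 2) ⟨by linarith, le_rfl⟩
        have a2 := c2 (G.len e / 2) ⟨le_rfl, by linarith⟩ t ⟨h, ht.2⟩
        rw [abs_of_nonpos (by linarith : s - G.len e / 2 ≤ 0)] at a1
        rw [abs_of_nonpos (by linarith : G.len e / 2 - t ≤ 0)] at a2
        rw [abs_of_nonpos (by linarith : s - t ≤ 0)]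
        exact (abs_sub_le _ _ _).trans (by linarith)
    intro s hs t ht
    rcases le_total s t with h | h
    · exact c3 s hs t ht h
    · rw [abs_sub_comm, abs_sub_comm s t]; exact c3 t ht s hs h
  · intro h s hs
    rw [half h s ⟨hs.1, by linarith [hs.2, four_rad_le h.1]⟩, Tsmall s hs]

theorem dist_arm_arm {h h' : G.E × Bool} (hb : base h = base h') {s t : ℝ}
    (hs : s ∈ Icc 0 G.rad) (ht : t ∈ Icc 0 G.rad) :
    (h = h' → dist (arm h s) (arm h' t) = |s - t|) ∧
    (h ≠ h' → dist (arm h s) (arm h' t) = s + t) := by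
  classical
  have mem : ∀ k : G.E × Bool, ∀ u ∈ Icc 0 G.rad, u ∈ Icc 0 (G.len k.1) := fun k u hu =>
    ⟨hu.1, by linarith [hu.2, four_rad_le k.1, G.rad_pos]⟩
  constructor
  · rintro rfl
    refine le_antisymm (dist_arm_le h (mem _ _ hs) (mem _ _ ht)) ?_
    obtain ⟨φ, h1, h2⟩ := exists_arm_test (G := G) (fun _ => 1) (by simp)
    simpa [h2 _ _ hs, h2 _ _ ht] using h1 (arm h s) (arm h t)
  · intro hne
    refine le_antisymm ?_ ?_
    · refine (dist_triangle _ (Space.vertex (base h)) _).trans (add_le_add ?_ ?_)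
      · rw [← arm_zero]
        refine (dist_arm_le h (mem _ _ hs) (zero_mem _)).trans ?_
        rw [sub_zero, abs_of_nonneg hs.1]
      · rw [hb, ← arm_zero]
        refine (dist_arm_le h' (zero_mem _) (mem _ _ ht)).trans ?_
        rw [zero_sub, abs_neg, abs_of_nonneg ht.1]
    · obtain ⟨φ, h1, h2⟩ := exists_arm_test (G := G) (fun k => if k = h then 1 else -1)
        (by intro k; split_ifs <;> simp)
      have := h1 (arm h s) (arm h' t)
      rw [h2 _ _ hs, h2 _ _ ht, if_pos rfl, if_neg hne.symm, one_mul, neg_one_mul,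
        sub_neg_eq_add] at this
      exact (le_abs_self _).trans this

theorem dist_vertex_arm (h : G.E × Bool) {s : ℝ} (hs : s ∈ Icc 0 G.rad) :
    dist (Space.vertex (base h)) (arm h s) = s := by
  rw [← arm_zero, (dist_arm_arm rfl ⟨le_rfl, G.rad_pos.le⟩ hs).1 rfl, zero_sub, abs_neg,
    abs_of_nonneg hs.1]

theorem arm_of_dist_lt {v : G.V} {x : G.Space} (hx : dist (Space.vertex v) x < G.rad) :
    x = Space.vertex v ∨ ∃ h, base h = v ∧ ∃ s ∈ Ioo 0 G.rad, x = arm h s := by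
  classical
  set ρ := G.rad with hρ
  have hρ0 : 0 < ρ := G.rad_pos
  let a : G.V → ℝ := fun u => if u = v then 0 else ρ
  let q : G.E → ℝ → ℝ := fun e t => min ρ (min (if G.src e = v then t else ρ)
    (if G.tgt e = v then G.len e - t else ρ))
  have q0 : ∀ e, q e 0 = a (G.src e) := fun e => by
    have := four_rad_le e
    simp only [q, a]
    rw [← hρ] at this
    simp only [min_def]
    split_ifs <;> linarith
  have q1 : ∀ e, q e (G.len e) = a (G.tgt e) := fun e => by
    have := four_rad_le e
    simp only [q, a]
    rw [← hρ] at this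
    simp only [min_def]
    split_ifs <;> linarith
  have lip : ∀ x y, |edgeMap a q x - edgeMap a q y| ≤ dist x y := by
    refine abs_sub_le_dist _ fun e s hs t ht => ?_
    rw [edgeMap_pt q0 q1 e hs, edgeMap_pt q0 q1 e ht]
    refine (abs_min_sub_min_le_max _ _ _ _).trans (max_le (by simp) ?_)
    refine (abs_min_sub_min_le_max _ _ _ _).trans (max_le ?_ ?_) <;> split_ifs
    · rfl
    · simp
    · rw [sub_sub_sub_cancel_left, abs_sub_comm]
    · simp
  have h1 := lip (Space.vertex v) x
  have h2 : edgeMap a q (Space.vertex v) = 0 := by simp [edgeMap, a]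
  rw [h2, zero_sub, abs_neg] at h1
  have h3 : edgeMap a q x < ρ := ((le_abs_self _).trans h1).trans_lt hx
  rcases x with u | ⟨e, t⟩
  · left
    simp only [edgeMap, a] at h3
    split_ifs at h3 with h
    · rw [h]
    · exact absurd h3 (lt_irrefl _)
  · right
    simp only [edgeMap, q] at h3
    rcases min_lt_iff.1 h3 with h | h
    · exact absurd h (lt_irrefl _)
    rcases min_lt_iff.1 h with h | h <;> split_ifs at h with h'
    · exact ⟨(e, false), h', t, ⟨t.2.1, h⟩, by simp [arm, pt_inner]⟩
    · exact absurd h (lt_irrefl _)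
    · exact ⟨(e, true), h', G.len e - t, ⟨by linarith [t.2.2], h⟩, by simp [arm, pt_inner]⟩
    · exact absurd h (lt_irrefl _)

theorem inner_of_dist_lt {e : G.E} {u : ℝ} (hu : u ∈ Ioo 0 (G.len e)) {x : G.Space}
    (hx : dist (G.pt e u) x < min u (G.len e - u)) :
    ∃ t : Ioo (0 : ℝ) (G.len e), x = Space.inner e t ∧ dist (G.pt e u) x = |u - t| := by
  classical
  set R := min u (G.len e - u) with hR
  have R1 : R ≤ u := min_le_left _ _
  have R2 : R ≤ G.len e - u := min_le_right _ _
  have R0 : 0 < R := lt_min hu.1 (by linarith [hu.2])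
  let q : G.E → ℝ → ℝ := fun e' t => if e' = e then max 0 (R - |t - u|) else 0
  have q0 : ∀ e', q e' 0 = 0 := fun e' => by
    simp only [q]
    split_ifs
    · rw [abs_of_nonpos (by linarith), max_eq_left (by linarith)]
    · rfl
  have q1 : ∀ e', q e' (G.len e') = 0 := fun e' => by
    simp only [q]
    split_ifs with h
    · subst h
      rw [abs_of_nonneg (by linarith), max_eq_left (by linarith)]
    · rfl
  have hpt := fun e t ht => edgeMap_pt (a := fun _ => (0 : ℝ)) q0 q1 e (t := t) ht
  have lip : ∀ x y, |edgeMap (fun _ => 0) q x - edgeMap (fun _ => 0) q y| ≤ dist x y := by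
    refine abs_sub_le_dist _ fun e s hs t ht => ?_
    rw [hpt e s hs, hpt e t ht]
    simp only [q]
    split_ifs
    · refine (abs_max_sub_max_le_max _ _ _ _).trans ?_
      rw [sub_self, abs_zero, max_eq_right (abs_nonneg _), sub_sub_sub_cancel_left,
        abs_sub_comm s t]
      refine (abs_abs_sub_abs_le_abs_sub _ _).trans ?_
      rw [sub_sub_sub_cancel_right]
    · simp
  have hu' : u ∈ Icc 0 (G.len e) := ⟨hu.1.le, hu.2.le⟩
  have h1 := lip (G.pt e u) x
  rw [hpt e u hu'] at h1
  have h2 : q e u = R := by simp [q, R0.le]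
  rw [h2] at h1
  have h3 := ((le_abs_self _).trans h1).trans_lt hx
  rcases x with v | ⟨e', t⟩
  · simp [edgeMap] at h3
  · by_cases he : e' = e
    · subst he
      refine ⟨t, rfl, le_antisymm ?_ ?_⟩
      · rw [← pt_inner]
        exact dist_pt_le e' hu' ⟨t.2.1.le, t.2.2.le⟩
      · simp only [edgeMap, q, if_true] at h1 h3
        have h4 : 0 < R - |(t : ℝ) - u| := by
          by_contra hc
          rw [max_eq_left (not_lt.1 hc)] at h3
          linarith
        rw [max_eq_right h4.le, sub_sub_cancel, abs_abs, abs_sub_comm] at h1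
        exact h1
    · simp [edgeMap, q, he] at h3

theorem dist_pt_eq {e : G.E} {s t : ℝ} (hs : s ∈ Ioo 0 (G.len e)) (ht : t ∈ Icc 0 (G.len e))
    (h : |s - t| < min s (G.len e - s)) : dist (G.pt e s) (G.pt e t) = |s - t| := by
  have h1 := dist_pt_le e ⟨hs.1.le, hs.2.le⟩ ht
  obtain ⟨u, hu, hd⟩ := inner_of_dist_lt hs (h1.trans_lt h)
  rcases pt_cases e ht with ⟨rfl, h'⟩ | ⟨rfl, h'⟩ | ⟨h', h''⟩
  · rw [h'] at hu; cases hu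
  · rw [h'] at hu; cases hu
  · rw [h''] at hu
    cases hu
    exact hd

/-- The direction of a point seen from the centre `c`, locally. -/
def dirAt : (c : G.Space) → G.Space → Option (G.E × Bool)
  | _, Space.vertex _ => none
  | Space.vertex _, Space.inner e u => some (e, decide (G.len e / 2 < u))
  | Space.inner _ t, Space.inner e u => some (e, decide ((t : ℝ) < u))

theorem dirAt_arm (v : G.V) (h : G.E × Bool) {s : ℝ} (hs : s ∈ Ioo 0 G.rad) :
    dirAt (Space.vertex v) (arm h s) = some h := by
  rcases h with ⟨e, _ | _⟩ <;> have := four_rad_le e <;> obtain ⟨h0, h1⟩ := hs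
  · have : s ∈ Ioo 0 (G.len e) := ⟨h0, by linarith⟩
    simp only [arm]
    rw [if_neg (by simp), pt_inner e ⟨s, this⟩]
    simp only [dirAt]
    rw [decide_eq_false (by linarith)]
  · have : G.len e - s ∈ Ioo 0 (G.len e) := ⟨by linarith, by linarith⟩
    simp only [arm]
    rw [if_pos trivial, pt_inner e ⟨_, this⟩]
    simp only [dirAt]
    rw [decide_eq_true (by linarith)]

theorem isStar_vertex (v : G.V) :
    IsStar (Space.vertex v) G.rad (dirAt (Space.vertex v : G.Space)) := by
  have key : ∀ y : G.Space, dist (Space.vertex v) y < G.rad → y ≠ Space.vertex v →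
      ∃ h, base h = v ∧ ∃ s ∈ Ioo 0 G.rad, y = arm h s ∧ dist (Space.vertex v) y = s ∧
        dirAt (Space.vertex v) y = some h := by
    intro y hy hne
    rcases arm_of_dist_lt hy with h | ⟨h, rfl, s, hs, rfl⟩
    · exact absurd h hne
    · exact ⟨h, rfl, s, hs, rfl, dist_vertex_arm h ⟨hs.1.le, hs.2.le⟩, dirAt_arm _ h hs⟩
  intro y z hy hz
  by_cases hyv : y = Space.vertex v
  · subst hyv
    simp [abs_of_nonneg]
  by_cases hzv : z = Space.vertex v
  · subst hzv
    simp [abs_of_nonneg, dist_comm]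
  obtain ⟨h, hb, s, hs, rfl, hd, hdir⟩ := key y hy hyv
  obtain ⟨h', hb', s', hs', rfl, hd', hdir'⟩ := key z hz hzv
  rw [hd, hd', hdir, hdir']
  have := dist_arm_arm (hb.trans hb'.symm) ⟨hs.1.le, hs.2.le⟩ ⟨hs'.1.le, hs'.2.le⟩
  exact ⟨fun h => this.1 (Option.some_inj.1 h), fun h => this.2 fun h' => h (by rw [h'])⟩

theorem isStar_inner (e : G.E) (t : Ioo (0 : ℝ) (G.len e)) :
    IsStar (Space.inner e t) (min (t : ℝ) (G.len e - t) / 3) (dirAt (Space.inner e t : G.Space)) := by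
  obtain ⟨t, ht⟩ := t
  dsimp only
  set R := min t (G.len e - t) with hR
  have R0 : 0 < R := lt_min ht.1 (by linarith [ht.2])
  have R1 : R ≤ t := min_le_left _ _
  have R2 : R ≤ G.len e - t := min_le_right _ _
  have key : ∀ y : G.Space, dist (Space.inner e ⟨t, ht⟩) y < R / 3 →
      ∃ u : Ioo (0 : ℝ) (G.len e), y = Space.inner e u ∧
        dist (Space.inner e ⟨t, ht⟩) y = |t - u| := by
    intro y hy
    rw [← pt_inner] at hy ⊢
    exact inner_of_dist_lt ht (hy.trans (by linarith))
  intro y z hy hz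
  obtain ⟨u, rfl, hu⟩ := key y hy
  obtain ⟨w, rfl, hw⟩ := key z hz
  rw [hu] at hy ⊢
  rw [hw] at hz ⊢
  have hy' := abs_lt.1 hy
  have hz' := abs_lt.1 hz
  have hd : dist (Space.inner e u : G.Space) (Space.inner e w) = |(u : ℝ) - w| := by
    rw [← pt_inner, ← pt_inner]
    refine dist_pt_eq u.2 ⟨w.2.1.le, w.2.2.le⟩ (lt_min ?_ ?_) <;> rw [abs_lt]
    · constructor <;> linarith
    · constructor <;> linarith
  rw [hd]
  simp only [dirAt, Option.some_inj, Prod.mk.injEq, true_and, ne_eq, decide_eq_decide]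
  constructor
  · intro h
    rcases lt_or_ge t (u : ℝ) with h1 | h1
    · have h2 := h.1 h1
      rw [abs_of_neg (by linarith : t - (u : ℝ) < 0), abs_of_neg (by linarith : t - (w : ℝ) < 0)]
      congr 1; ring
    · have h2 : (w : ℝ) ≤ t := not_lt.1 fun h2 => absurd (h.2 h2) (not_lt.2 h1)
      rw [abs_of_nonneg (by linarith : 0 ≤ t - (u : ℝ)),
        abs_of_nonneg (by linarith : 0 ≤ t - (w : ℝ)), abs_sub_comm]
      congr 1; ring
  · intro h
    rcases lt_or_ge t (u : ℝ) with h1 | h1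
    · have h2 : (w : ℝ) ≤ t := not_lt.1 fun h2 => h ⟨fun _ => h2, fun _ => h1⟩
      rw [abs_of_neg (by linarith : t - (u : ℝ) < 0),
        abs_of_nonneg (by linarith : 0 ≤ t - (w : ℝ)), abs_of_nonneg (by linarith)]
      ring
    · have h2 : t < (w : ℝ) := by
        by_contra h2
        exact h ⟨fun h3 => absurd h3 (not_lt.2 h1), fun h3 => absurd h3 h2⟩
      rw [abs_of_nonneg (by linarith : 0 ≤ t - (u : ℝ)),
        abs_of_neg (by linarith : t - (w : ℝ) < 0), abs_of_nonpos (by linarith)]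
      ring

theorem exists_isStar (c : G.Space) : ∃ ρ > 0, IsStar c ρ (dirAt c) := by
  rcases c with v | ⟨e, t⟩
  · exact ⟨_, G.rad_pos, isStar_vertex v⟩
  · exact ⟨_, div_pos (lt_min t.2.1 (by linarith [t.2.2])) (by norm_num), isStar_inner e t⟩

theorem continuous_pt (e : G.E) : ContinuousOn (G.pt e) (Icc 0 (G.len e)) := by
  have : LipschitzOnWith 1 (G.pt e) (Icc 0 (G.len e)) :=
    LipschitzOnWith.of_dist_le_mul fun s hs t ht => by
      simpa [Real.dist_eq] using dist_pt_le e hs ht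
  exact this.continuousOn

instance instCompactSpace (G : MetricGraph) : CompactSpace G.Space := by
  refine ⟨?_⟩
  have : (univ : Set G.Space) = range (Space.vertex : G.V → G.Space) ∪ ⋃ e, G.closedEdge e := by
    symm
    rw [eq_univ_iff_forall]
    rintro (v | ⟨e, t⟩)
    · exact Or.inl ⟨v, rfl⟩
    · exact Or.inr (mem_iUnion.2 ⟨e, t, ⟨t.2.1.le, t.2.2.le⟩, pt_inner e t⟩)
  rw [this]
  exact (finite_range _).isCompact.union
    (isCompact_iUnion fun e => isCompact_Icc.image_of_continuousOn (continuous_pt e))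

end MetricGraph

/-- Every point has a neighbourhood that looks like a star. -/
def LocallyStar (X : Type*) [MetricSpace X] : Prop :=
  ∀ c : X, ∃ ρ > 0, ∃ (D : Type) (dir : X → D), IsStar c ρ dir

/-- `q` is `K`-Lipschitz on `[0, l]`. -/
def LipPath {X : Type*} [MetricSpace X] (K l : ℝ) (q : ℝ → X) : Prop :=
  ∀ s ∈ Icc 0 l, ∀ t ∈ Icc 0 l, dist (q s) (q t) ≤ K * |s - t|

/-- Any two points are joined by a path whose length is their distance. -/
def GeodesicMetric (X : Type*) [MetricSpace X] : Prop :=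
  ∀ x y : X, ∃ q : ℝ → X, q 0 = x ∧ q (dist x y) = y ∧ LipPath 1 (dist x y) q

section

variable {X : Type*} [MetricSpace X]

theorem IsStar.eq_of_between {D : Type*} {c : X} {ρ : ℝ} {dir : X → D} (h : IsStar c ρ dir)
    {x y z w : X} (hx : dist c x < ρ) (hy : dist c y < ρ) (hz : dist c z < ρ) (hw : dist c w < ρ)
    (h1 : dist x z + dist z y = dist x y) (h2 : dist x w = dist x z) (h3 : dist w y = dist z y) :
    z = w := by
  classical
  have H : ∀ u v, dist c u < ρ → dist c v < ρ →
      (dir u = dir v ∧ (dist u v = dist c u - dist c v ∧ dist c v ≤ dist c u ∨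
        dist u v = dist c v - dist c u ∧ dist c u ≤ dist c v)) ∨
      (dir u ≠ dir v ∧ dist u v = dist c u + dist c v) := by
    intro u v hu hv
    by_cases hd : dir u = dir v
    · left
      refine ⟨hd, ?_⟩
      rw [(h u v hu hv).1 hd]
      rcases le_total (dist c v) (dist c u) with h' | h'
      · exact Or.inl ⟨abs_of_nonneg (by linarith), h'⟩
      · exact Or.inr ⟨by rw [abs_of_nonpos (by linarith)]; ring, h'⟩
    · exact Or.inr ⟨hd, (h u v hu hv).2 hd⟩
  have a := H x y hx hy
  have b := H x z hx hz
  have b' := H z y hz hy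
  have e := H x w hx hw
  have e' := H w y hw hy
  have f := H z w hz hw
  have p1 : 0 ≤ dist c x := dist_nonneg
  have p2 : 0 ≤ dist c y := dist_nonneg
  have p3 : 0 ≤ dist c z := dist_nonneg
  have p4 : 0 ≤ dist c w := dist_nonneg
  clear H h
  rw [← dist_le_zero]
  generalize dist c x = cx at *
  generalize dist c y = cy at *
  generalize dist c z = cz at *
  generalize dist c w = cw at *
  generalize dist x y = xy at *
  generalize dist x z = xz at *
  generalize dist z y = zy at *
  generalize dist x w = xw at *
  generalize dist w y = wy at *
  generalize dist z w = zw at *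
  generalize dir x = dx at *
  generalize dir y = dy at *
  generalize dir z = dz at *
  generalize dir w = dw at *
  grind

theorem exists_uniform_star [CompactSpace X] (hX : LocallyStar X) :
    ∃ r > 0, ∀ x : X, ∃ (c : X) (ρ : ℝ) (D : Type) (dir : X → D), IsStar c ρ dir ∧
      ∀ y, dist x y < r → dist c y < ρ := by
  choose ρ hρ D dir hs using hX
  obtain ⟨r, hr, H⟩ := lebesgue_number_lemma_of_metric (isCompact_univ (X := X))
    (c := fun c => Metric.ball c (ρ c)) (fun c => Metric.isOpen_ball)
    (fun x _ => mem_iUnion.2 ⟨x, Metric.mem_ball_self (hρ x)⟩)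
  refine ⟨r, hr, fun x => ?_⟩
  obtain ⟨c, hc⟩ := H x trivial
  refine ⟨c, ρ c, D c, dir c, hs c, fun y hy => ?_⟩
  have := hc (show y ∈ Metric.ball x r by rwa [Metric.mem_ball, dist_comm])
  rwa [Metric.mem_ball, dist_comm] at this

theorem exists_between_unique [CompactSpace X] (hX : LocallyStar X) :
    ∃ r > 0, ∀ x y z w : X, dist x y < r → dist x z + dist z y = dist x y →
      dist x w = dist x z → dist w y = dist z y → z = w := by
  obtain ⟨r, hr, H⟩ := exists_uniform_star hX
  refine ⟨r, hr, fun x y z w hxy h1 h2 h3 => ?_⟩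
  obtain ⟨c, ρ, D, dir, hs, hb⟩ := H x
  have : dist x z < r := by linarith [dist_nonneg (x := z) (y := y)]
  exact hs.eq_of_between (hb x (by simpa)) (hb y hxy) (hb z this) (hb w (h2 ▸ this)) h1 h2 h3

theorem GeodesicMetric.exists_between (hX : GeodesicMetric X) (x y : X) {s : ℝ}
    (hs : s ∈ Icc (0 : ℝ) 1) :
    ∃ z, dist x z = s * dist x y ∧ dist z y = (1 - s) * dist x y := by
  obtain ⟨q, h0, h1, hq⟩ := hX x y
  have hd : 0 ≤ dist x y := dist_nonneg
  have m : s * dist x y ∈ Icc 0 (dist x y) :=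
    ⟨mul_nonneg hs.1 hd, mul_le_of_le_one_left hd hs.2⟩
  have a := hq 0 ⟨le_rfl, hd⟩ _ m
  have b := hq _ m (dist x y) ⟨hd, le_rfl⟩
  rw [h0, zero_sub, abs_neg, abs_of_nonneg m.1, one_mul] at a
  rw [h1, abs_of_nonpos (by linarith [m.2]), one_mul] at b
  have := dist_triangle x (q (s * dist x y)) y
  exact ⟨_, by linarith, by linarith⟩

/-- In a compact geodesic space that is locally a star, uniformly close maps are homotopic. -/
theorem exists_homotopic_of_dist_lt [CompactSpace X] (hX : LocallyStar X)
    (hg : GeodesicMetric X) :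
    ∃ r > 0, ∀ (Y : Type) [TopologicalSpace Y] (f g : C(Y, X)),
      (∀ y, dist (f y) (g y) < r) → f.Homotopic g := by
  obtain ⟨r, hr, H⟩ := exists_between_unique hX
  refine ⟨r, hr, fun Y _ f g hfg => ?_⟩
  choose mid hmid1 hmid2 using fun (p : I × Y) =>
    hg.exists_between (f p.2) (g p.2) (s := (p.1 : ℝ)) ⟨p.1.2.1, p.1.2.2⟩
  have cont : Continuous mid := by
    rw [continuous_iff_ultrafilter]
    intro p u hu
    obtain ⟨z, -, hz⟩ := isCompact_univ.ultrafilter_le_nhds (u.map mid) (by simp)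
    have hz' : Tendsto mid u (𝓝 z) := hz
    have c1 : Tendsto (fun p : I × Y => f p.2) u (𝓝 (f p.2)) :=
      ((f.continuous.comp continuous_snd).tendsto p).mono_left hu
    have c2 : Tendsto (fun p : I × Y => g p.2) u (𝓝 (g p.2)) :=
      ((g.continuous.comp continuous_snd).tendsto p).mono_left hu
    have c3 : Tendsto (fun p : I × Y => (p.1 : ℝ)) u (𝓝 (p.1 : ℝ)) :=
      ((continuous_subtype_val.comp continuous_fst).tendsto p).mono_left hu
    have e1 : dist (f p.2) z = p.1 * dist (f p.2) (g p.2) := by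
      refine tendsto_nhds_unique (c1.dist hz') ?_
      simp_rw [hmid1]
      exact c3.mul (c1.dist c2)
    have e2 : dist z (g p.2) = (1 - p.1) * dist (f p.2) (g p.2) := by
      refine tendsto_nhds_unique (hz'.dist c2) ?_
      simp_rw [hmid2]
      exact (c3.const_sub 1).mul (c1.dist c2)
    have := H (f p.2) (g p.2) (mid p) z (hfg _) (by rw [hmid1, hmid2]; ring) (by rw [e1, hmid1])
      (by rw [e2, hmid2])
    rwa [this]
  refine ⟨⟨⟨mid, cont⟩, fun y => ?_, fun y => ?_⟩⟩
  · have := hmid1 (0, y)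
    simp only [Icc.coe_zero, zero_mul, dist_eq_zero] at this
    exact this.symm
  · have := hmid2 (1, y)
    simp only [Icc.coe_one, sub_self, zero_mul, dist_eq_zero] at this
    exact this

/-- `α` is a geodesic of speed `S` on a short interval `[0, ε)`. -/
def IsGerm (S : ℝ) (α : ℝ → X) : Prop :=
  ∃ ε > 0, ∀ s ∈ Ico 0 ε, ∀ t ∈ Ico 0 ε, dist (α s) (α t) = S * |s - t|

theorem IsStar.dir_germ {D : Type*} {c : X} {ρ : ℝ} (hρ : 0 < ρ) {dir : X → D}
    (h : IsStar c ρ dir) {S : ℝ} (hS : 0 < S) {α : ℝ → X} (hα : IsGerm S α) (h0 : α 0 = c) :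
    ∃ ε > 0, (∀ s ∈ Ico 0 ε, dist c (α s) = S * s) ∧ S * ε ≤ ρ ∧
      ∃ d, ∀ s ∈ Ioo 0 ε, dir (α s) = d := by
  obtain ⟨ε, hε, H⟩ := hα
  set ε' := min ε (ρ / S) with hε'
  have e1 : ε' ≤ ε := min_le_left _ _
  have e2 : S * ε' ≤ ρ := by
    rw [mul_comm, ← le_div_iff₀ hS]; exact min_le_right _ _
  have e0 : 0 < ε' := lt_min hε (by positivity)
  have hd : ∀ s ∈ Ico 0 ε', dist c (α s) = S * s := by
    intro s hs
    rw [← h0, H 0 ⟨le_rfl, hε⟩ s ⟨hs.1, hs.2.trans_le e1⟩, zero_sub, abs_neg, abs_of_nonneg hs.1]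
  refine ⟨ε', e0, hd, e2, dir (α (ε' / 2)), fun s hs => ?_⟩
  by_contra hne
  have m : ε' / 2 ∈ Ico 0 ε' := ⟨by linarith, by linarith⟩
  have l : ∀ s ∈ Ico 0 ε', dist c (α s) < ρ := fun s hs => by
    rw [hd s hs]; exact (mul_lt_mul_of_pos_left hs.2 hS).trans_le e2
  have := (h _ _ (l s ⟨hs.1.le, hs.2⟩) (l _ m)).2 hne
  rw [hd _ m, hd s ⟨hs.1.le, hs.2⟩, H _ ⟨hs.1.le, hs.2.trans_le e1⟩ _ ⟨m.1, m.2.trans_le e1⟩,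
    ← mul_add] at this
  have := mul_left_cancel₀ hS.ne' this
  rcases abs_cases (s - ε' / 2) with h | h <;> linarith [hs.1]

theorem germ_dichotomy (hX : LocallyStar X) {S : ℝ} (hS : 0 < S) {α β : ℝ → X}
    (hα : IsGerm S α) (hβ : IsGerm S β) (h0 : α 0 = β 0) :
    (∃ ε > 0, ∀ s ∈ Ico 0 ε, α s = β s) ∨
      ∃ ε > 0, ∀ s ∈ Ico 0 ε, ∀ t ∈ Ico 0 ε, dist (α s) (β t) = S * (s + t) := by
  obtain ⟨ρ, hρ, D, dir, hs⟩ := hX (α 0)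
  obtain ⟨ε₁, p₁, d₁, b₁, a, ha⟩ := hs.dir_germ hρ hS hα rfl
  obtain ⟨ε₂, p₂, d₂, b₂, b, hb⟩ := hs.dir_germ hρ hS hβ h0.symm
  have l₁ : ∀ s ∈ Ico 0 ε₁, dist (α 0) (α s) < ρ := fun s hs => by
    rw [d₁ s hs]; exact (mul_lt_mul_of_pos_left hs.2 hS).trans_le b₁
  have l₂ : ∀ s ∈ Ico 0 ε₂, dist (α 0) (β s) < ρ := fun s hs => by
    rw [d₂ s hs]; exact (mul_lt_mul_of_pos_left hs.2 hS).trans_le b₂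
  by_cases hab : a = b
  · left
    refine ⟨min ε₁ ε₂, lt_min p₁ p₂, fun s h => ?_⟩
    have m₁ : s < ε₁ := h.2.trans_le (min_le_left _ _)
    have m₂ : s < ε₂ := h.2.trans_le (min_le_right _ _)
    rcases h.1.eq_or_lt with rfl | hpos
    · exact h0
    have := (hs _ _ (l₁ s ⟨h.1, m₁⟩) (l₂ s ⟨h.1, m₂⟩)).1
      ((ha s ⟨hpos, m₁⟩).trans (hab.trans (hb s ⟨hpos, m₂⟩).symm))
    rw [d₁ s ⟨h.1, m₁⟩, d₂ s ⟨h.1, m₂⟩, sub_self, abs_zero] at this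
    exact dist_eq_zero.1 this
  · right
    refine ⟨min ε₁ ε₂, lt_min p₁ p₂, fun s h t h' => ?_⟩
    have m₁ : s < ε₁ := h.2.trans_le (min_le_left _ _)
    have m₂ : t < ε₂ := h'.2.trans_le (min_le_right _ _)
    rcases h.1.eq_or_lt with rfl | hpos
    · rw [d₂ t ⟨h'.1, m₂⟩, zero_add]
    rcases h'.1.eq_or_lt with rfl | hpos'
    · rw [← h0, dist_comm, d₁ s ⟨h.1, m₁⟩, add_zero]
    have := (hs _ _ (l₁ s ⟨h.1, m₁⟩) (l₂ t ⟨h'.1, m₂⟩)).2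
      (by rw [ha s ⟨hpos, m₁⟩, hb t ⟨hpos', m₂⟩]; exact hab)
    rw [this, d₁ s ⟨h.1, m₁⟩, d₂ t ⟨h'.1, m₂⟩, mul_add]

theorem LipPath.mono {K K' l l' : ℝ} {q : ℝ → X} (h : LipPath K l q) (hK : K ≤ K') (hl : l' ≤ l) :
    LipPath K' l' q := fun s hs t ht =>
  (h s ⟨hs.1, hs.2.trans hl⟩ t ⟨ht.1, ht.2.trans hl⟩).trans (by gcongr)

theorem LipPath.rescale {K l c l' : ℝ} {q : ℝ → X} (h : LipPath K l q) (hc : 0 ≤ c)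
    (hl : c * l' ≤ l) : LipPath (K * c) l' (fun t => q (c * t)) := by
  have m : ∀ s ∈ Icc 0 l', c * s ∈ Icc 0 l := fun s hs =>
    ⟨mul_nonneg hc hs.1, (mul_le_mul_of_nonneg_left hs.2 hc).trans hl⟩
  intro s hs t ht
  refine (h _ (m s hs) _ (m t ht)).trans_eq ?_
  rw [← mul_sub, abs_mul, abs_of_nonneg hc, mul_assoc]

theorem LipPath.reverse {K l : ℝ} {q : ℝ → X} (h : LipPath K l q) :
    LipPath K l (fun t => q (l - t)) := by
  intro s hs t ht
  refine (h _ ⟨by linarith [hs.2], by linarith [hs.1]⟩ _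
    ⟨by linarith [ht.2], by linarith [ht.1]⟩).trans_eq ?_
  rw [sub_sub_sub_cancel_left, abs_sub_comm]

theorem LipPath.congr {K l : ℝ} {q q' : ℝ → X} (h : LipPath K l q)
    (hq : ∀ t ∈ Icc 0 l, q' t = q t) : LipPath K l q' := fun s hs t ht => by
  rw [hq s hs, hq t ht]; exact h s hs t ht

theorem LipPath.of_split {K a b : ℝ} (ha : 0 ≤ a) (hb : 0 ≤ b) {q : ℝ → X}
    (h1 : LipPath K a q) (h2 : LipPath K b (fun t => q (a + t))) : LipPath K (a + b) q := by
  have c2 : ∀ s ∈ Icc a (a + b), ∀ t ∈ Icc a (a + b), dist (q s) (q t) ≤ K * |s - t| := by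
    intro s hs t ht
    have := h2 (s - a) ⟨by linarith [hs.1], by linarith [hs.2]⟩ (t - a)
      ⟨by linarith [ht.1], by linarith [ht.2]⟩
    simpa using this
  have c3 : ∀ s ∈ Icc 0 (a + b), ∀ t ∈ Icc 0 (a + b), s ≤ t → dist (q s) (q t) ≤ K * |s - t| := by
    intro s hs t ht hst
    rcases le_total t a with h | h
    · exact h1 s ⟨hs.1, hst.trans h⟩ t ⟨ht.1, h⟩
    rcases le_total a s with h' | h'
    · exact c2 s ⟨h', hs.2⟩ t ⟨h, ht.2⟩
    · have a1 := h1 s ⟨hs.1, h'⟩ a ⟨ha, le_rfl⟩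
      have a2 := c2 a ⟨le_rfl, by linarith⟩ t ⟨h, ht.2⟩
      rw [abs_of_nonpos (by linarith)] at a1 a2 ⊢
      linarith [dist_triangle (q s) (q a) (q t)]
  intro s hs t ht
  rcases le_total s t with h | h
  · exact c3 s hs t ht h
  · rw [dist_comm, abs_sub_comm]; exact c3 t ht s hs h

/-- Concatenation of a path on `[0, a]` with another one. -/
def concat {Y : Type*} (a : ℝ) (p q : ℝ → Y) (t : ℝ) : Y := if t ≤ a then p t else q (t - a)

theorem concat_of_le {Y : Type*} {a t : ℝ} {p q : ℝ → Y} (h : t ≤ a) : concat a p q t = p t := if_pos h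

theorem concat_of_ge {Y : Type*} {a t : ℝ} {p q : ℝ → Y} (hpq : p a = q 0) (h : a ≤ t) :
    concat a p q t = q (t - a) := by
  rcases h.eq_or_lt with rfl | h
  · rw [concat_of_le le_rfl, hpq, sub_self]
  · exact if_neg (not_le.2 h)

theorem LipPath.concat {K a b : ℝ} (ha : 0 ≤ a) (hb : 0 ≤ b) {p q : ℝ → X} (hp : LipPath K a p)
    (hq : LipPath K b q) (hpq : p a = q 0) : LipPath K (a + b) (concat a p q) := by
  refine LipPath.of_split ha hb (hp.congr fun t ht => concat_of_le ht.2) (hq.congr fun t ht => ?_)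
  rw [concat_of_ge hpq (by linarith [ht.1]), add_sub_cancel_left]

theorem exists_ultralimit {Y : Type*} [CompactSpace X] (F : ℕ → Y → X) :
    ∃ F' : Y → X, ∀ y, Tendsto (fun n => F n y) (hyperfilter ℕ) (𝓝 (F' y)) := by
  have : ∀ y, ∃ x, Tendsto (fun n => F n y) (hyperfilter ℕ) (𝓝 x) := fun y => by
    obtain ⟨x, -, hx⟩ := isCompact_univ.ultrafilter_le_nhds
      ((hyperfilter ℕ).map fun n => F n y) (by simp)
    exact ⟨x, hx⟩
  choose F' h using this
  exact ⟨F', h⟩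

end

namespace MetricGraph

variable {G : MetricGraph}

theorem locallyStar (G : MetricGraph) : LocallyStar G.Space := fun c =>
  let ⟨ρ, hρ, h⟩ := exists_isStar c
  ⟨ρ, hρ, _, _, h⟩

theorem Joined.exists_lipPath {x y : G.Space} {L : ℝ} (h : Joined x y L) :
    ∃ q : ℝ → G.Space, q 0 = x ∧ q L = y ∧ LipPath 1 L q := by
  induction h with
  | refl =>
    refine ⟨fun _ => x, rfl, rfl, fun s _ t _ => ?_⟩
    simp
  | @step L e s t hs ht h ih =>
    obtain ⟨q, h0, h1, hq⟩ := ih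
    have hL := h.nonneg
    have key : ∃ p : ℝ → G.Space, p 0 = G.pt e s ∧ p |s - t| = G.pt e t ∧ LipPath 1 |s - t| p := by
      rcases le_total s t with hst | hst
      · refine ⟨fun u => G.pt e (s + u), by simp, ?_, ?_⟩
        · rw [abs_of_nonpos (by linarith)]; simp
        · rw [abs_of_nonpos (by linarith)]
          intro u hu w hw
          refine (dist_pt_le e ⟨by linarith [hs.1, hu.1], by linarith [ht.2, hu.2]⟩
            ⟨by linarith [hs.1, hw.1], by linarith [ht.2, hw.2]⟩).trans_eq ?_
          rw [one_mul, add_sub_add_left_eq_sub]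
      · refine ⟨fun u => G.pt e (s - u), by simp, ?_, ?_⟩
        · rw [abs_of_nonneg (by linarith)]; simp
        · rw [abs_of_nonneg (by linarith)]
          intro u hu w hw
          refine (dist_pt_le e ⟨by linarith [ht.1, hu.2], by linarith [hs.2, hu.1]⟩
            ⟨by linarith [ht.1, hw.2], by linarith [hs.2, hw.1]⟩).trans_eq ?_
          rw [one_mul, sub_sub_sub_cancel_left, abs_sub_comm]
    obtain ⟨p, p0, p1, hp⟩ := key
    refine ⟨_, ?_, ?_, hq.concat hL (abs_nonneg _) hp (h1.trans p0.symm)⟩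
    · rw [concat_of_le hL, h0]
    · rw [concat_of_ge (h1.trans p0.symm) (by linarith [abs_nonneg (s - t)]),
        add_sub_cancel_left, p1]

theorem geodesicMetric (G : MetricGraph) : GeodesicMetric G.Space := by
  intro x y
  rcases eq_or_ne x y with rfl | hne
  · exact ⟨fun _ => x, rfl, rfl, fun s _ t _ => by simp⟩
  set d := dist x y with hd
  have d0 : 0 < d := dist_pos.2 hne
  have : ∀ n : ℕ, ∃ q : ℝ → G.Space, q 0 = x ∧ q d = y ∧
      LipPath (1 + 1 / ((n : ℝ) + 1)) d q := by
    intro n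
    have hn : 0 < 1 / ((n : ℝ) + 1) := by positivity
    obtain ⟨M, hM, hJ⟩ := exists_joined_lt (x := x) (y := y) (L := d * (1 + 1 / ((n : ℝ) + 1)))
      (by rw [← hd]; nlinarith)
    have hM0 := hJ.nonneg
    obtain ⟨q, h0, h1, hq⟩ := hJ.exists_lipPath
    refine ⟨fun t => q (M / d * t), by simp [h0], ?_, ?_⟩
    · dsimp only
      rw [div_mul_cancel₀ _ d0.ne', h1]
    · refine (hq.rescale (c := M / d) (by positivity) (div_mul_cancel₀ _ d0.ne').le).mono ?_ le_rfl
      rw [one_mul, div_le_iff₀ d0, mul_comm]; exact hM.le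
  choose q h0 h1 hq using this
  obtain ⟨Q, hQ⟩ := exists_ultralimit q
  refine ⟨Q, tendsto_nhds_unique (hQ 0) (by simp [h0]), tendsto_nhds_unique (hQ d) (by simp [h1]),
    fun s hs t ht => ?_⟩
  have l : Tendsto (fun n : ℕ => (1 + 1 / ((n : ℝ) + 1)) * |s - t|) (hyperfilter ℕ)
      (𝓝 ((1 + 0) * |s - t|)) :=
    (((tendsto_one_div_add_atTop_nhds_zero_nat (𝕜 := ℝ)).const_add 1).mul_const _).mono_left
      Nat.hyperfilter_le_atTop
  rw [add_zero] at l
  exact le_of_tendsto_of_tendsto' ((hQ s).dist (hQ t)) l fun n => hq n s hs t ht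

theorem exists_homotopic (G : MetricGraph) :
    ∃ r > 0, ∀ (Y : Type) [TopologicalSpace Y] (f g : C(Y, G.Space)),
      (∀ y, dist (f y) (g y) < r) → f.Homotopic g :=
  exists_homotopic_of_dist_lt G.locallyStar G.geodesicMetric

end MetricGraph

namespace FreeGroup

open Classical in
/-- The length of the reduced word of `g`, each letter being weighted by `wt`. -/
def weight {α : Type*} (wt : α → ℝ) (g : FreeGroup α) : ℝ :=
  (g.toWord.map fun p => wt p.1).sum

open Classical in
/-- The sign with which the weight changes when the letter `a` is put in front of `g`. -/
def sgn {α : Type*} (a : α × Bool) (g : FreeGroup α) : ℝ :=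
  if g.toWord.head? = some (a.1, !a.2) then -1 else 1

variable {α : Type*} {wt : α → ℝ}

theorem sgn_cases (a : α × Bool) (g : FreeGroup α) : sgn a g = -1 ∨ sgn a g = 1 := by
  unfold sgn; split_ifs <;> simp

theorem eq_of_sgn_eq_neg_one {a b : α × Bool} {g : FreeGroup α} (ha : sgn a g = -1)
    (hb : sgn b g = -1) : a = b := by
  classical
  have key : ∀ {a : α × Bool}, sgn a g = -1 →
      g.toWord.head? = some (a.1, !a.2) := fun {a} h => by
    unfold sgn at h
    split_ifs at h with h'
    · convert h'
    · norm_num at h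
  have := (key ha).symm.trans (key hb)
  simp only [Option.some_inj, Prod.mk.injEq, Bool.not_eq_eq_eq_not, Bool.not_not] at this
  exact Prod.ext this.1 this.2

theorem weight_nonneg (hwt : ∀ a, 0 < wt a) (g : FreeGroup α) : 0 ≤ weight wt g :=
  List.sum_nonneg fun x hx => by
    obtain ⟨p, -, rfl⟩ := List.mem_map.1 hx
    exact (hwt _).le

theorem weight_letter_mul (wt : α → ℝ) (a : α × Bool) (g : FreeGroup α) :
    weight wt (mk [a] * g) = weight wt g + sgn a g * wt a.1 := by
  classical
  have h1 : (mk [a] * g).toWord = reduce (a :: g.toWord) := by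
    rw [toWord_mul, toWord_mk]
    rfl
  have h2 : weight wt (mk [a] * g) = ((reduce (a :: g.toWord)).map fun p => wt p.1).sum := by
    rw [← h1]; unfold weight; congr!
  have h3 : weight wt g = (g.toWord.map fun p => wt p.1).sum := by unfold weight; congr!
  have h4 : sgn a g = if g.toWord.head? = some (a.1, !a.2) then -1 else 1 := by
    unfold sgn; congr!
  rw [h2, h3, h4, reduce.cons, reduce_toWord]
  rcases g.toWord with _ | ⟨hd, tl⟩
  · simp
  · simp only [List.head?_cons, Option.some_inj]
    by_cases hc : a.1 = hd.1 ∧ a.2 = !hd.2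
    · rw [if_pos hc, if_pos (Prod.ext hc.1.symm (by simp [hc.2]) : hd = (a.1, !a.2))]
      simp [hc.1]
    · rw [if_neg hc, if_neg (fun h => hc ⟨by rw [h], by rw [h]; simp⟩)]
      simp [add_comm]

theorem sgn_inv_letter (a : α × Bool) (g : FreeGroup α) :
    sgn (a.1, !a.2) (mk [a] * g) = - sgn a g := by
  have h1 := weight_letter_mul (fun _ => (1 : ℝ)) a g
  have h2 := weight_letter_mul (fun _ => (1 : ℝ)) (a.1, !a.2) (mk [a] * g)
  have h3 : mk [(a.1, !a.2)] * (mk [a] * g) = g := by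
    rw [← mul_assoc]
    have : mk [(a.1, !a.2)] = (mk [a])⁻¹ := by rw [inv_mk]; rfl
    rw [this, inv_mul_cancel, one_mul]
  rw [h3] at h2
  linarith

theorem exists_abs_weight_mul_sub_le (wt : α → ℝ) (g : FreeGroup α) :
    ∃ C, ∀ x, |weight wt (g * x) - weight wt x| ≤ C := by
  have letter : ∀ a : α × Bool, ∀ x, |weight wt (mk [a] * x) - weight wt x| ≤ |wt a.1| := by
    intro a x
    rw [weight_letter_mul, add_sub_cancel_left, abs_mul]
    rcases sgn_cases a x with h | h <;> rw [h] <;> simp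
  induction g using FreeGroup.induction_on with
  | C1 => exact ⟨0, by simp⟩
  | of a => exact ⟨_, letter (a, true)⟩
  | inv_of a _ => exact ⟨_, letter (a, false)⟩
  | mul g h hg hh =>
    obtain ⟨C, hC⟩ := hg
    obtain ⟨C', hC'⟩ := hh
    refine ⟨C + C', fun x => ?_⟩
    rw [mul_assoc]
    exact (abs_sub_le _ _ _).trans (add_le_add (hC _) (hC' _))

end FreeGroup

namespace MetricGraph

open FreeGroup

variable {G : MetricGraph}

instance instTopologicalSpaceFreeGroup (E : Type) : TopologicalSpace (FreeGroup E) := ⊥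

instance instDiscreteTopologyFreeGroup (E : Type) : DiscreteTopology (FreeGroup E) := ⟨rfl⟩

open Classical in
/-- The transition from the chart of the edge containing `x` to the chart `i`. -/
def hol : G.V ⊕ G.E → G.Space → FreeGroup G.E
  | Sum.inr _, _ => 1
  | Sum.inl _, Space.vertex _ => 1
  | Sum.inl _, Space.inner e t => if G.len e / 2 < t then FreeGroup.mk [(e, true)] else 1

/-- The chart to which a point belongs. -/
def chartAt : G.Space → G.V ⊕ G.E
  | Space.vertex v => Sum.inl v
  | Space.inner e _ => Sum.inr e

/-- The domains of the charts: stars of vertices and open edges. -/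
def chartSet : G.V ⊕ G.E → Set G.Space
  | Sum.inl v => Metric.ball (Space.vertex v) G.rad
  | Sum.inr e => range (Space.inner e)

theorem hol_chartAt (x : G.Space) : hol (chartAt x) x = 1 := by
  rcases x with v | ⟨e, t⟩ <;> rfl

theorem hol_continuousOn (v : G.V) (e : G.E) :
    ContinuousOn (hol (Sum.inl v : G.V ⊕ G.E)) (chartSet (Sum.inl v) ∩ chartSet (Sum.inr e)) := by
  rintro _ ⟨hv, t, rfl⟩
  have ht : (t : ℝ) ≠ G.len e / 2 := by
    intro h
    have h4 := four_rad_le e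
    have h0 := G.rad_pos
    have hv' : dist (Space.vertex v) (Space.inner e t) < G.rad := by
      rw [dist_comm]; exact hv
    rcases arm_of_dist_lt hv' with h' | ⟨k, -, s, hs, h'⟩
    · cases h'
    · have hd := dirAt_arm v k hs
      rw [← h'] at hd
      simp only [dirAt, Option.some_inj] at hd
      subst hd
      simp only [arm, h, lt_irrefl, decide_false, Bool.false_eq_true, if_false] at h'
      have hs' : s ∈ Ioo 0 (G.len e) := ⟨hs.1, by linarith [hs.2]⟩
      rw [pt_inner e ⟨s, hs'⟩] at h'
      cases h'
      dsimp at h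
      linarith [hs.2]
  refine ContinuousAt.continuousWithinAt ?_
  have : hol (Sum.inl v : G.V ⊕ G.E) =ᶠ[𝓝 (Space.inner e t)]
      fun _ => hol (Sum.inl v) (Space.inner e t) := by
    have h0 : 0 < min (min (t : ℝ) (G.len e - t)) |t - G.len e / 2| :=
      lt_min (lt_min t.2.1 (by linarith [t.2.2])) (abs_pos.2 (sub_ne_zero.2 ht))
    filter_upwards [Metric.ball_mem_nhds _ h0] with y hy
    rw [Metric.mem_ball, dist_comm, ← pt_inner] at hy
    obtain ⟨u, rfl, hu⟩ := inner_of_dist_lt t.2 (hy.trans_le (min_le_left _ _))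
    have := hy.trans_le (min_le_right _ _)
    rw [hu] at this
    simp only [hol]
    congr 1
    rw [eq_iff_iff]
    rcases abs_cases ((t : ℝ) - u) with h | h <;>
      rcases abs_cases ((t : ℝ) - G.len e / 2) with h' | h' <;>
      constructor <;> intro <;> linarith
  exact continuousAt_const.congr this.symm

/-- The covering of the graph `G` on which the free group on the edges acts from the right: crossing
the edge `e` multiplies the sheet by `e` from the left. -/
def coverCore (G : MetricGraph) : FiberBundleCore (G.V ⊕ G.E) G.Space (FreeGroup G.E) where
  baseSet := chartSet
  isOpen_baseSet i := by
    rcases i with v | e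
    · exact Metric.isOpen_ball
    · rw [Metric.isOpen_iff]
      rintro _ ⟨t, rfl⟩
      refine ⟨_, lt_min t.2.1 (sub_pos.2 t.2.2), fun y hy => ?_⟩
      rw [Metric.mem_ball, dist_comm, ← pt_inner] at hy
      obtain ⟨u, rfl, -⟩ := inner_of_dist_lt t.2 hy
      exact ⟨u, rfl⟩
  indexAt := chartAt
  mem_baseSet_at x := by
    rcases x with v | ⟨e, t⟩
    · exact Metric.mem_ball_self G.rad_pos
    · exact ⟨t, rfl⟩
  coordChange i j x g := hol j x * (hol i x)⁻¹ * g
  coordChange_self i x _ g := by simp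
  continuousOn_coordChange i j := by
    have key : ContinuousOn (fun x => hol j x * (hol i x)⁻¹) (chartSet i ∩ chartSet j) := by
      rcases i with v | e <;> rcases j with v' | e'
      · have : (fun x : G.Space => hol (Sum.inl v' : G.V ⊕ G.E) x * (hol (Sum.inl v) x)⁻¹) =
            fun _ => 1 := by
          funext x
          rcases x with _ | _ <;> simp [hol]
        rw [this]; exact continuousOn_const
      · exact continuousOn_const.mul (hol_continuousOn v e').inv
      · rw [inter_comm]
        exact (hol_continuousOn v' e).mul continuousOn_const
      · exact continuousOn_const
    exact (key.comp continuousOn_fst fun p hp => hp.1).mul continuousOn_snd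
  coordChange_comp i j k x _ g := by group

/-- The total space of the covering. -/
abbrev Cover (G : MetricGraph) : Type := (coverCore G).TotalSpace

/-- The projection of the covering. -/
def coverProj (G : MetricGraph) : G.Cover → G.Space := (coverCore G).proj

theorem isCoveringMap_coverProj (G : MetricGraph) : IsCoveringMap G.coverProj :=
  IsCoveringMap.mk _ (fun _ => FreeGroup G.E) (fun x => (coverCore G).localTrivAt x)
    fun x => (coverCore G).mem_localTrivAt_baseSet x

/-- The point of the covering over `x` with given sheet. -/
def Cover.mk (x : G.Space) (g : FreeGroup G.E) : G.Cover := ⟨x, g⟩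

/-- The sheet of a point of the covering. -/
def Cover.sheet (z : G.Cover) : FreeGroup G.E := z.2

/-- The action of the free group on the covering by deck transformations. -/
def deck (h : FreeGroup G.E) (z : G.Cover) : G.Cover := Cover.mk (G.coverProj z) (z.sheet * h)

theorem coverProj_deck (h : FreeGroup G.E) (z : G.Cover) :
    G.coverProj (deck h z) = G.coverProj z := rfl

theorem sheet_deck (h : FreeGroup G.E) (z : G.Cover) : (deck h z).sheet = z.sheet * h := rfl

theorem Cover.ext {z w : G.Cover} (h : G.coverProj z = G.coverProj w) (h' : z.sheet = w.sheet) :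
    z = w := by
  rcases z with ⟨x, g⟩
  rcases w with ⟨y, k⟩
  obtain rfl : x = y := h
  obtain rfl : g = k := h'
  rfl

theorem eventually_sheet (z : G.Cover) (i : G.V ⊕ G.E) (hz : G.coverProj z ∈ chartSet i) :
    ∀ᶠ w in 𝓝 z, G.coverProj w ∈ chartSet i ∧
      hol i (G.coverProj w) * w.sheet = hol i (G.coverProj z) * z.sheet := by
  have hsrc : z ∈ ((coverCore G).localTriv i).source := hz
  have hopen := ((coverCore G).localTriv i).open_source
  have hc : ContinuousAt (fun w => ((coverCore G).localTriv i w).2) z :=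
    continuousAt_snd.comp
      (((coverCore G).localTriv i).continuousOn_toFun.continuousAt (hopen.mem_nhds hsrc))
  have h1 := hc (IsOpen.mem_nhds (isOpen_discrete {((coverCore G).localTriv i z).2}) rfl)
  filter_upwards [hopen.mem_nhds hsrc, h1] with w hw hw'
  refine ⟨hw, ?_⟩
  have h2 : hol i (G.coverProj w) * (hol (chartAt (G.coverProj w)) (G.coverProj w))⁻¹ * w.sheet =
      hol i (G.coverProj z) * (hol (chartAt (G.coverProj z)) (G.coverProj z))⁻¹ * z.sheet := hw'
  simpa [hol_chartAt] using h2

theorem continuous_coverProj (G : MetricGraph) : Continuous G.coverProj :=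
  (isCoveringMap_coverProj G).continuous

theorem continuous_deck (h : FreeGroup G.E) : Continuous (deck (G := G) h) := by
  rw [continuous_iff_continuousAt]
  intro z
  set i := chartAt (G.coverProj z) with hi
  have hz : G.coverProj z ∈ chartSet i := (coverCore G).mem_baseSet_at _
  set T := (coverCore G).localTriv i with hT
  have hsrc : deck h z ∈ T.source := hz
  have h1 : ContinuousAt (fun w => T (deck h w)) z := by
    have : (fun w => T (deck h w)) =ᶠ[𝓝 z]
        fun w => (G.coverProj w, hol i (G.coverProj z) * z.sheet * h) := by
      filter_upwards [eventually_sheet z i hz] with w hw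
      have h2 : T (deck h w) = (G.coverProj w,
          hol i (G.coverProj w) * (hol (chartAt (G.coverProj w)) (G.coverProj w))⁻¹ *
            (w.sheet * h)) := rfl
      rw [h2, hol_chartAt, inv_one, mul_one, ← mul_assoc, hw.2]
    refine ContinuousAt.congr ?_ this.symm
    exact (continuous_coverProj G).continuousAt.prodMk continuousAt_const
  exact (T.toOpenPartialHomeomorph.continuousAt_iff_continuousAt_comp_left
    (f := deck h) (x := z) (T.open_source.mem_nhds (show z ∈ T.source from hz))).2 h1

end MetricGraph

theorem real_induction {P : ℝ → Prop} {a b : ℝ}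
    (left : ∀ x ∈ Icc a b, (∀ y ∈ Ico a x, P y) → P x)
    (right : ∀ x ∈ Ico a b, (∀ y ∈ Icc a x, P y) → ∃ ε > 0, ∀ y ∈ Ioo x (x + ε), P y) :
    ∀ x ∈ Icc a b, P x := by
  by_contra hcon
  push Not at hcon
  obtain ⟨x₀, hx₀, hP₀⟩ := hcon
  set Bad : Set ℝ := {x ∈ Icc a b | ¬ P x} with hBad
  have hne : Bad.Nonempty := ⟨x₀, hx₀, hP₀⟩
  have hbd : BddBelow Bad := ⟨a, fun x hx => hx.1.1⟩
  set c := sInf Bad with hc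
  have hac : a ≤ c := le_csInf hne fun x hx => hx.1.1
  have hcb : c ≤ b := (csInf_le hbd ⟨hx₀, hP₀⟩).trans hx₀.2
  have h1 : ∀ y ∈ Ico a c, P y := fun y hy => by
    by_contra h
    exact absurd (csInf_le hbd ⟨⟨hy.1, hy.2.le.trans hcb⟩, h⟩) (not_le.2 hy.2)
  have hPc := left c ⟨hac, hcb⟩ h1
  have h2 : ∀ y ∈ Icc a c, P y := fun y hy => by
    rcases hy.2.eq_or_lt with rfl | h
    · exact hPc
    · exact h1 y ⟨hy.1, h⟩
  have hcx : c < x₀ := lt_of_le_of_ne (csInf_le hbd ⟨hx₀, hP₀⟩) fun h => hP₀ (h ▸ hPc)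
  obtain ⟨ε, hε, hr⟩ := right c ⟨hac, hcx.trans_le hx₀.2⟩ h2
  obtain ⟨x, hx, hxlt⟩ := exists_lt_of_csInf_lt hne (show sInf Bad < c + ε by linarith)
  have hcx' : c ≤ x := csInf_le hbd hx
  rcases hcx'.eq_or_lt with h | h
  · exact hx.2 (h ▸ hPc)
  · exact hx.2 (hr x ⟨h, hxlt⟩)

theorem eq_of_eqOn_Ico {u g : ℝ → ℝ} (hu : Continuous u) (hg : Continuous g) {a x : ℝ}
    (hax : a < x) (h : ∀ y ∈ Ico a x, u y = g y) : u x = g x := by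
  have : closure (Ico a x) ⊆ {y | u y = g y} := (isClosed_eq hu hg).closure_subset_iff.2 h
  rw [closure_Ico hax.ne] at this
  exact this ⟨hax.le, le_rfl⟩

/-- `p` is locally a geodesic of speed `S`. -/
def LocalGeodesic {X : Type*} [MetricSpace X] (S : ℝ) (p : ℝ → X) : Prop :=
  ∀ t, ∃ ε > 0, ∀ x y, |x - t| < ε → |y - t| < ε → dist (p x) (p y) = S * |x - y|

namespace MetricGraph

open FreeGroup

variable {G : MetricGraph}

/-- The height of the point over `x` in the sheet `g`, its distance from the base sheet. -/
def heightAt : G.Space → FreeGroup G.E → ℝ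
  | Space.vertex _, g => weight G.len g
  | Space.inner e t, g => weight G.len g + sgn (e, true) g * t

/-- The height of a point of the covering. -/
def height (z : G.Cover) : ℝ := heightAt (G.coverProj z) z.sheet

theorem height_nonneg (z : G.Cover) : 0 ≤ height z := by
  unfold height
  generalize z.sheet = g
  rcases G.coverProj z with v | ⟨e, t⟩
  · exact weight_nonneg G.len_pos _
  · have h0 := weight_nonneg G.len_pos g
    have h1 := weight_nonneg G.len_pos (FreeGroup.mk [(e, true)] * g)
    rw [weight_letter_mul] at h1
    simp only [heightAt]
    have := t.2.1
    have := t.2.2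
    rcases sgn_cases (e, true) g with h | h <;> rw [h] at h1 ⊢ <;> dsimp at h1 <;> linarith

theorem exists_abs_height_sub_weight_le (G : MetricGraph) :
    ∃ C, ∀ z : G.Cover, |height z - weight G.len z.sheet| ≤ C := by
  refine ⟨∑ e, G.len e, fun z => ?_⟩
  unfold height
  generalize z.sheet = g
  have hs : 0 ≤ ∑ e, G.len e := Finset.sum_nonneg fun e _ => (G.len_pos e).le
  rcases G.coverProj z with v | ⟨e, t⟩
  · simpa [heightAt] using hs
  · have : G.len e ≤ ∑ e, G.len e :=
      Finset.single_le_sum (fun e _ => (G.len_pos e).le) (Finset.mem_univ e)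
    have h0 := t.2.1
    have h1 := t.2.2
    simp only [heightAt, add_sub_cancel_left, abs_mul, abs_of_pos h0]
    rcases sgn_cases (e, true) g with h | h <;> rw [h] <;> simp <;> linarith

/-- The letter that is read off along a half-edge. -/
def letter (h : G.E × Bool) : G.E × Bool := (h.1, !h.2)

open Classical in
theorem exists_descent_vertex (g : FreeGroup G.E) :
    ∃ δ : Option (G.E × Bool), ∀ h : G.E × Bool,
      sgn (letter h) g = if some h = δ then -1 else 1 := by
  by_cases hex : ∃ h : G.E × Bool, sgn (letter h) g = -1
  · obtain ⟨h, hh⟩ := hex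
    refine ⟨some h, fun k => ?_⟩
    split_ifs with hk
    · rw [Option.some_inj.1 hk, hh]
    · refine (sgn_cases _ _).resolve_left fun hk' => hk ?_
      have := eq_of_sgn_eq_neg_one hk' hh
      simp only [letter, Prod.mk.injEq] at this
      rw [Prod.ext this.1 (Bool.not_inj this.2)]
  · refine ⟨none, fun k => ?_⟩
    rw [if_neg (by simp)]
    exact (sgn_cases _ _).resolve_left fun hk' => hex ⟨k, hk'⟩

theorem heightAt_arm (h : G.E × Bool) {s : ℝ} (hs : s ∈ Ioo 0 G.rad) {k : FreeGroup G.E}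
    {v : G.V} {g : FreeGroup G.E} (hg : hol (Sum.inl v) (arm h s) * k = g) :
    heightAt (arm h s) k = weight G.len g + sgn (letter h) g * s := by
  obtain ⟨e, _ | _⟩ := h
  · have h4 := four_rad_le e
    have hs' : s ∈ Ioo 0 (G.len e) := ⟨hs.1, by linarith [hs.1, hs.2]⟩
    simp only [arm, Bool.false_eq_true, if_false] at hg ⊢
    rw [pt_inner e ⟨s, hs'⟩] at hg ⊢
    simp only [hol] at hg
    rw [if_neg (by linarith [hs.1, hs.2]), one_mul] at hg
    subst hg
    rfl
  · have h4 := four_rad_le e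
    have hs' : G.len e - s ∈ Ioo 0 (G.len e) := ⟨by linarith [hs.1, hs.2], by linarith [hs.1]⟩
    simp only [arm, if_true] at hg ⊢
    rw [pt_inner e ⟨_, hs'⟩] at hg ⊢
    simp only [hol] at hg
    rw [if_pos (by linarith [hs.1, hs.2])] at hg
    subst hg
    have := sgn_inv_letter (e, true) k
    simp only [letter, heightAt]
    simp only at this
    rw [this, weight_letter_mul]
    ring

open Classical in
/-- At every point of the covering the height decreases in at most one direction. -/
theorem exists_descent (z : G.Cover) :
    ∃ δ : Option (G.E × Bool), ∀ᶠ w in 𝓝 z,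
      height w = height z + (if dirAt (G.coverProj z) (G.coverProj w) = δ then -1 else 1) *
        dist (G.coverProj z) (G.coverProj w) := by
  obtain ⟨x, g, rfl⟩ : ∃ x g, z = Cover.mk x g := ⟨G.coverProj z, z.sheet, rfl⟩
  have hx : G.coverProj (Cover.mk x g) = x := rfl
  have hg : (Cover.mk x g).sheet = g := rfl
  rw [hx]
  rcases x with v | ⟨e, t⟩
  · obtain ⟨δ, hδ⟩ := exists_descent_vertex g
    refine ⟨δ, ?_⟩
    filter_upwards [eventually_sheet (Cover.mk (Space.vertex v) g) (Sum.inl v)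
      (Metric.mem_ball_self G.rad_pos)] with w ⟨hw, hs⟩
    rw [hx, hg] at hs
    simp only [hol, one_mul] at hs
    unfold height
    rw [hx, hg]
    have hw' : dist (Space.vertex v) (G.coverProj w) < G.rad := by rw [dist_comm]; exact hw
    generalize G.coverProj w = y at *
    rcases arm_of_dist_lt hw' with rfl | ⟨h, rfl, s, hs', rfl⟩
    · simp only [one_mul] at hs
      simp [hs]
    · rw [heightAt_arm h hs' hs, dirAt_arm _ _ hs', dist_vertex_arm h ⟨hs'.1.le, hs'.2.le⟩, hδ]
      rfl
  · refine ⟨if sgn (e, true) g = 1 then some (e, false) else some (e, true), ?_⟩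
    have h0 : 0 < min (t : ℝ) (G.len e - t) := lt_min t.2.1 (sub_pos.2 t.2.2)
    have hball : ∀ᶠ w in 𝓝 (Cover.mk (Space.inner e t) g),
        dist (Space.inner e t) (G.coverProj w) < min (t : ℝ) (G.len e - t) := by
      have := (continuous_coverProj G).continuousAt (x := Cover.mk (Space.inner e t) g)
      filter_upwards [this (Metric.ball_mem_nhds _ h0)] with w hw
      rw [dist_comm]; exact hw
    filter_upwards [eventually_sheet (Cover.mk (Space.inner e t) g) (Sum.inr e) ⟨t, rfl⟩, hball]
      with w ⟨_, hs⟩ hd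
    rw [hx, hg] at hs
    simp only [hol, one_mul] at hs
    unfold height
    rw [hx, hg, hs]
    generalize G.coverProj w = y at *
    rw [← pt_inner] at hd
    obtain ⟨u, rfl, hu⟩ := inner_of_dist_lt t.2 hd
    rw [pt_inner] at hu
    rw [hu]
    simp only [heightAt]
    rcases lt_or_ge (t : ℝ) u with htu | htu
    · have hdir : dirAt (Space.inner e t : G.Space) (Space.inner e u) = some (e, true) := by
        simp only [dirAt, decide_eq_true htu]
      rw [abs_of_neg (by linarith), hdir]
      rcases sgn_cases (e, true) g with h | h <;> rw [h]
      · rw [if_neg (by norm_num : ¬ (-1 : ℝ) = 1), if_pos rfl]; ring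
      · rw [if_pos rfl, if_neg (by simp)]; ring
    · have hdir : dirAt (Space.inner e t : G.Space) (Space.inner e u) = some (e, false) := by
        simp only [dirAt, decide_eq_false (not_lt.2 htu)]
      rw [abs_of_nonneg (by linarith), hdir]
      rcases sgn_cases (e, true) g with h | h <;> rw [h]
      · rw [if_neg (by norm_num : ¬ (-1 : ℝ) = 1), if_neg (by simp)]; ring
      · rw [if_pos rfl, if_pos rfl]; ring

theorem exists_height_lipschitz (z : G.Cover) :
    ∃ U ∈ 𝓝 z, ∀ w ∈ U, ∀ w' ∈ U,
      |height w - height w'| ≤ dist (G.coverProj w) (G.coverProj w') := by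
  classical
  obtain ⟨δ, hδ⟩ := exists_descent z
  obtain ⟨ρ, hρ, hs⟩ := exists_isStar (G.coverProj z)
  have hball : ∀ᶠ w in 𝓝 z, dist (G.coverProj z) (G.coverProj w) < ρ := by
    filter_upwards [(continuous_coverProj G).continuousAt (x := z) (Metric.ball_mem_nhds _ hρ)]
      with w hw
    rw [dist_comm]; exact hw
  refine ⟨_, hδ.and hball, fun w hw w' hw' => ?_⟩
  have h1 : height w = _ := hw.1
  have h2 : height w' = _ := hw'.1
  obtain ⟨c1, c2⟩ := hs _ _ hw.2 hw'.2
  have p1 : 0 ≤ dist (G.coverProj z) (G.coverProj w) := dist_nonneg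
  have p2 : 0 ≤ dist (G.coverProj z) (G.coverProj w') := dist_nonneg
  rw [h1, h2]
  by_cases hd : dirAt (G.coverProj z) (G.coverProj w) = dirAt (G.coverProj z) (G.coverProj w')
  · rw [c1 hd, hd]
    split_ifs
    · rw [abs_sub_comm]; apply le_of_eq; congr 1; ring
    · apply le_of_eq; congr 1; ring
  · rw [c2 hd, abs_le]
    split_ifs <;> constructor <;> linarith

theorem continuous_height : Continuous (height (G := G)) := by
  rw [continuous_iff_continuousAt]
  intro z
  obtain ⟨U, hU, H⟩ := exists_height_lipschitz z
  rw [ContinuousAt, tendsto_iff_dist_tendsto_zero]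
  have h1 : Tendsto (fun w => dist (G.coverProj w) (G.coverProj z)) (𝓝 z) (𝓝 0) :=
    tendsto_iff_dist_tendsto_zero.1 (continuous_coverProj G).continuousAt
  refine squeeze_zero' (Eventually.of_forall fun _ => dist_nonneg) ?_ h1
  filter_upwards [hU] with w hw
  rw [Real.dist_eq]
  exact H w hw z (mem_of_mem_nhds hU)

theorem edist_height_le (c : C(I, G.Cover)) :
    edist (height (c 0)) (height (c 1)) ≤ eVariationOn (fun t => G.coverProj (c t)) univ := by
  choose U hU H using fun z : G.Cover => exists_height_lipschitz z
  obtain ⟨t, ht0, hmono, ⟨m, hm⟩, ht⟩ := exists_monotone_Icc_subset_open_cover_unitInterval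
    (c := fun z => c ⁻¹' (interior (U z))) (fun z => isOpen_interior.preimage c.continuous)
    (fun s _ => mem_iUnion.2 ⟨c s, mem_interior_iff_mem_nhds.2 (hU _)⟩)
  have h1 := edist_le_range_sum_edist (fun i => height (c (t i))) m
  rw [ht0, hm m le_rfl] at h1
  refine h1.trans ((Finset.sum_le_sum fun i _ => ?_).trans
    (eVariationOn.sum_le (f := fun t => G.coverProj (c t)) (n := m) (u := t) hmono
      fun i => mem_univ _))
  obtain ⟨z, hz⟩ := ht i
  have a1 := interior_subset (hz ⟨le_rfl, hmono i.le_succ⟩)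
  have a2 := interior_subset (hz ⟨hmono i.le_succ, le_rfl⟩)
  rw [edist_comm, edist_dist, edist_dist]
  refine ENNReal.ofReal_le_ofReal ?_
  rw [Real.dist_eq]
  exact H z _ a2 _ a1

theorem height_local_geodesic {S : ℝ} (hS : 0 < S) {p : ℝ → G.Cover} (hp : Continuous p)
    (hg : LocalGeodesic S fun t => G.coverProj (p t)) (t : ℝ) :
    ∃ ε > 0, ∃ a b : ℝ, (a = -1 ∨ a = 1) ∧ (b = -1 ∨ b = 1) ∧ ¬ (a = -1 ∧ b = -1) ∧
      (∀ s ∈ Ioo 0 ε, height (p (t - s)) = height (p t) + a * (S * s)) ∧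
      ∀ s ∈ Ioo 0 ε, height (p (t + s)) = height (p t) + b * (S * s) := by
  classical
  obtain ⟨δ, hδ⟩ := exists_descent (p t)
  obtain ⟨ρ, hρ, hs⟩ := exists_isStar (G.coverProj (p t))
  obtain ⟨η, hη, hdist⟩ := hg t
  have germ : ∀ τ : ℝ, (τ = -1 ∨ τ = 1) →
      IsGerm S fun s => G.coverProj (p (t + τ * s)) := by
    intro τ hτ
    have habs : |τ| = 1 := by rcases hτ with rfl | rfl <;> simp
    refine ⟨η, hη, fun s hs s' hs' => ?_⟩
    have := hdist (t + τ * s) (t + τ * s')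
      (by rw [add_sub_cancel_left, abs_mul, habs, one_mul, abs_of_nonneg hs.1]; exact hs.2)
      (by rw [add_sub_cancel_left, abs_mul, habs, one_mul, abs_of_nonneg hs'.1]; exact hs'.2)
    rwa [add_sub_add_left_eq_sub, ← mul_sub, abs_mul, habs, one_mul] at this
  obtain ⟨ε₁, p₁, d₁, b₁, a, ha⟩ := hs.dir_germ hρ hS (germ (-1) (Or.inl rfl)) (by simp)
  obtain ⟨ε₂, p₂, d₂, b₂, b, hb⟩ := hs.dir_germ hρ hS (germ 1 (Or.inr rfl)) (by simp)
  obtain ⟨ε₃, p₃, h₃⟩ := Metric.eventually_nhds_iff.1 (hp.continuousAt.eventually hδ)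
  set ε := min (min ε₁ ε₂) (min ε₃ η) with hε
  have q₁ : ε ≤ ε₁ := (min_le_left _ _).trans (min_le_left _ _)
  have q₂ : ε ≤ ε₂ := (min_le_left _ _).trans (min_le_right _ _)
  have q₃ : ε ≤ ε₃ := (min_le_right _ _).trans (min_le_left _ _)
  have q₄ : ε ≤ η := (min_le_right _ _).trans (min_le_right _ _)
  have q₀ : 0 < ε := lt_min (lt_min p₁ p₂) (lt_min p₃ hη)
  have hab : a ≠ b := by
    intro hab
    have m₁ : ε / 2 ∈ Ioo 0 ε₁ := ⟨by linarith, by linarith⟩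
    have m₂ : ε / 2 ∈ Ioo 0 ε₂ := ⟨by linarith, by linarith⟩
    have l : S * (ε / 2) < ρ := (mul_lt_mul_of_pos_left m₁.2 hS).trans_le b₁
    have e1 := d₁ _ ⟨m₁.1.le, m₁.2⟩
    have e2 := d₂ _ ⟨m₂.1.le, m₂.2⟩
    have := (hs _ _ (e1 ▸ l) (e2 ▸ l)).1 ((ha _ m₁).trans (hab.trans (hb _ m₂).symm))
    rw [e1, e2, sub_self, abs_zero, hdist _ _ (by rw [abs_lt]; constructor <;> linarith)
      (by rw [abs_lt]; constructor <;> linarith)] at this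
    have h2 : t + -1 * (ε / 2) - (t + 1 * (ε / 2)) = -ε := by ring
    rw [h2, abs_neg, abs_of_pos q₀] at this
    exact absurd this (mul_pos hS q₀).ne'
  refine ⟨ε, q₀, if a = δ then -1 else 1, if b = δ then -1 else 1, ?_, ?_, ?_, ?_, ?_⟩
  · split_ifs <;> simp
  · split_ifs <;> simp
  · rintro ⟨h1, h2⟩
    split_ifs at h1 h2 with h3 h4
    · exact hab (h3.trans h4.symm)
    all_goals linarith
  · intro s hs'
    have e1 := h₃ (y := t + -1 * s) (by
      rw [Real.dist_eq, add_sub_cancel_left, neg_one_mul, abs_neg, abs_of_pos hs'.1]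
      exact hs'.2.trans_le q₃)
    rw [ha s ⟨hs'.1, hs'.2.trans_le q₁⟩, d₁ s ⟨hs'.1.le, hs'.2.trans_le q₁⟩] at e1
    rw [sub_eq_add_neg, ← neg_one_mul s]; exact e1
  · intro s hs'
    have e1 := h₃ (y := t + 1 * s) (by
      rw [Real.dist_eq, add_sub_cancel_left, one_mul, abs_of_pos hs'.1]
      exact hs'.2.trans_le q₃)
    rw [hb s ⟨hs'.1, hs'.2.trans_le q₂⟩, d₂ s ⟨hs'.1.le, hs'.2.trans_le q₂⟩] at e1
    rw [one_mul] at e1; exact e1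

theorem height_ascending {S : ℝ} (hS : 0 < S) {p : ℝ → G.Cover} (hp : Continuous p)
    (hg : LocalGeodesic S fun t => G.coverProj (p t)) {a : ℝ}
    (hasc : ∃ ε > 0, ∀ s ∈ Ioo 0 ε, height (p (a + s)) = height (p a) + S * s) (b : ℝ) :
    ∀ t ∈ Icc a b, height (p t) = height (p a) + S * (t - a) := by
  have hu : Continuous fun t => height (p t) := continuous_height.comp hp
  refine real_induction (fun x hx h => ?_) fun x hx h => ?_
  · rcases hx.1.eq_or_lt with rfl | hax
    · simp
    · exact eq_of_eqOn_Ico hu (g := fun t => height (p a) + S * (t - a)) (by fun_prop) hax h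
  · rcases hx.1.eq_or_lt with rfl | hax
    · obtain ⟨ε, hε, H⟩ := hasc
      refine ⟨ε, hε, fun y hy => ?_⟩
      have := H (y - a) ⟨by linarith [hy.1], by linarith [hy.2]⟩
      rwa [add_sub_cancel] at this
    · obtain ⟨ε, hε, α, β, hα, hβ, hne, hl, hr⟩ := height_local_geodesic hS hp hg x
      have hα' : α = -1 := by
        refine hα.resolve_right fun h1 => ?_
        set s := min (ε / 2) (x - a) with hs
        have s0 : 0 < s := lt_min (by linarith) (by linarith)
        have s1 : s ≤ ε / 2 := min_le_left _ _
        have s2 : s ≤ x - a := min_le_right _ _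
        have e1 := hl s ⟨s0, by linarith⟩
        rw [h (x - s) ⟨by linarith, by linarith⟩, h x ⟨hax.le, le_rfl⟩, h1] at e1
        nlinarith [mul_pos hS s0]
      have hβ' : β = 1 := hβ.resolve_left fun h => hne ⟨hα', h⟩
      refine ⟨ε, hε, fun y hy => ?_⟩
      have := hr (y - x) ⟨by linarith [hy.1], by linarith [hy.2]⟩
      rw [add_sub_cancel, h x ⟨hax.le, le_rfl⟩, hβ'] at this
      rw [this]; ring

theorem le_height_add {S : ℝ} (hS : 0 < S) {p : ℝ → G.Cover} (hp : Continuous p)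
    (hg : LocalGeodesic S fun t => G.coverProj (p t)) {T : ℝ} (hT : 0 ≤ T) :
    S * T ≤ height (p T) + height (p 0) := by
  have hu : Continuous fun t => height (p t) := continuous_height.comp hp
  by_cases hex : ∃ a ∈ Icc 0 T, height (p a) = height (p 0) - S * a ∧
      ∃ ε > 0, ∀ s ∈ Ioo 0 ε, height (p (a + s)) = height (p a) + S * s
  · obtain ⟨a, ha, h1, h2⟩ := hex
    have h3 := height_ascending hS hp hg h2 T T ⟨ha.2, le_rfl⟩
    have h4 := height_nonneg (p a)
    nlinarith
  · have key : ∀ t ∈ Icc 0 T, height (p t) = height (p 0) - S * t := by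
      refine real_induction (fun x hx h => ?_) fun x hx h => ?_
      · rcases hx.1.eq_or_lt with rfl | hax
        · simp
        · exact eq_of_eqOn_Ico hu (g := fun t => height (p 0) - S * t) (by fun_prop) hax h
      · obtain ⟨ε, hε, α, β, hα, hβ, hne, hl, hr⟩ := height_local_geodesic hS hp hg x
        have hx' := h x ⟨hx.1, le_rfl⟩
        have hβ' : β = -1 := by
          refine hβ.resolve_right fun h1 => hex ⟨x, ⟨hx.1, hx.2.le⟩, hx', ε, hε, fun s hs => ?_⟩
          rw [hr s hs, h1, one_mul]
        refine ⟨ε, hε, fun y hy => ?_⟩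
        have := hr (y - x) ⟨by linarith [hy.1], by linarith [hy.2]⟩
        rw [add_sub_cancel, hx', hβ'] at this
        rw [this]; ring
    have h1 := key T ⟨hT, le_rfl⟩
    have h2 := height_nonneg (p T)
    have h3 := height_nonneg (p 0)
    nlinarith

/-- A closed local geodesic is not longer than any loop that is freely homotopic to it. -/
theorem le_pathLength_of_freelyHomotopic {S : ℝ} (hS : 0 < S) {p : ℝ → G.Space}
    (hp : Continuous p) (hper : ∀ t, p (t + 1) = p t) (hg : LocalGeodesic S p)
    {x y : G.Space} (c : Path x x) (hc : ∀ t : I, c t = p t) (q : Path y y)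
    (hcq : FreelyHomotopic c q) : ENNReal.ofReal S ≤ pathLength q := by
  by_cases hfin : pathLength q = ⊤
  · rw [hfin]; exact le_top
  obtain ⟨F⟩ := hcq
  have cov := isCoveringMap_coverProj G
  obtain ⟨P, ⟨-, hP⟩, -⟩ := cov.existsUnique_continuousMap_lifts (⟨p, hp⟩ : C(ℝ, G.Space)) 0
    (Cover.mk (p 0) 1) rfl
  have hP' : ∀ t, G.coverProj (P t) = p t := fun t => congrFun hP t
  have hF0 : ∀ t : I, F (0, t) = p t := fun t => (F.map_zero_left t).trans (hc t)
  have hF1 : ∀ t : I, F (1, t) = q t := fun t => F.map_one_left t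
  have hF : ∀ s : I, F (s, 0) = F (s, 1) := fun s => F.prop s
  let f : C(I, G.Cover) := P.comp ⟨Subtype.val, continuous_subtype_val⟩
  let H := cov.liftHomotopy (F : C(I × I, G.Space)) f
    (fun a => (hF0 a).trans (hP' a).symm)
  have hH : ∀ a, G.coverProj (H a) = F a := fun a => congrFun (cov.liftHomotopy_lifts _ _ _) a
  have hH0 : ∀ t : I, H (0, t) = P t := fun t => cov.liftHomotopy_zero _ _ _ t
  set h : FreeGroup G.E := (P 0).sheet⁻¹ * (P 1).sheet with hh
  have hP1 : P 1 = deck h (P 0) := by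
    refine Cover.ext ?_ ?_
    · rw [coverProj_deck, hP', hP', ← hper 0, zero_add]
    · rw [sheet_deck, hh, mul_inv_cancel_left]
  have hdeck : ∀ t, P (t + 1) = deck h (P t) := by
    refine congrFun (cov.eq_of_comp_eq (P.continuous.comp (continuous_add_const 1))
      ((continuous_deck h).comp P.continuous) ?_ 0 ?_)
    · funext t
      simp only [Function.comp_apply, coverProj_deck, hP', hper]
    · simp [hP1]
  have hHdeck : ∀ s : I, H (s, 1) = deck h (H (s, 0)) := by
    refine congrFun (cov.eq_of_comp_eq (g₁ := fun s : I => H (s, 1))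
      (g₂ := fun s : I => deck h (H (s, 0))) (by fun_prop)
      ((continuous_deck h).comp (by fun_prop)) ?_ 0 ?_)
    · funext s
      simp only [Function.comp_apply, coverProj_deck, hH, hF]
    · have e1 : H (0, 1) = P 1 := hH0 1
      have e0 : H (0, 0) = P 0 := hH0 0
      simp only [e0, e1, hP1]
  have deck_mul : ∀ (a b : FreeGroup G.E) (z : G.Cover), deck b (deck a z) = deck (a * b) z :=
    fun a b z => Cover.ext rfl (mul_assoc _ _ _)
  have hPk : ∀ k : ℕ, P k = deck (h ^ k) (P 0) := by
    intro k
    induction k with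
    | zero => exact Cover.ext (by simp [coverProj_deck]) (by simp [sheet_deck])
    | succ k ih => rw [Nat.cast_succ, hdeck, ih, deck_mul, pow_succ]
  set z := H (1, 0) with hz
  have hzk : ∀ k : ℕ, height (deck (h ^ k) z) ≤ height z + k * (pathLength q).toReal := by
    intro k
    induction k with
    | zero =>
      have : deck (h ^ 0) z = z := Cover.ext rfl (by simp [sheet_deck])
      rw [this]; simp
    | succ k ih =>
      have := edist_height_le (G := G) ⟨fun t => deck (h ^ k) (H (1, t)),
        (continuous_deck _).comp (by fun_prop)⟩
      simp only [ContinuousMap.coe_mk, coverProj_deck, hH, hF1, hHdeck, deck_mul] at this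
      rw [← hz, ← pow_succ'] at this
      have h2 : edist (height (deck (h ^ k) z)) (height (deck (h ^ (k + 1)) z)) ≤
        ENNReal.ofReal (pathLength q).toReal := by
        rw [ENNReal.ofReal_toReal hfin]; exact this
      rw [edist_dist, ENNReal.ofReal_le_ofReal_iff ENNReal.toReal_nonneg, Real.dist_eq,
        abs_le] at h2
      push_cast
      linarith
  obtain ⟨C, hC⟩ := exists_abs_height_sub_weight_le G
  obtain ⟨C', hC'⟩ := exists_abs_weight_mul_sub_le G.len ((P 0).sheet * z.sheet⁻¹)
  have hS' : S ≤ (pathLength q).toReal := by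
    by_contra hlt
    push Not at hlt
    obtain ⟨k, hk⟩ := exists_nat_gt ((height z + height (P 0) + 2 * C + C') /
      (S - (pathLength q).toReal))
    rw [div_lt_iff₀ (by linarith)] at hk
    have a1 := le_height_add hS P.continuous (by simpa only [hP'] using hg) (Nat.cast_nonneg k)
    rw [hPk] at a1
    have a2 := abs_le.1 (hC (deck (h ^ k) (P 0)))
    have a3 := abs_le.1 (hC (deck (h ^ k) z))
    have a4 := abs_le.1 (hC' (z.sheet * h ^ k))
    have a5 := hzk k
    rw [sheet_deck] at a2 a3
    rw [mul_assoc, inv_mul_cancel_left] at a4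
    linarith
  calc ENNReal.ofReal S ≤ ENNReal.ofReal (pathLength q).toReal := ENNReal.ofReal_le_ofReal hS'
    _ = pathLength q := ENNReal.ofReal_toReal hfin

end MetricGraph

section

variable {X : Type*} [MetricSpace X]

theorem LipPath.of_dist_le {K L : ℝ} {q : ℝ → X} (h : LipPath K L q) {s t η : ℝ}
    (hs : s ∈ Icc 0 L) (ht : t ∈ Icc 0 L) (hη : K * |s - t| ≤ η) : dist (q s) (q t) ≤ η :=
  (h s hs t ht).trans hη

theorem GeodesicMetric.exists_lipPath (hX : GeodesicMetric X) (x y : X) {l : ℝ} (hl : 0 < l) :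
    ∃ q : ℝ → X, q 0 = x ∧ q l = y ∧ LipPath (dist x y / l) l q := by
  obtain ⟨q, h0, h1, hq⟩ := hX x y
  refine ⟨fun t => q (dist x y / l * t), by simp [h0], ?_, ?_⟩
  · dsimp only
    rw [div_mul_cancel₀ _ hl.ne', h1]
  · have := hq.rescale (c := dist x y / l) (l' := l) (by positivity)
      (div_mul_cancel₀ _ hl.ne').le
    rwa [one_mul] at this

/-- A continuous path is uniformly approximated by Lipschitz paths with the same end points. -/
theorem GeodesicMetric.exists_lipPath_near (hX : GeodesicMetric X) {q : ℝ → X} {l : ℝ}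
    (hl : 0 ≤ l) (hq : ContinuousOn q (Icc 0 l)) {δ : ℝ} (hδ : 0 < δ) :
    ∃ (K : ℝ) (q' : ℝ → X), 0 ≤ K ∧ LipPath K l q' ∧ q' 0 = q 0 ∧ q' l = q l ∧
      ∀ t ∈ Icc 0 l, dist (q' t) (q t) ≤ δ := by
  set P : ℝ → Prop := fun x => ∃ (K : ℝ) (q' : ℝ → X), 0 ≤ K ∧ LipPath K x q' ∧ q' 0 = q 0 ∧
    q' x = q x ∧ ∀ t ∈ Icc 0 x, dist (q' t) (q t) ≤ δ with hP
  have ext : ∀ y x, 0 ≤ y → y < x → P y → (∀ s ∈ Icc y x, dist (q y) (q s) ≤ δ / 2) → P x := by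
    rintro y x hy hyx ⟨K, p, hK, hp, p0, p1, hc⟩ hosc
    obtain ⟨g, g0, g1, hg⟩ := hX.exists_lipPath (q y) (q x) (sub_pos.2 hyx)
    have hpg : p y = g 0 := p1.trans g0.symm
    have hd : 0 ≤ dist (q y) (q x) / (x - y) := div_nonneg dist_nonneg (by linarith)
    refine ⟨max K (dist (q y) (q x) / (x - y)), concat y p g, hK.trans (le_max_left _ _), ?_, ?_,
      ?_, ?_⟩
    · have := (hp.mono (le_max_left K (dist (q y) (q x) / (x - y))) le_rfl).concat hy
        (sub_pos.2 hyx).le (hg.mono (le_max_right _ _) le_rfl) hpg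
      rwa [add_sub_cancel] at this
    · rw [concat_of_le hy, p0]
    · rw [concat_of_ge hpg hyx.le, g1]
    · intro t ht
      rcases le_total t y with h | h
      · rw [concat_of_le h]; exact hc t ⟨ht.1, h⟩
      · rw [concat_of_ge hpg h]
        have h1 : dist (g (t - y)) (q y) ≤ δ / 2 := by
          rw [← g0]
          refine (hg (t - y) ⟨by linarith, by linarith [ht.2]⟩ 0 ⟨le_rfl, by linarith⟩).trans ?_
          rw [sub_zero, abs_of_nonneg (by linarith)]
          refine le_trans ?_ (hosc x ⟨hyx.le, le_rfl⟩)
          rw [div_mul_eq_mul_div, div_le_iff₀ (by linarith)]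
          exact mul_le_mul_of_nonneg_left (by linarith [ht.2]) dist_nonneg
        linarith [dist_triangle (g (t - y)) (q y) (q t), hosc t ⟨h, ht.2⟩]
  have osc : ∀ x ∈ Icc 0 l, ∃ ε > 0, ∀ s ∈ Icc 0 l, |s - x| < ε → dist (q s) (q x) < δ / 4 := by
    intro x hx
    obtain ⟨ε, hε, h⟩ := Metric.continuousWithinAt_iff.1 (hq x hx) (δ / 4) (by linarith)
    exact ⟨ε, hε, fun s hs hsx => h hs (by rwa [Real.dist_eq])⟩
  refine real_induction (P := P) (a := 0) (b := l) ?_ ?_ l ⟨hl, le_rfl⟩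
  · intro x hx h
    rcases hx.1.eq_or_lt with rfl | hx0
    · exact ⟨0, fun _ => q 0, le_rfl, fun s _ t _ => by simp, rfl, rfl, fun t ht => by
        rw [le_antisymm ht.2 ht.1, dist_self]; exact hδ.le⟩
    · obtain ⟨ε, hε, hosc⟩ := osc x hx
      set y := max 0 (x - ε / 2) with hy
      have y0 : 0 ≤ y := le_max_left _ _
      have yx : y < x := max_lt hx0 (by linarith)
      have y1 : x - ε / 2 ≤ y := le_max_right _ _
      refine ext y x y0 yx (h y ⟨y0, yx⟩) fun s hs => ?_
      have a1 := hosc y ⟨y0, yx.le.trans hx.2⟩ (by rw [abs_lt]; constructor <;> linarith)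
      have a2 := hosc s ⟨y0.trans hs.1, hs.2.trans hx.2⟩
        (by rw [abs_lt]; constructor <;> linarith [hs.1, hs.2])
      rw [dist_comm] at a2
      linarith [dist_triangle (q y) (q x) (q s)]
  · intro x hx h
    obtain ⟨ε, hε, hosc⟩ := osc x ⟨hx.1, hx.2.le⟩
    refine ⟨min ε (l - x), lt_min hε (by linarith [hx.2]), fun y hy => ?_⟩
    have m1 := hy.2.trans_le (add_le_add_right (min_le_left ε (l - x)) x)
    have m2 := hy.2.trans_le (add_le_add_right (min_le_right ε (l - x)) x)
    refine ext x y hx.1 hy.1 (h x ⟨hx.1, le_rfl⟩) fun s hs => ?_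
    rw [dist_comm]
    exact (hosc s ⟨hx.1.trans hs.1, by linarith [hs.2]⟩
      (by rw [abs_of_nonneg (by linarith [hs.1])]; linarith [hs.2])).le.trans (by linarith)

/-- The initial point of a path can be moved by `η` at the cost of an increase of the speed. -/
theorem GeodesicMetric.exists_lipPath_move_left (hX : GeodesicMetric X) {q : ℝ → X} {K l η : ℝ}
    (hl : 0 < l) (hK : 0 ≤ K) (hη : 0 < η) (hq : LipPath K l q) {x : X}
    (hx : dist x (q 0) ≤ η) :
    ∃ q' : ℝ → X, LipPath (K + η / l) l q' ∧ q' 0 = x ∧ q' l = q l ∧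
      ∀ t ∈ Icc 0 l, dist (q' t) (q t) ≤ 3 * η := by
  obtain ⟨g, g0, g1, hg⟩ := hX.exists_lipPath x (q 0) hη
  have hg' : LipPath 1 η g := hg.mono ((div_le_one hη).2 hx) le_rfl
  have hc : LipPath 1 (K * l) (fun t => q (t / K)) := by
    rcases hK.eq_or_lt with rfl | hK0
    · intro s _ t _
      simp
    · have := hq.rescale (c := 1 / K) (l' := K * l) (by positivity)
        (by rw [one_div_mul_eq_div, mul_div_cancel_left₀ _ hK0.ne'])
      rw [mul_one_div_cancel hK0.ne'] at this
      exact this.congr fun t _ => by rw [one_div_mul_eq_div]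
  have hgc : g η = q (0 / K) := by rw [g1, zero_div]
  have hL : 0 ≤ K * l := by positivity
  have hp := hg'.concat hη.le hL hc hgc
  have hcl : (K + η / l) * l = η + K * l := by field_simp; ring
  have hk0 : 0 < K + η / l := by positivity
  refine ⟨fun t => concat η g (fun t => q (t / K)) ((K + η / l) * t), ?_, ?_, ?_, ?_⟩
  · have := hp.rescale hk0.le hcl.le
    rwa [one_mul] at this
  · dsimp only
    rw [mul_zero, concat_of_le hη.le, g0]
  · dsimp only
    rw [hcl, concat_of_ge hgc (by linarith), add_sub_cancel_left]
    rcases hK.eq_or_lt with rfl | hK0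
    · have := hq 0 ⟨le_rfl, hl.le⟩ l ⟨hl.le, le_rfl⟩
      rw [zero_mul, dist_le_zero] at this
      simpa using this
    · rw [mul_div_cancel_left₀ _ hK0.ne']
  · intro t ht
    have ht1 : (K + η / l) * t = K * t + η * (t / l) := by ring
    have ht2 : t / l ≤ 1 := (div_le_one hl).2 ht.2
    have ht3 : 0 ≤ t / l := div_nonneg ht.1 hl.le
    have ht4 : 0 ≤ K * t := mul_nonneg hK ht.1
    dsimp only
    rcases le_total ((K + η / l) * t) η with h | h
    · rw [concat_of_le h]
      have a1 := hg' ((K + η / l) * t) ⟨mul_nonneg hk0.le ht.1, h⟩ η ⟨hη.le, le_rfl⟩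
      have a2 := hq 0 ⟨le_rfl, hl.le⟩ t ht
      rw [g1, abs_of_nonpos (by linarith)] at a1
      rw [zero_sub, abs_neg, abs_of_nonneg ht.1] at a2
      have := mul_nonneg hη.le ht3
      linarith [dist_triangle (g ((K + η / l) * t)) (q 0) (q t)]
    · rw [concat_of_ge (q := fun t => q (t / K)) hgc h]
      rcases hK.eq_or_lt with rfl | hK0
      · have := hq (((0 + η / l) * t - η) / 0) (by simp [hl.le]) t ht
        rw [zero_mul] at this
        linarith
      · have e1 : ((K + η / l) * t - η) / K - t = (η * (t / l) - η) / K := by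
          field_simp; ring
        have m : ((K + η / l) * t - η) / K ∈ Icc 0 l := by
          refine ⟨div_nonneg (by linarith) hK0.le, ?_⟩
          rw [div_le_iff₀ hK0]
          have := mul_le_mul_of_nonneg_left ht.2 hk0.le
          linarith
        refine hq.of_dist_le m ht ?_
        rw [e1, abs_div, abs_of_pos hK0, mul_div_cancel₀ _ hK0.ne', abs_of_nonpos (by nlinarith)]
        have := mul_nonneg hη.le ht3
        linarith

theorem GeodesicMetric.exists_lipPath_move_right (hX : GeodesicMetric X) {q : ℝ → X} {K l η : ℝ}
    (hl : 0 < l) (hK : 0 ≤ K) (hη : 0 < η) (hq : LipPath K l q) {y : X}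
    (hy : dist y (q l) ≤ η) :
    ∃ q' : ℝ → X, LipPath (K + η / l) l q' ∧ q' 0 = q 0 ∧ q' l = y ∧
      ∀ t ∈ Icc 0 l, dist (q' t) (q t) ≤ 3 * η := by
  obtain ⟨q', h1, h2, h3, h4⟩ := hX.exists_lipPath_move_left hl hK hη hq.reverse (x := y)
    (by simpa using hy)
  refine ⟨fun t => q' (l - t), h1.reverse, by simpa using h3, by simpa using h2, fun t ht => ?_⟩
  have := h4 (l - t) ⟨by linarith [ht.2], by linarith [ht.1]⟩
  simpa using this

/-- A path that is not a geodesic on `[x, y]` can be replaced by a slower one that is close. -/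
theorem GeodesicMetric.exists_lipPath_shorten (hX : GeodesicMetric X) {q : ℝ → X} {K l : ℝ}
    (hl : 0 < l) (hq : LipPath K l q) {x y : ℝ} (hx : 0 ≤ x) (hxy : x < y) (hy : y ≤ l)
    (hd : dist (q x) (q y) < K * (y - x)) :
    ∃ (K' : ℝ) (q' : ℝ → X), 0 ≤ K' ∧ K' < K ∧ LipPath K' l q' ∧ q' 0 = q 0 ∧ q' l = q l ∧
      ∀ t ∈ Icc 0 l, dist (q' t) (q t) ≤ 3 * (K * (y - x)) := by
  have hK : 0 < K := by
    by_contra h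
    have : K * (y - x) ≤ 0 := mul_nonpos_of_nonpos_of_nonneg (not_lt.1 h) (by linarith)
    linarith [dist_nonneg (x := q x) (y := q y)]
  set c : ℝ → X := fun t => q (t / K) with hc
  set L := K * l with hL
  set m := K * (y - x) with hm
  set d := dist (q x) (q y) with hdd
  have hd0 : 0 ≤ d := dist_nonneg
  have hcK : ∀ t, c (K * t) = q t := fun t => by simp only [hc]; rw [mul_div_cancel_left₀ _ hK.ne']
  have hcl : LipPath 1 L c := by
    have := hq.rescale (c := 1 / K) (l' := K * l) (by positivity)
      (by rw [one_div_mul_eq_div, mul_div_cancel_left₀ _ hK.ne'])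
    rw [mul_one_div_cancel hK.ne'] at this
    exact this.congr fun t _ => by rw [one_div_mul_eq_div]
  have hX0 : 0 ≤ K * x := by positivity
  have hY : K * y = K * x + m := by rw [hm]; ring
  have hYL : K * y ≤ L := by rw [hL]; gcongr
  obtain ⟨g, g0, g1, hg⟩ := hX (q x) (q y)
  rw [← hdd] at g1 hg
  have htail : LipPath 1 (L - K * y) (fun t => c (K * y + t)) := by
    intro s hs t ht
    have := hcl (K * y + s) ⟨by linarith [hs.1], by linarith [hs.2]⟩ (K * y + t)
      ⟨by linarith [ht.1], by linarith [ht.2]⟩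
    rwa [add_sub_add_left_eq_sub] at this
  have j1 : g d = c (K * y + 0) := by rw [g1, add_zero, hcK]
  have hgt := hg.concat hd0 (sub_nonneg.2 hYL) htail j1
  have j2 : c (K * x) = concat d g (fun t => c (K * y + t)) 0 := by
    rw [concat_of_le hd0, g0, hcK]
  set p := concat (K * x) c (concat d g fun t => c (K * y + t)) with hp
  have hpl : LipPath 1 (K * x + (d + (L - K * y))) p :=
    (hcl.mono le_rfl (by linarith)).concat hX0 (by linarith) hgt j2
  set L' := K * x + (d + (L - K * y)) with hL'
  have hL'0 : 0 ≤ L' := by linarith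
  have hLL : L' = L - (m - d) := by rw [hL']; linarith
  have near : ∀ s ∈ Icc 0 L', dist (p s) (c s) ≤ 2 * m := by
    intro s hs
    rcases le_total s (K * x) with h | h
    · rw [hp, concat_of_le h, dist_self]; linarith
    rw [hp, concat_of_ge j2 h]
    rcases le_total (s - K * x) d with h' | h'
    · rw [concat_of_le h']
      have a1 := hg (s - K * x) ⟨by linarith, h'⟩ 0 ⟨le_rfl, hd0⟩
      have a2 := hcl (K * x) ⟨hX0, by linarith⟩ s ⟨hs.1, by linarith [hs.2]⟩
      rw [g0, sub_zero, abs_of_nonneg (by linarith)] at a1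
      rw [hcK, abs_of_nonpos (by linarith)] at a2
      linarith [dist_triangle (g (s - K * x)) (q x) (c s)]
    · rw [concat_of_ge j1 h']
      refine hcl.of_dist_le ⟨by linarith, by linarith [hs.2]⟩ ⟨hs.1, by linarith [hs.2]⟩ ?_
      rw [one_mul, abs_of_nonneg (by linarith)]
      linarith
  refine ⟨L' / l, fun t => p (L' / l * t), by positivity, ?_, ?_, ?_, ?_, fun t ht => ?_⟩
  · rw [div_lt_iff₀ hl]; linarith
  · have := hpl.rescale (c := L' / l) (l' := l) (by positivity) (div_mul_cancel₀ _ hl.ne').le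
    rwa [one_mul] at this
  · dsimp only
    rw [mul_zero, hp, concat_of_le hX0, ← hcK, mul_zero]
  · dsimp only
    rw [div_mul_cancel₀ _ hl.ne', hp, concat_of_ge j2 (by linarith), concat_of_ge j1 (by linarith)]
    rw [← hcK l]
    congr 1
    linarith
  · have hc0 : 0 ≤ L' / l := by positivity
    have e1 : L' / l * t = K * t - (m - d) * (t / l) := by
      rw [hLL, hL]; field_simp
    have ht2 : t / l ≤ 1 := (div_le_one hl).2 ht.2
    have ht3 : 0 ≤ t / l := div_nonneg ht.1 hl.le
    have hmem : L' / l * t ∈ Icc 0 L' := ⟨mul_nonneg hc0 ht.1, by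
      calc L' / l * t ≤ L' / l * l := by gcongr; exact ht.2
        _ = L' := div_mul_cancel₀ _ hl.ne'⟩
    have a1 := near _ hmem
    have a2 : dist (c (L' / l * t)) (q t) ≤ m := by
      rw [← hcK t]
      refine hcl.of_dist_le ⟨hmem.1, hmem.2.trans (by linarith)⟩
        ⟨mul_nonneg hK.le ht.1, by rw [hL]; gcongr; exact ht.2⟩ ?_
      rw [e1, one_mul, sub_sub_cancel_left, abs_neg, abs_of_nonneg (by nlinarith)]
      nlinarith
    linarith [dist_triangle (p (L' / l * t)) (c (L' / l * t)) (q t)]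

end

namespace MetricGraph

variable {A B : MetricGraph}

/-- `f` is `κ e`-Lipschitz on every edge `e`. -/
def EdgeLip (f : A.Space → B.Space) (κ : A.E → ℝ≥0) : Prop :=
  ∀ e, LipPath (κ e) (A.len e) fun t => f (A.pt e t)

theorem EdgeLip.dist_le {f : A.Space → B.Space} {κ : A.E → ℝ≥0} (hf : EdgeLip f κ) {K : ℝ≥0}
    (hK : ∀ e, κ e ≤ K) (x y : A.Space) : dist (f x) (f y) ≤ K * dist x y :=
  dist_map_le K.2 f (fun e s hs t ht => (hf e s hs t ht).trans
    (mul_le_mul_of_nonneg_right (hK e) (abs_nonneg _))) x y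

theorem EdgeLip.lipschitzWith {f : A.Space → B.Space} {κ : A.E → ℝ≥0} (hf : EdgeLip f κ)
    {K : ℝ≥0} (hK : ∀ e, κ e ≤ K) : LipschitzWith K f :=
  LipschitzWith.of_dist_le_mul (hf.dist_le hK)

theorem EdgeLip.continuous {f : A.Space → B.Space} {κ : A.E → ℝ≥0} (hf : EdgeLip f κ) :
    Continuous f :=
  (hf.lipschitzWith (K := Finset.univ.sup κ) fun e => Finset.le_sup (Finset.mem_univ e)).continuous

/-- Lipschitz paths on the edges fit together to a map of the graph. -/
theorem exists_map_of_edges {κ : A.E → ℝ≥0} (a : A.V → B.Space) (q : A.E → ℝ → B.Space)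
    (h0 : ∀ e, q e 0 = a (A.src e)) (h1 : ∀ e, q e (A.len e) = a (A.tgt e))
    (hq : ∀ e, LipPath (κ e) (A.len e) (q e)) :
    ∃ f : C(A.Space, B.Space), EdgeLip f κ ∧ (∀ v, f (Space.vertex v) = a v) ∧
      ∀ e, ∀ t ∈ Icc 0 (A.len e), f (A.pt e t) = q e t := by
  have h : EdgeLip (edgeMap a q) κ := fun e =>
    (hq e).congr fun t ht => edgeMap_pt h0 h1 e ht
  exact ⟨⟨edgeMap a q, h.continuous⟩, h, fun v => rfl, fun e t ht => edgeMap_pt h0 h1 e ht⟩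

theorem forall_dist_lt {f g : A.Space → B.Space} {r : ℝ}
    (hv : ∀ v, dist (f (Space.vertex v)) (g (Space.vertex v)) < r)
    (he : ∀ e, ∀ t ∈ Icc 0 (A.len e), dist (f (A.pt e t)) (g (A.pt e t)) < r) (x : A.Space) :
    dist (f x) (g x) < r := by
  rcases x with v | ⟨e, t⟩
  · exact hv v
  · rw [← pt_inner]; exact he e t ⟨t.2.1.le, t.2.2.le⟩

theorem exists_homotopic_edgeLip (f : C(A.Space, B.Space)) :
    ∃ (g : C(A.Space, B.Space)) (κ : A.E → ℝ≥0), f.Homotopic g ∧ EdgeLip g κ := by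
  obtain ⟨r, hr, H⟩ := B.exists_homotopic
  choose K q hK hq h0 h1 hc using fun e => B.geodesicMetric.exists_lipPath_near
    (q := fun t => f (A.pt e t)) (A.len_pos e).le
    (f.continuous.comp_continuousOn (continuous_pt e)) (half_pos hr)
  obtain ⟨g, hg, hgv, hge⟩ := exists_map_of_edges (κ := fun e => ⟨K e, hK e⟩)
    (fun v => f (Space.vertex v)) q (fun e => by rw [h0, pt_zero]) (fun e => by rw [h1, pt_len]) hq
  refine ⟨g, _, H _ _ _ (forall_dist_lt (fun v => ?_) fun e t ht => ?_), hg⟩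
  · rw [hgv, dist_self]; exact hr
  · rw [hge e t ht, dist_comm]
    exact (hc e t ht).trans_lt (by linarith)

/-- The edgewise Lipschitz constants of the maps in a class of maps. -/
def lipConstants (P : C(A.Space, B.Space) → Prop) : Set (A.E → ℝ≥0) :=
  {κ | ∃ f : C(A.Space, B.Space), P f ∧ EdgeLip f κ}

theorem isClosed_lipConstants {P : C(A.Space, B.Space) → Prop}
    (hP : ∀ f g : C(A.Space, B.Space), f.Homotopic g → P f → P g) :
    IsClosed (lipConstants P) := by
  refine IsSeqClosed.isClosed fun κ κ' hκ hlim => ?_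
  choose f hf hlip using hκ
  obtain ⟨F, hF⟩ := exists_ultralimit fun n => (f n : A.Space → B.Space)
  have hu := hlim.mono_left (Nat.hyperfilter_le_atTop)
  have hFlip : EdgeLip F κ' := fun e s hs t ht => by
    have l : Tendsto (fun n => (κ n e : ℝ) * |s - t|) (hyperfilter ℕ) (𝓝 (κ' e * |s - t|)) :=
      ((NNReal.continuous_coe.tendsto _).comp (((continuous_apply e).tendsto _).comp hu)).mul_const _
    exact le_of_tendsto_of_tendsto' ((hF _).dist (hF _)) l fun n => hlip n e s hs t ht
  obtain ⟨r, hr, H⟩ := B.exists_homotopic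
  set K : ℝ≥0 := Finset.univ.sup κ' + 1 with hK
  have hK1 : ∀ e, κ' e < K := fun e =>
    (Finset.le_sup (Finset.mem_univ e)).trans_lt (lt_add_of_pos_right _ one_pos)
  have hev : ∀ᶠ n in (hyperfilter ℕ : Filter ℕ), ∀ e, κ n e ≤ K :=
    eventually_all.2 fun e =>
      ((((continuous_apply e).tendsto _).comp hu).eventually (gt_mem_nhds (hK1 e))).mono
        fun n hn => le_of_lt hn
  set ε : ℝ := r / (2 * K + 1) with hε
  have hKpos : (0 : ℝ) < 2 * K + 1 := by positivity
  have hε0 : 0 < ε := by positivity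
  obtain ⟨T, -, hTfin, hT⟩ := finite_cover_balls_of_compact (isCompact_univ (X := A.Space))
    (show 0 < ε / 2 by positivity)
  have hev2 : ∀ᶠ n in (hyperfilter ℕ : Filter ℕ), ∀ a ∈ T, dist (f n a) (F a) < ε / 2 :=
    (eventually_all_finite hTfin).2 fun a _ => (tendsto_iff_dist_tendsto_zero.1 (hF a)).eventually
      (gt_mem_nhds (by positivity))
  obtain ⟨n, hn1, hn2⟩ := (hev.and hev2).exists
  refine ⟨⟨F, hFlip.continuous⟩, hP (f n) _ (H _ _ _ fun x => ?_) (hf n), hFlip⟩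
  obtain ⟨a, ha, hx⟩ := mem_iUnion₂.1 (hT (mem_univ x))
  rw [Metric.mem_ball] at hx
  have b1 := (hlip n).dist_le hn1 x a
  have b2 := hFlip.dist_le (fun e => (hK1 e).le) a x
  rw [dist_comm a x] at b2
  have b3 := hn2 a ha
  have b4 : (K : ℝ) * dist x a ≤ K * (ε / 2) := mul_le_mul_of_nonneg_left hx.le K.2
  have b5 : ε * (2 * K + 1) = r := div_mul_cancel₀ _ hKpos.ne'
  have := dist_triangle4 (f n x) (f n a) (F a) (F x)
  have b6 : 0 ≤ (K : ℝ) * ε := by positivity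
  change dist (f n x) (F x) < r
  nlinarith

/-- `f` is locally a geodesic on every edge, of speed `κ e`. -/
def EdgeGeodesic (f : A.Space → B.Space) (κ : A.E → ℝ≥0) : Prop :=
  ∀ e, ∀ t ∈ Icc 0 (A.len e), ∃ ε > 0, ∀ x ∈ Icc 0 (A.len e), ∀ y ∈ Icc 0 (A.len e),
    |x - t| < ε → |y - t| < ε → dist (f (A.pt e x)) (f (A.pt e y)) = κ e * |x - y|

theorem edgeGeodesic_of_minimal {P : C(A.Space, B.Space) → Prop}
    (hP : ∀ f g : C(A.Space, B.Space), f.Homotopic g → P f → P g) {f : C(A.Space, B.Space)}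
    {κ : A.E → ℝ≥0} (hf : P f) (hκ : EdgeLip f κ)
    (hmin : ∀ κ' ∈ lipConstants P, κ' ≤ κ → κ' = κ) : EdgeGeodesic f κ := by
  classical
  obtain ⟨r, hr, H⟩ := B.exists_homotopic
  intro e t ht
  set ε : ℝ := r / (6 * κ e + 1) with hε
  have hκ0 : (0 : ℝ) ≤ κ e := (κ e).2
  have hε0 : 0 < ε := by positivity
  have main : ∀ x ∈ Icc 0 (A.len e), ∀ y ∈ Icc 0 (A.len e), |x - t| < ε → |y - t| < ε → x < y →
      dist (f (A.pt e x)) (f (A.pt e y)) = κ e * |x - y| := by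
    intro x hx y hy hxt hyt hxy
    refine le_antisymm (hκ e x hx y hy) (not_lt.1 fun hlt => ?_)
    rw [abs_of_neg (sub_neg.2 hxy), neg_sub] at hlt
    obtain ⟨k, q, hk0, hk, hq, q0, q1, hnear⟩ := B.geodesicMetric.exists_lipPath_shorten
      (A.len_pos e) (hκ e) hx.1 hxy hy.2 hlt
    lift k to ℝ≥0 using hk0
    obtain ⟨g, hg, hgv, hge⟩ := exists_map_of_edges (κ := Function.update κ e k)
      (fun v => f (Space.vertex v)) (Function.update (fun e' t => f (A.pt e' t)) e q)
      (fun e' => by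
        rcases eq_or_ne e' e with rfl | hne
        · rw [Function.update_self, q0, pt_zero]
        · rw [Function.update_of_ne hne, pt_zero])
      (fun e' => by
        rcases eq_or_ne e' e with rfl | hne
        · rw [Function.update_self, q1, pt_len]
        · rw [Function.update_of_ne hne, pt_len])
      (fun e' => by
        rcases eq_or_ne e' e with rfl | hne
        · rw [Function.update_self, Function.update_self]; exact hq
        · rw [Function.update_of_ne hne, Function.update_of_ne hne]; exact hκ e')
    have hfg : f.Homotopic g := H _ _ _ <| forall_dist_lt
      (fun v => by rw [hgv, dist_self]; exact hr) fun e' s hs => by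
        rw [hge e' s hs]
        rcases eq_or_ne e' e with rfl | hne
        · rw [Function.update_self, dist_comm]
          refine (hnear s hs).trans_lt ?_
          have h1 : y - x < 2 * ε := by linarith [(abs_lt.1 hxt).1, (abs_lt.1 hyt).2]
          have h2 : ε * (6 * κ e' + 1) = r := div_mul_cancel₀ _ (by positivity)
          have h3 := mul_le_mul_of_nonneg_left h1.le hκ0
          nlinarith
        · rw [Function.update_of_ne hne, dist_self]; exact hr
    have hle : Function.update κ e k ≤ κ := fun e' => by
      rcases eq_or_ne e' e with rfl | hne
      · rw [Function.update_self]; exact_mod_cast hk.le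
      · rw [Function.update_of_ne hne]
    have := congrFun (hmin _ ⟨g, hP _ _ hfg hf, hg⟩ hle) e
    rw [Function.update_self] at this
    rw [this] at hk
    exact lt_irrefl _ hk
  refine ⟨ε, hε0, fun x hx y hy hxt hyt => ?_⟩
  rcases lt_trichotomy x y with h | rfl | h
  · exact main x hx y hy hxt hyt h
  · simp
  · rw [dist_comm, abs_sub_comm]; exact main y hy x hx hyt hxt h

theorem EdgeGeodesic.isGerm {f : A.Space → B.Space} {κ : A.E → ℝ≥0} (hf : EdgeGeodesic f κ)
    (h : A.E × Bool) : IsGerm (κ h.1) fun s => f (arm h s) := by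
  obtain ⟨ε, hε, H⟩ := hf h.1 _ (arm_mem (zero_mem h.1))
  refine ⟨min ε (A.len h.1), lt_min hε (A.len_pos _), fun s hs t ht => ?_⟩
  have h1 := hs.2.trans_le (min_le_left _ _)
  have h2 := hs.2.trans_le (min_le_right _ _)
  have h3 := ht.2.trans_le (min_le_left _ _)
  have h4 := ht.2.trans_le (min_le_right _ _)
  have := H _ (arm_mem ⟨hs.1, h2.le⟩) _ (arm_mem ⟨ht.1, h4.le⟩)
    (by rwa [arm_sub, sub_zero, abs_of_nonneg hs.1])
    (by rwa [arm_sub, sub_zero, abs_of_nonneg ht.1])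
  rwa [arm_sub] at this

/-- A turn is legal if its image under `f` is locally a geodesic of speed `S`. -/
def Legal (f : A.Space → B.Space) (S : ℝ) (h h' : A.E × Bool) : Prop :=
  ∃ ε > 0, ∀ s ∈ Ico 0 ε, ∀ t ∈ Ico 0 ε, dist (f (arm h s)) (f (arm h' t)) = S * (s + t)

/-- If the images of all fast half-edges at a vertex have the same germ, then these half-edges can
be slowed down. -/
theorem exists_slower {P : C(A.Space, B.Space) → Prop}
    (hP : ∀ f g : C(A.Space, B.Space), f.Homotopic g → P f → P g) {f : C(A.Space, B.Space)}
    {κ : A.E → ℝ≥0} (hf : P f) (hκ : EdgeLip f κ) {S : ℝ≥0} (hS : 0 < S) (hκS : ∀ e, κ e ≤ S)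
    {h : A.E × Bool} (hh : κ h.1 = S)
    (hgerm : ∀ h', κ h'.1 = S → base h' = base h →
      ∃ ε > 0, ∀ s ∈ Ico 0 ε, f (arm h' s) = f (arm h s)) :
    ∃ κ' ∈ lipConstants P, (∀ e, κ' e ≤ S) ∧ (∀ e, κ' e = S → κ e = S) ∧ κ' h.1 < S := by
  classical
  obtain ⟨r, hr, H⟩ := B.exists_homotopic
  have hS' : (0 : ℝ) < S := hS
  set v := base h with hv
  have small : ∀ c : ℝ, 0 < c → ∀ᶠ s in 𝓝[>] (0 : ℝ), s < c := fun c hc =>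
    (gt_mem_nhds hc).filter_mono nhdsWithin_le_nhds
  obtain ⟨s, hs0, hsr, hse, hsg⟩ : ∃ s : ℝ, 0 < s ∧ 6 * (S * s) < r ∧
      (∀ e, 2 * s < A.len e ∧ (κ e < S → κ e + 2 * (S * s / A.len e) < S)) ∧
      ∀ h', κ h'.1 = S → base h' = v → f (arm h' s) = f (arm h s) := by
    have e1 : ∀ᶠ s in 𝓝[>] (0 : ℝ), 6 * (S * s) < r :=
      (small (r / (6 * S)) (by positivity)).mono fun s hs => by
        rw [lt_div_iff₀ (by positivity)] at hs; linarith
    have e2 : ∀ᶠ s in 𝓝[>] (0 : ℝ), ∀ e, 2 * s < A.len e ∧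
        (κ e < S → (κ e : ℝ) + 2 * (S * s / A.len e) < S) := by
      refine eventually_all.2 fun e => ?_
      have hl := A.len_pos e
      refine ((small (A.len e / 2) (by positivity)).mono fun s hs => by linarith).and ?_
      by_cases hlt : κ e < S
      · have hlt' : (0 : ℝ) < S - κ e := sub_pos.2 hlt
        refine (small ((S - κ e) * A.len e / (2 * S)) (by positivity)).mono fun s hs _ => ?_
        rw [lt_div_iff₀ (by positivity)] at hs
        have : 2 * (S * s / A.len e) < S - κ e := by
          rw [← mul_div_assoc, div_lt_iff₀ hl]; linarith
        linarith
      · exact Eventually.of_forall fun s hc => absurd hc hlt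
    have e3 : ∀ᶠ s in 𝓝[>] (0 : ℝ), ∀ h', κ h'.1 = S → base h' = v →
        f (arm h' s) = f (arm h s) := by
      refine eventually_all.2 fun h' => ?_
      by_cases hc : κ h'.1 = S ∧ base h' = v
      · obtain ⟨ε, hε, hg⟩ := hgerm h' hc.1 hc.2
        filter_upwards [small ε hε, self_mem_nhdsWithin] with s hs hs0 _ _
        exact hg s ⟨le_of_lt hs0, hs⟩
      · exact Eventually.of_forall fun s h1 h2 => absurd ⟨h1, h2⟩ hc
    obtain ⟨s, ⟨h1, h2, h3⟩, h0⟩ := ((e1.and (e2.and e3)).and self_mem_nhdsWithin).exists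
    exact ⟨s, h0, h1, h2, h3⟩
  have hη : 0 < (S : ℝ) * s := by positivity
  let a : A.V → B.Space := fun u => if u = v then f (arm h s) else f (Space.vertex u)
  have ha : ∀ u, dist (a u) (f (Space.vertex u)) ≤ S * s := by
    intro u
    simp only [a]
    split_ifs with hu
    · have := hκ.dist_le hκS (arm h s) (arm h 0)
      rw [hu, hv, ← arm_zero]
      refine this.trans (mul_le_mul_of_nonneg_left ?_ hS'.le)
      refine (dist_arm_le h ⟨hs0.le, by linarith [(hse h.1).1]⟩ (zero_mem _)).trans_eq ?_
      rw [sub_zero, abs_of_pos hs0]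
    · rw [dist_self]; exact hη.le
  have edge : ∀ e, ∃ (k : ℝ≥0) (q : ℝ → B.Space), LipPath k (A.len e) q ∧ q 0 = a (A.src e) ∧
      q (A.len e) = a (A.tgt e) ∧ (∀ t ∈ Icc 0 (A.len e), dist (q t) (f (A.pt e t)) < r) ∧
      k ≤ S ∧ (k = S → κ e = S) ∧ (κ e = S → (A.src e = v ∨ A.tgt e = v) → k < S) := by
    intro e
    have hl := A.len_pos e
    obtain ⟨hs2, hslow⟩ := hse e
    by_cases he : κ e = S
    · set α : ℝ := if A.src e = v then s else 0 with hα
      set β : ℝ := if A.tgt e = v then s else 0 with hβ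
      have α0 : 0 ≤ α := by rw [hα]; split_ifs <;> simp [hs0.le]
      have β0 : 0 ≤ β := by rw [hβ]; split_ifs <;> simp [hs0.le]
      have α1 : α ≤ s := by rw [hα]; split_ifs <;> simp [hs0.le]
      have β1 : β ≤ s := by rw [hβ]; split_ifs <;> simp [hs0.le]
      set c : ℝ := (A.len e - α - β) / A.len e with hc
      have hc0 : 0 ≤ c := div_nonneg (by linarith) hl.le
      have hcl : c * A.len e = A.len e - α - β := div_mul_cancel₀ _ hl.ne'
      have hc1 : c ≤ 1 := (div_le_one hl).2 (by linarith)
      have mem : ∀ t ∈ Icc 0 (A.len e), α + c * t ∈ Icc 0 (A.len e) := fun t ht => by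
        have := mul_le_mul_of_nonneg_left ht.2 hc0
        have := mul_nonneg hc0 ht.1
        constructor <;> linarith
      refine ⟨S * ⟨c, hc0⟩, fun t => f (A.pt e (α + c * t)), ?_, ?_, ?_, ?_, ?_, fun _ => he, ?_⟩
      · intro t ht t' ht'
        refine (hκ e _ (mem t ht) _ (mem t' ht')).trans_eq ?_
        rw [add_sub_add_left_eq_sub, ← mul_sub, abs_mul, abs_of_nonneg hc0, he, ← mul_assoc]
        rfl
      · simp only [mul_zero, add_zero, a, hα]
        split_ifs with hsrc
        · exact hsg (e, false) he hsrc
        · rw [pt_zero]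
      · have : α + c * A.len e = A.len e - β := by rw [hcl]; ring
        simp only [this, a, hβ]
        split_ifs with htgt
        · exact hsg (e, true) he htgt
        · rw [sub_zero, pt_len]
      · intro t ht
        refine (hκ e _ (mem t ht) _ ht).trans_lt (lt_of_le_of_lt ?_ hsr)
        have h1 : (1 - c) * t ≤ (1 - c) * A.len e :=
          mul_le_mul_of_nonneg_left ht.2 (by linarith)
        have h2 : 0 ≤ (1 - c) * t := mul_nonneg (by linarith) ht.1
        have : |α + c * t - t| ≤ 2 * s := by
          rw [abs_le]; constructor <;> nlinarith
        rw [he]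
        have := mul_le_mul_of_nonneg_left this hS'.le
        linarith
      · exact mul_le_of_le_one_right' (show (⟨c, hc0⟩ : ℝ≥0) ≤ 1 from hc1)
      · intro _ hor
        have : c < 1 := by
          rw [hc, div_lt_one hl]
          rcases hor with h1 | h1
          · rw [hα, if_pos h1]; linarith
          · rw [hβ, if_pos h1]; linarith
        exact mul_lt_of_lt_one_right hS (show (⟨c, hc0⟩ : ℝ≥0) < 1 from this)
    · have hlt := lt_of_le_of_ne (hκS e) he
      have hK0 : (0 : ℝ) ≤ κ e := (κ e).2
      obtain ⟨q, hq, q0, q1, hqn⟩ := B.geodesicMetric.exists_lipPath_move_left hl hK0 hη (hκ e)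
        (x := a (A.src e)) (by rw [pt_zero]; exact ha _)
      obtain ⟨q', hq', q0', q1', hqn'⟩ := B.geodesicMetric.exists_lipPath_move_right hl
        (by positivity) hη hq (y := a (A.tgt e)) (by rw [q1, pt_len]; exact ha _)
      have hk : (κ e : ℝ) + S * s / A.len e + S * s / A.len e < S := by linarith [hslow hlt]
      have hk' : (⟨κ e + S * s / A.len e + S * s / A.len e, by positivity⟩ : ℝ≥0) < S := hk
      refine ⟨⟨κ e + S * s / A.len e + S * s / A.len e, by positivity⟩, q', hq', q0'.trans q0, q1',
        fun t ht => ?_, hk'.le, fun h1 => absurd h1 hk'.ne, fun h1 => absurd h1 he⟩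
      have := dist_triangle (q' t) (q t) (f (A.pt e t))
      linarith [hqn t ht, hqn' t ht]
  choose κ' q hq q0 q1 hnear hle heq hlt using edge
  obtain ⟨g, hg, hgv, hge⟩ := exists_map_of_edges a q q0 q1 hq
  have hfg : f.Homotopic g := H _ _ _ <| forall_dist_lt
    (fun u => by rw [hgv, dist_comm]; exact (ha u).trans_lt (by linarith))
    fun e t ht => by rw [hge e t ht, dist_comm]; exact hnear e t ht
  refine ⟨κ', ⟨g, hP _ _ hfg hf, hg⟩, hle, heq, hlt h.1 hh ?_⟩
  rcases h with ⟨e, _ | _⟩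
  · exact Or.inl rfl
  · exact Or.inr rfl

/-- In every homotopy class that is not constant there is an optimal map. -/
theorem exists_optimal {P : C(A.Space, B.Space) → Prop} [Nonempty A.E]
    (hP : ∀ f g : C(A.Space, B.Space), f.Homotopic g → P f → P g) (hne : ∃ f, P f)
    (hconst : ∀ f : C(A.Space, B.Space), P f → ¬ EdgeLip f 0) :
    ∃ (f : C(A.Space, B.Space)) (κ : A.E → ℝ≥0) (S : ℝ≥0), P f ∧ EdgeLip f κ ∧
      EdgeGeodesic f κ ∧ 0 < S ∧ (∀ e, κ e ≤ S) ∧ (∃ e, κ e = S) ∧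
      ∀ h : A.E × Bool, κ h.1 = S → ∃ h' : A.E × Bool, κ h'.1 = S ∧ base h' = base h ∧
        Legal f S h h' := by
  classical
  have hcl := isClosed_lipConstants hP
  have hM : Continuous fun κ : A.E → ℝ≥0 => Finset.univ.sup κ :=
    Continuous.finset_sup_apply fun e _ => continuous_apply e
  obtain ⟨S, ⟨κ₁, hκ₁, hκ₁S⟩, hSmin⟩ : ∃ S : ℝ≥0, (∃ κ ∈ lipConstants P, ∀ e, κ e ≤ S) ∧
      ∀ κ ∈ lipConstants P, S ≤ Finset.univ.sup κ := by
    obtain ⟨f₀, hf₀⟩ := hne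
    obtain ⟨f₁, κ₀, hh, hκ₀⟩ := exists_homotopic_edgeLip f₀
    have hκ₀' : κ₀ ∈ lipConstants P := ⟨f₁, hP _ _ hh hf₀, hκ₀⟩
    set M := Finset.univ.sup κ₀ with hMdef
    have hcomp : IsCompact (lipConstants P ∩ Icc 0 (fun _ => M)) := by
      rw [inter_comm]; exact isCompact_Icc.inter_right hcl
    obtain ⟨κ₁, h1, h2⟩ := hcomp.exists_isMinOn ⟨κ₀, hκ₀', fun e => zero_le, fun e =>
      Finset.le_sup (f := κ₀) (Finset.mem_univ e)⟩ hM.continuousOn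
    refine ⟨Finset.univ.sup κ₁, ⟨κ₁, h1.1, fun e => Finset.le_sup (Finset.mem_univ e)⟩,
      fun κ hκ => ?_⟩
    rcases le_total (Finset.univ.sup κ) M with h | h
    · exact h2 ⟨hκ, fun e => zero_le, fun e => (Finset.le_sup (Finset.mem_univ e)).trans h⟩
    · exact (Finset.sup_le fun e _ => h1.2.2 e).trans h
  let count : (A.E → ℝ≥0) → ℕ := fun κ => (Finset.univ.filter fun e => κ e = S).card
  obtain ⟨κ₂, ⟨hκ₂, hκ₂S⟩, hcount⟩ : ∃ κ, (κ ∈ lipConstants P ∧ ∀ e, κ e ≤ S) ∧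
      ∀ κ', κ' ∈ lipConstants P → (∀ e, κ' e ≤ S) → count κ ≤ count κ' := by
    have hex : ∃ n, ∃ κ, (κ ∈ lipConstants P ∧ ∀ e, κ e ≤ S) ∧ count κ = n :=
      ⟨_, κ₁, ⟨hκ₁, hκ₁S⟩, rfl⟩
    obtain ⟨κ, h1, h2⟩ := Nat.find_spec hex
    exact ⟨κ, h1, fun κ' h3 h4 => h2 ▸ Nat.find_min' hex ⟨κ', ⟨h3, h4⟩, rfl⟩⟩
  obtain ⟨κ, ⟨hκ, -, hκκ₂⟩, hmin⟩ : ∃ κ ∈ lipConstants P ∩ Icc 0 κ₂,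
      IsMinOn (fun κ : A.E → ℝ≥0 => ∑ e, κ e) (lipConstants P ∩ Icc 0 κ₂) κ := by
    have hcomp : IsCompact (lipConstants P ∩ Icc 0 κ₂) := by
      rw [inter_comm]; exact isCompact_Icc.inter_right hcl
    exact hcomp.exists_isMinOn ⟨κ₂, hκ₂, fun e => zero_le, le_rfl⟩
      (Continuous.continuousOn (by fun_prop))
  have hκS : ∀ e, κ e ≤ S := fun e => (hκκ₂ e).trans (hκ₂S e)
  obtain ⟨f, hf, hlip⟩ := id hκ
  have hS : 0 < S := by
    refine pos_iff_ne_zero.2 fun h0 => hconst f hf ?_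
    have : κ = 0 := funext fun e => le_antisymm ((hκS e).trans h0.le) (zero_le)
    rwa [← this]
  have hcκ : count κ ≤ count κ₂ := Finset.card_le_card fun e he => by
    simp only [Finset.mem_filter, Finset.mem_univ, true_and] at he ⊢
    exact le_antisymm (hκ₂S e) (he ▸ hκκ₂ e)
  have hgeo : EdgeGeodesic f κ := by
    refine edgeGeodesic_of_minimal hP hf hlip fun κ' h1 h2 => ?_
    have h3 : ∑ e, κ e ≤ ∑ e, κ' e := hmin ⟨h1, fun e => zero_le, h2.trans hκκ₂⟩
    have h4 := (Finset.sum_eq_sum_iff_of_le fun e _ => h2 e).1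
      (le_antisymm (Finset.sum_le_sum fun e _ => h2 e) h3)
    exact funext fun e => h4 e (Finset.mem_univ e)
  refine ⟨f, κ, S, hf, hlip, hgeo, hS, hκS, ?_, fun h hh => ?_⟩
  · by_contra hno
    push Not at hno
    refine absurd (hSmin κ hκ) (not_le.2 ((Finset.sup_lt_iff (by simpa using hS)).2 fun e _ =>
      lt_of_le_of_ne (hκS e) (hno e)))
  · by_contra hno
    push Not at hno
    have hgerm : ∀ h', κ h'.1 = S → base h' = base h →
        ∃ ε > 0, ∀ s ∈ Ico 0 ε, f (arm h' s) = f (arm h s) := by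
      intro h' h1 h2
      have g1 := hgeo.isGerm h
      have g2 := hgeo.isGerm h'
      rw [hh] at g1
      rw [h1] at g2
      rcases germ_dichotomy B.locallyStar (by exact_mod_cast hS) g1 g2
        (by simp only [arm_zero, h2]) with ⟨ε, hε, h3⟩ | h3
      · exact ⟨ε, hε, fun s hs => (h3 s hs).symm⟩
      · exact absurd h3 (hno h' h1 h2)
    obtain ⟨κ', h1, h2, h3, h4⟩ := exists_slower hP hf hlip hS hκS hh hgerm
    have : count κ' < count κ := by
      refine Finset.card_lt_card ⟨fun e he => ?_, fun hsub => ?_⟩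
      · simp only [Finset.mem_filter, Finset.mem_univ, true_and] at he ⊢
        exact h3 e he
      · have := hsub (show h.1 ∈ _ by simpa using hh)
        simp only [Finset.mem_filter, Finset.mem_univ, true_and] at this
        exact h4.ne this
    have h5 := hcount κ' h1 h2
    omega

end MetricGraph

theorem Function.exists_iterate_eq_of_finite {α : Type*} [Finite α] [Nonempty α] (f : α → α) :
    ∃ (x : α) (k : ℕ), 0 < k ∧ f^[k] x = x := by
  obtain ⟨x₀⟩ := ‹Nonempty α›
  obtain ⟨m, n, hmn, h⟩ := Finite.exists_ne_map_eq_of_infinite fun n : ℕ => f^[n] x₀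
  wlog hlt : m < n generalizing m n
  · exact this n m hmn.symm h.symm (lt_of_le_of_ne (not_lt.1 hlt) hmn.symm)
  refine ⟨f^[m] x₀, n - m, Nat.sub_pos_of_lt hlt, ?_⟩
  rw [← Function.iterate_add_apply, Nat.sub_add_cancel hlt.le]
  exact h.symm

namespace MetricGraph

variable {A : MetricGraph} {X : Type*} [MetricSpace X]

/-- The time at which the edge path `H` reaches the start of its `i`-th edge. -/
def startTime (H : ℕ → A.E × Bool) (i : ℕ) : ℝ := ∑ j ∈ Finset.range i, A.len (H j).1

theorem startTime_succ (H : ℕ → A.E × Bool) (i : ℕ) :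
    startTime H (i + 1) = startTime H i + A.len (H i).1 := Finset.sum_range_succ _ _

theorem startTime_mono (H : ℕ → A.E × Bool) : Monotone (startTime H) :=
  monotone_nat_of_le_succ fun i => by
    rw [startTime_succ]; linarith [A.len_pos (H i).1]

theorem le_startTime (H : ℕ → A.E × Bool) (i : ℕ) : i * A.rad ≤ startTime H i := by
  induction i with
  | zero => simp [startTime]
  | succ i ih =>
    rw [startTime_succ]
    push_cast
    linarith [four_rad_le (H i).1, A.rad_pos]

theorem exists_lt_startTime (H : ℕ → A.E × Bool) (t : ℝ) : ∃ i, t < startTime H (i + 1) := by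
  obtain ⟨i, hi⟩ := exists_nat_gt (t / A.rad)
  rw [div_lt_iff₀ A.rad_pos] at hi
  exact ⟨i, hi.trans_le ((le_startTime H i).trans (startTime_mono H i.le_succ))⟩

open Classical in
/-- The edge path `H`, parametrised by arc length. -/
def edgePath (H : ℕ → A.E × Bool) (t : ℝ) : A.Space :=
  arm (H (Nat.find (exists_lt_startTime H t))) (t - startTime H (Nat.find (exists_lt_startTime H t)))

theorem edgePath_of_mem_Ico {H : ℕ → A.E × Bool} {i : ℕ} {t : ℝ}
    (ht : t ∈ Ico (startTime H i) (startTime H (i + 1))) :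
    edgePath H t = arm (H i) (t - startTime H i) := by
  classical
  have : Nat.find (exists_lt_startTime H t) = i := by
    rw [Nat.find_eq_iff]
    refine ⟨ht.2, fun j hj => not_lt.2 ?_⟩
    exact (startTime_mono H hj).trans ht.1
  unfold edgePath
  have h2 : ∀ j, Nat.find (exists_lt_startTime H t) = j →
    arm (H (Nat.find (exists_lt_startTime H t)))
      (t - startTime H (Nat.find (exists_lt_startTime H t))) = arm (H j) (t - startTime H j) := by
    rintro j rfl; rfl
  convert h2 i this

theorem edgePath_of_mem_Icc {H : ℕ → A.E × Bool} (hH : ∀ i, base (H (i + 1)) = base (opp (H i)))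
    {i : ℕ} {t : ℝ} (ht : t ∈ Icc (startTime H i) (startTime H (i + 1))) :
    edgePath H t = arm (H i) (t - startTime H i) := by
  rcases ht.2.eq_or_lt with rfl | h
  · rw [edgePath_of_mem_Ico (i := i + 1) ⟨le_rfl, by
      rw [startTime_succ _ (i + 1)]; linarith [A.len_pos (H (i + 1)).1]⟩, sub_self, arm_zero, hH,
      ← arm_zero, arm_opp, sub_zero, startTime_succ, add_sub_cancel_left]
  · exact edgePath_of_mem_Ico ⟨ht.1, h⟩

theorem exists_mem_Ico_startTime (H : ℕ → A.E × Bool) {t : ℝ} (ht : 0 ≤ t) :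
    ∃ i, t ∈ Ico (startTime H i) (startTime H (i + 1)) := by
  classical
  refine ⟨Nat.find (exists_lt_startTime H t), ?_, Nat.find_spec (exists_lt_startTime H t)⟩
  by_contra hcon
  push Not at hcon
  rcases hi : Nat.find (exists_lt_startTime H t) with _ | j
  · rw [hi] at hcon
    simp [startTime] at hcon
    linarith
  · rw [hi] at hcon
    exact Nat.find_min (exists_lt_startTime H t) (hi ▸ j.lt_succ_self) hcon

theorem lipPath_edgePath {H : ℕ → A.E × Bool} (hH : ∀ i, base (H (i + 1)) = base (opp (H i)))
    (i : ℕ) : LipPath 1 (startTime H i) (edgePath H) := by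
  induction i with
  | zero =>
    intro s hs t ht
    have h0 : startTime H 0 = 0 := Finset.sum_range_zero _
    rw [h0] at hs ht
    rw [le_antisymm hs.2 hs.1, le_antisymm ht.2 ht.1]
    simp
  | succ i ih =>
    have h0 : 0 ≤ startTime H i := by
      have := le_startTime H i
      have := A.rad_pos
      have : 0 ≤ (i : ℝ) * A.rad := by positivity
      linarith
    rw [startTime_succ]
    refine LipPath.of_split h0 (A.len_pos _).le ih fun s hs t ht => ?_
    have key : ∀ s ∈ Icc 0 (A.len (H i).1), edgePath H (startTime H i + s) = arm (H i) s := by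
      intro s hs
      rw [edgePath_of_mem_Icc hH (i := i) ⟨by linarith [hs.1], by
        rw [startTime_succ]; linarith [hs.2]⟩, add_sub_cancel_left]
    dsimp only
    rw [key s hs, key t ht, one_mul]
    exact dist_arm_le _ hs ht

/-- `f` is a local geodesic of speed `S` on the half-edge `h`. -/
def ArmGeodesic (f : A.Space → X) (S : ℝ) (h : A.E × Bool) : Prop :=
  ∀ t ∈ Icc 0 (A.len h.1), ∃ ε > 0, ∀ x ∈ Icc 0 (A.len h.1), ∀ y ∈ Icc 0 (A.len h.1),
    |x - t| < ε → |y - t| < ε → dist (f (arm h x)) (f (arm h y)) = S * |x - y|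

theorem local_geodesic_edgePath {H : ℕ → A.E × Bool}
    (hH : ∀ i, base (H (i + 1)) = base (opp (H i))) {f : A.Space → X} {S : ℝ}
    (hgeo : ∀ i, ArmGeodesic f S (H i))
    (hleg : ∀ i, ∃ ε > 0, ∀ s ∈ Ico 0 ε, ∀ t ∈ Ico 0 ε,
      dist (f (arm (opp (H i)) s)) (f (arm (H (i + 1)) t)) = S * (s + t)) {t : ℝ} (ht : 0 < t) :
    ∃ ε > 0, ∀ x y, |x - t| < ε → |y - t| < ε →
      dist (f (edgePath H x)) (f (edgePath H y)) = S * |x - y| := by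
  obtain ⟨i, hi⟩ := exists_mem_Ico_startTime H ht.le
  have hlen := A.len_pos (H i).1
  have hsucc := startTime_succ H i
  obtain ⟨ε, hε, hg⟩ := hgeo i (t - startTime H i)
    ⟨by linarith [hi.1], by linarith [hi.2]⟩
  have right : ∀ x y, x ∈ Icc (startTime H i) (startTime H (i + 1)) →
      y ∈ Icc (startTime H i) (startTime H (i + 1)) → |x - t| < ε → |y - t| < ε →
      dist (f (edgePath H x)) (f (edgePath H y)) = S * |x - y| := by
    intro x y hx hy hxt hyt
    rw [edgePath_of_mem_Icc hH hx, edgePath_of_mem_Icc hH hy]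
    have := hg (x - startTime H i) ⟨by linarith [hx.1], by linarith [hx.2]⟩ (y - startTime H i)
      ⟨by linarith [hy.1], by linarith [hy.2]⟩ (by rwa [sub_sub_sub_cancel_right])
      (by rwa [sub_sub_sub_cancel_right])
    rwa [sub_sub_sub_cancel_right] at this
  rcases hi.1.eq_or_lt with heq | hlt
  · obtain ⟨j, rfl⟩ : ∃ j, i = j + 1 := by
      rcases i with _ | j
      · simp [startTime] at heq; linarith
      · exact ⟨j, rfl⟩
    have hsucc' := startTime_succ H j
    have hlen' := A.len_pos (H j).1
    obtain ⟨ε₁, hε₁, hg₁⟩ := hgeo j (A.len (H j).1) ⟨hlen'.le, le_rfl⟩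
    obtain ⟨ε₂, hε₂, hg₂⟩ := hleg j
    set η := min (min ε ε₁) (min ε₂ (min (A.len (H j).1) (A.len (H (j + 1)).1))) with hη
    have η0 : 0 < η := lt_min (lt_min hε hε₁) (lt_min hε₂ (lt_min hlen' hlen))
    have η1 : η ≤ ε := (min_le_left _ _).trans (min_le_left _ _)
    have η2 : η ≤ ε₁ := (min_le_left _ _).trans (min_le_right _ _)
    have η3 : η ≤ ε₂ := (min_le_right _ _).trans (min_le_left _ _)
    have η4 : η ≤ A.len (H j).1 :=
      (min_le_right _ _).trans ((min_le_right _ _).trans (min_le_left _ _))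
    have η5 : η ≤ A.len (H (j + 1)).1 :=
      (min_le_right _ _).trans ((min_le_right _ _).trans (min_le_right _ _))
    have before : ∀ x, x ≤ t → |x - t| < η → edgePath H x = arm (H j) (x - startTime H j) :=
      fun x hx hxt => edgePath_of_mem_Icc hH ⟨by linarith [(abs_lt.1 hxt).1], by linarith⟩
    have mixed : ∀ x y, x ≤ t → t ≤ y → |x - t| < η → |y - t| < η →
        dist (f (edgePath H x)) (f (edgePath H y)) = S * |x - y| := by
      intro x y hx hy hxt hyt
      have hxt' := abs_lt.1 hxt
      have hyt' := abs_lt.1 hyt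
      rw [before x hx hxt, edgePath_of_mem_Icc hH (i := j + 1) ⟨by linarith, by linarith⟩]
      have := hg₂ (t - x) ⟨by linarith, by linarith⟩ (y - t) ⟨by linarith, by linarith⟩
      rw [arm_opp] at this
      have e1 : A.len (H j).1 - (t - x) = x - startTime H j := by linarith
      rw [e1, ← heq] at this
      rw [this, heq, abs_of_nonpos (by linarith)]
      congr 1; ring
    refine ⟨η, η0, fun x y hxt hyt => ?_⟩
    have hxt' := abs_lt.1 hxt
    have hyt' := abs_lt.1 hyt
    rcases le_total x t with hx | hx <;> rcases le_total y t with hy | hy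
    · rw [before x hx hxt, before y hy hyt]
      have := hg₁ (x - startTime H j) ⟨by linarith, by linarith⟩ (y - startTime H j)
        ⟨by linarith, by linarith⟩
        (by have : x - startTime H j - A.len (H j).1 = x - t := by linarith
            rw [this]; linarith)
        (by have : y - startTime H j - A.len (H j).1 = y - t := by linarith
            rw [this]; linarith)
      rwa [sub_sub_sub_cancel_right] at this
    · exact mixed x y hx hy hxt hyt
    · rw [dist_comm, abs_sub_comm]; exact mixed y x hy hx hyt hxt
    · exact right x y ⟨by linarith, by linarith⟩ ⟨by linarith, by linarith⟩ (hxt.trans_le η1)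
        (hyt.trans_le η1)
  · refine ⟨min ε (min (t - startTime H i) (startTime H (i + 1) - t)),
      lt_min hε (lt_min (by linarith) (by linarith [hi.2])), fun x y hx hy => ?_⟩
    have mem : ∀ x, |x - t| < min ε (min (t - startTime H i) (startTime H (i + 1) - t)) →
        x ∈ Icc (startTime H i) (startTime H (i + 1)) := fun x hx => by
      have h1 := abs_lt.1 (hx.trans_le ((min_le_right _ _).trans (min_le_left _ _)))
      have h2 := abs_lt.1 (hx.trans_le ((min_le_right _ _).trans (min_le_right _ _)))
      constructor <;> linarith
    exact right x y (mem x hx) (mem y hy) (hx.trans_le (min_le_left _ _))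
      (hy.trans_le (min_le_left _ _))

/-- If every half-edge in a set of edges on which `f` is a geodesic has a partner with which it
forms a legal turn, then there is a loop in these edges that `f` maps to a closed geodesic. -/
theorem exists_legal_loop {M : A.E → Prop} (hM : ∃ e, M e) {f : A.Space → X}
    {S : ℝ}
    (hgeo : ∀ h : A.E × Bool, M h.1 → ArmGeodesic f S h)
    (hleg : ∀ h : A.E × Bool, M h.1 → ∃ h' : A.E × Bool, M h'.1 ∧ base h' = base h ∧
      ∃ ε > 0, ∀ s ∈ Ico 0 ε, ∀ t ∈ Ico 0 ε, dist (f (arm h s)) (f (arm h' t)) = S * (s + t)) :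
    ∃ (ℓ : ℝ) (p : ℝ → A.Space), 0 < ℓ ∧ Continuous p ∧ (∀ t, p (t + 1) = p t) ∧
      LipPath ℓ 1 p ∧ LocalGeodesic (S * ℓ) (fun t => f (p t)) ∧
      ∀ t, ∃ e, M e ∧ p t ∈ A.closedEdge e := by
  choose! nx hnM hnb hnl using hleg
  let nxt : {h : A.E × Bool // M h.1} → {h : A.E × Bool // M h.1} :=
    fun h => ⟨nx (opp h.1), hnM _ h.2⟩
  have : Nonempty {h : A.E × Bool // M h.1} := hM.elim fun e he => ⟨⟨(e, true), he⟩⟩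
  obtain ⟨h₀, k, hk, hper⟩ := Function.exists_iterate_eq_of_finite nxt
  let H : ℕ → A.E × Bool := fun i => (nxt^[i] h₀).1
  have hHM : ∀ i, M (H i).1 := fun i => (nxt^[i] h₀).2
  have hHs : ∀ i, H (i + 1) = nx (opp (H i)) := fun i => by
    simp only [H, Function.iterate_succ_apply']; rfl
  have hH : ∀ i, base (H (i + 1)) = base (opp (H i)) := fun i => by
    rw [hHs]; exact hnb _ (hHM i)
  have hHk : ∀ i, H (i + k) = H i := fun i => by
    simp only [H, Function.iterate_add_apply, hper]
  set ℓ := startTime H k with hℓ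
  have hℓ0 : 0 < ℓ := lt_of_lt_of_le (mul_pos (Nat.cast_pos.2 hk) A.rad_pos) (le_startTime H k)
  have hT : ∀ i, startTime H (i + k) = startTime H i + ℓ := by
    intro i
    induction i with
    | zero => simp [startTime, hℓ]
    | succ i ih =>
      rw [Nat.add_right_comm, startTime_succ, ih, startTime_succ, hHk]; ring
  have hp1 : ∀ t, 0 ≤ t → edgePath H (t + ℓ) = edgePath H t := by
    intro t ht
    obtain ⟨i, hi⟩ := exists_mem_Ico_startTime H ht
    rw [edgePath_of_mem_Ico hi, edgePath_of_mem_Ico (i := i + k)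
      ⟨by rw [hT]; linarith [hi.1], by rw [Nat.add_right_comm, hT]; linarith [hi.2]⟩, hT, hHk,
      add_sub_add_right_eq_sub]
  have hpm : ∀ (m : ℕ) (t : ℝ), 0 ≤ t → edgePath H (t + m * ℓ) = edgePath H t := by
    intro m
    induction m with
    | zero => simp
    | succ m ih =>
      intro t ht
      rw [Nat.cast_succ, add_mul, one_mul, ← add_assoc, hp1 _ (by positivity), ih t ht]
  let p : ℝ → A.Space := fun t => edgePath H (Int.fract t * ℓ)
  have hpper : ∀ t, p (t + 1) = p t := fun t => by simp only [p, Int.fract_add_one]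
  have hpnat : ∀ (m : ℕ) (t : ℝ), p (t + m) = p t := fun m t => by
    simp only [p, Int.fract_add_natCast]
  have hpos : ∀ t, 0 ≤ t → p t = edgePath H (t * ℓ) := by
    intro t ht
    have h1 : (⌊t⌋.toNat : ℝ) = ⌊t⌋ := by
      exact_mod_cast Int.toNat_of_nonneg (Int.floor_nonneg.2 ht)
    have h2 : t * ℓ = Int.fract t * ℓ + (⌊t⌋.toNat : ℝ) * ℓ := by
      rw [h1, ← add_mul, Int.fract_add_floor]
    rw [h2, hpm _ _ (mul_nonneg (Int.fract_nonneg t) hℓ0.le)]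
  have shift : ∀ t : ℝ, ∃ m : ℕ, ∀ x, |x - t| < 1 → 0 < t + m ∧
      p x = edgePath H ((x + m) * ℓ) := by
    intro t
    obtain ⟨m, hm⟩ := exists_nat_gt (1 - t)
    refine ⟨m, fun x hx => ⟨by linarith, ?_⟩⟩
    rw [← hpnat m x, hpos _ (by linarith [(abs_lt.1 hx).1])]
  refine ⟨ℓ, p, hℓ0, ?_, hpper, ?_, ?_, ?_⟩
  · rw [continuous_iff_continuousAt]
    intro t
    obtain ⟨m, hm⟩ := shift t
    obtain ⟨i, hi⟩ := exists_lt_startTime H ((t + m + 1) * ℓ)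
    have hlip := lipPath_edgePath hH (i + 1)
    have hc : ContinuousOn (edgePath H) (Icc 0 (startTime H (i + 1))) :=
      (LipschitzOnWith.of_dist_le_mul (K := 1) fun s hs t ht => by
        simpa [Real.dist_eq] using hlip s hs t ht).continuousOn
    have ht0 : 0 < (t + m) * ℓ := mul_pos (hm t (by simp)).1 hℓ0
    have hc' : ContinuousAt (edgePath H) ((t + m) * ℓ) :=
      hc.continuousAt (Icc_mem_nhds ht0 (by nlinarith))
    have : (fun x => edgePath H ((x + m) * ℓ)) =ᶠ[𝓝 t] p := by
      filter_upwards [Metric.ball_mem_nhds t one_pos] with x hx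
      rw [Metric.mem_ball, Real.dist_eq] at hx
      exact (hm x hx).2.symm
    refine ContinuousAt.congr ?_ this
    exact ContinuousAt.comp (f := fun x : ℝ => (x + m) * ℓ) hc' (by fun_prop)
  · have := (lipPath_edgePath hH k).rescale (c := ℓ) (l' := 1) hℓ0.le (by rw [mul_one])
    rw [one_mul] at this
    exact this.congr fun t ht => by rw [hpos t ht.1, mul_comm]
  · intro t
    obtain ⟨m, hm⟩ := shift t
    have ht0 : 0 < (t + m) * ℓ := mul_pos (hm t (by simp)).1 hℓ0
    obtain ⟨ε, hε, hg⟩ := local_geodesic_edgePath hH (fun i => hgeo _ (hHM i))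
      (fun i => by rw [hHs]; exact hnl _ (hHM i)) ht0
    refine ⟨min 1 (ε / ℓ), lt_min one_pos (by positivity), fun x y hx hy => ?_⟩
    have hsc : ∀ x y : ℝ, |(x + m) * ℓ - (y + m) * ℓ| = ℓ * |x - y| := fun x y => by
      rw [← sub_mul, abs_mul, abs_of_pos hℓ0, add_sub_add_right_eq_sub, mul_comm]
    have hlt : ∀ x, |x - t| < min 1 (ε / ℓ) → |(x + m) * ℓ - (t + m) * ℓ| < ε := fun x hx => by
      rw [hsc, mul_comm, ← lt_div_iff₀ hℓ0]; exact hx.trans_le (min_le_right _ _)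
    dsimp only
    rw [(hm x (hx.trans_le (min_le_left _ _))).2, (hm y (hy.trans_le (min_le_left _ _))).2,
      hg _ _ (hlt x hx) (hlt y hy), hsc, mul_assoc]
  · intro t
    obtain ⟨i, hi⟩ := exists_mem_Ico_startTime H (mul_nonneg (Int.fract_nonneg t) hℓ0.le)
    refine ⟨(H i).1, hHM i, ?_⟩
    simp only [p]
    rw [edgePath_of_mem_Ico hi]
    exact ⟨_, arm_mem ⟨by linarith [hi.1], by linarith [hi.2, startTime_succ H i]⟩, rfl⟩

theorem EdgeGeodesic.armGeodesic {B : MetricGraph} {f : A.Space → B.Space} {κ : A.E → ℝ≥0}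
    (hf : EdgeGeodesic f κ) (h : A.E × Bool) : ArmGeodesic f (κ h.1) h := by
  intro t ht
  obtain ⟨ε, hε, H⟩ := hf h.1 _ (arm_mem ht)
  refine ⟨ε, hε, fun x hx y hy hxt hyt => ?_⟩
  have := H _ (arm_mem hx) _ (arm_mem hy) (by rwa [arm_sub]) (by rwa [arm_sub])
  rwa [arm_sub] at this

end MetricGraph

section FreeHomotopy

variable {X Y : Type*} [TopologicalSpace X] [TopologicalSpace Y] {x y z : X}

theorem FreelyHomotopic.symm {p : Path x x} {q : Path y y} (h : FreelyHomotopic p q) :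
    FreelyHomotopic q p :=
  ContinuousMap.HomotopicWith.symm h

theorem FreelyHomotopic.trans {p : Path x x} {q : Path y y} {r : Path z z}
    (h : FreelyHomotopic p q) (h' : FreelyHomotopic q r) : FreelyHomotopic p r :=
  ContinuousMap.HomotopicWith.trans h h'

theorem FreelyHomotopic.map {p : Path x x} {q : Path y y} (h : FreelyHomotopic p q) (f : C(X, Y)) :
    FreelyHomotopic (p.map f.continuous) (q.map f.continuous) := by
  obtain ⟨H⟩ := h
  refine ⟨⟨⟨f.comp H.toHomotopy.toContinuousMap, fun t => ?_, fun t => ?_⟩, fun t => ?_⟩⟩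
  · exact congrArg f (H.apply_zero t)
  · exact congrArg f (H.apply_one t)
  · exact congrArg f (H.prop' t)

theorem freelyHomotopic_map (p : Path x x) {f g : C(X, Y)} (h : f.Homotopic g) :
    FreelyHomotopic (p.map f.continuous) (p.map g.continuous) := by
  obtain ⟨H⟩ := h
  refine ⟨⟨⟨H.toContinuousMap.comp ((ContinuousMap.id I).prodMap p.toContinuousMap),
    fun t => ?_, fun t => ?_⟩, fun t => ?_⟩⟩
  · exact H.apply_zero (p t)
  · exact H.apply_one (p t)
  · change H (t, p 0) = H (t, p 1)
    rw [p.source, p.target]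

theorem freelyHomotopic_of_homotopic {p q : Path x x} (h : p.Homotopic q) :
    FreelyHomotopic p q := by
  obtain ⟨H⟩ := h
  refine ⟨⟨⟨H.toContinuousMap, fun t => H.apply_zero t, fun t => H.apply_one t⟩, fun t => ?_⟩⟩
  exact (Path.Homotopy.source H t).trans (Path.Homotopy.target H t).symm

theorem freelyHomotopic_conj (δ : Path y x) (c : Path x x) :
    FreelyHomotopic (δ.trans (c.trans δ.symm)) c := by
  set P := δ.trans (c.trans δ.symm)
  have hP : ∀ s : ℝ, 0 ≤ s → s ≤ 1 → P.extend (s / 2) = δ.extend s := by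
    intro s h0 h1
    rw [Path.extend_apply _ ⟨by linarith, by linarith⟩, Path.extend_apply _ ⟨h0, h1⟩,
      Path.trans_apply, dif_pos (by dsimp only; linarith)]
    congr 2
    ring
  have hP' : ∀ s : ℝ, 0 ≤ s → s ≤ 1 → P.extend (1 / 2 + s / 4) = c.extend s := by
    intro s h0 h1
    rcases h0.eq_or_lt with rfl | h0'
    · have := hP 1 zero_le_one le_rfl
      rw [zero_div, add_zero, this]
      simp
    rw [Path.extend_apply _ ⟨by linarith, by linarith⟩, Path.extend_apply _ ⟨h0, h1⟩,
      Path.trans_apply, dif_neg (by dsimp only; linarith), Path.trans_apply,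
      dif_pos (by dsimp only; linarith)]
    congr 2
    dsimp only
    ring
  have hP'' : ∀ s : ℝ, 0 ≤ s → s ≤ 1 → P.extend (1 - s / 4) = δ.extend s := by
    intro s h0 h1
    rcases h1.eq_or_lt with rfl | h1'
    · have := hP' 1 zero_le_one le_rfl
      rw [show (1 : ℝ) - 1 / 4 = 1 / 2 + 1 / 4 by norm_num, this]
      simp
    rw [Path.extend_apply _ ⟨by linarith, by linarith⟩, Path.extend_apply _ ⟨h0, h1⟩,
      Path.trans_apply, dif_neg (by dsimp only; linarith), Path.trans_apply,
      dif_neg (by dsimp only; linarith), Path.symm_apply]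
    refine congrArg δ (Subtype.ext ?_)
    simp only [unitInterval.coe_symm_eq]
    ring
  let F : I × I → X := fun z => P.extend ((z.1 : ℝ) / 2 + z.2 * (1 - 3 * z.1 / 4))
  refine ⟨⟨⟨⟨F, P.continuous_extend.comp (by fun_prop)⟩, fun t => ?_, fun t => ?_⟩, fun t => ?_⟩⟩
  · simp only [F]
    change P.extend (((0 : I) : ℝ) / 2 + t * (1 - 3 * ((0 : I) : ℝ) / 4)) = P t
    rw [← Path.extend_apply P t.2]
    congr 1
    simp
  · change P.extend (((1 : I) : ℝ) / 2 + t * (1 - 3 * ((1 : I) : ℝ) / 4)) = c t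
    have := hP' t t.2.1 t.2.2
    rw [Path.extend_apply c t.2] at this
    rw [← Subtype.coe_eta t t.2, ← this]
    congr 1
    simp only [Icc.coe_one]
    ring
  · change P.extend ((t : ℝ) / 2 + ((0 : I) : ℝ) * (1 - 3 * t / 4)) =
      P.extend ((t : ℝ) / 2 + ((1 : I) : ℝ) * (1 - 3 * t / 4))
    have h1 := hP t t.2.1 t.2.2
    have h2 := hP'' t t.2.1 t.2.2
    rw [show (t : ℝ) / 2 + ((0 : I) : ℝ) * (1 - 3 * t / 4) = t / 2 by simp,
      show (t : ℝ) / 2 + ((1 : I) : ℝ) * (1 - 3 * t / 4) = 1 - t / 4 by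
        simp only [Icc.coe_one]; ring, h1, h2]

end FreeHomotopy

section Length

variable {X Y : Type*} [MetricSpace X] [MetricSpace Y]

theorem pathLength_of_const {x : X} {p : Path x x} (h : ∀ t, p t = x) : pathLength p = 0 :=
  eVariationOn.constant_on (by
    rintro _ ⟨s, -, rfl⟩ _ ⟨t, -, rfl⟩
    rw [h, h])

theorem pathLength_map_le {K : ℝ≥0} {f : C(X, Y)} (hf : LipschitzWith K f) {x y : X}
    (p : Path x y) : pathLength (p.map f.continuous) ≤ K * pathLength p :=
  (hf.lipschitzOnWith (s := univ)).comp_eVariationOn_le (mapsTo_univ _ _)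

theorem LipPath.pathLength_le {ℓ : ℝ} {q : ℝ → X} (h : LipPath ℓ 1 q) (hℓ : 0 ≤ ℓ) {x y : X}
    {c : Path x y} (hc : ∀ t : I, c t = q t) : pathLength c ≤ ENNReal.ofReal ℓ := by
  have h1 : LipschitzOnWith ℓ.toNNReal q I := LipschitzOnWith.of_dist_le_mul fun s hs t ht => by
    rw [Real.coe_toNNReal _ hℓ, Real.dist_eq]; exact h s hs t ht
  have h2 : eVariationOn ((↑) : I → ℝ) univ ≤ 1 := by
    have : MonotoneOn ((↑) : I → ℝ) univ := fun a _ b _ hab => hab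
    have := this.eVariationOn_eq (a := (0 : I)) (b := 1) (mem_univ _) (mem_univ _)
    rw [univ_inter, show Icc (0 : I) 1 = univ from eq_univ_of_forall fun t => ⟨t.2.1, t.2.2⟩]
      at this
    simp [this]
  have h3 : (c : I → X) = q ∘ ((↑) : I → ℝ) := funext hc
  rw [pathLength, h3]
  refine (h1.comp_eVariationOn_le (fun t _ => t.2)).trans ?_
  exact mul_le_of_le_one_right' h2

end Length

namespace MetricGraph

variable {G : MetricGraph}

theorem exists_base_eq {v : G.V} (hv : 2 ≤ G.valence v) :
    ∃ h h' : G.E × Bool, h ≠ h' ∧ base h = v ∧ base h' = v := by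
  have : Nontrivial ({e : G.E // G.src e = v} ⊕ {e : G.E // G.tgt e = v}) := by
    rw [← Finite.one_lt_card_iff_nontrivial, Nat.card_sum]
    exact hv
  obtain ⟨a, b, hab⟩ := exists_pair_ne ({e : G.E // G.src e = v} ⊕ {e : G.E // G.tgt e = v})
  let φ : {e : G.E // G.src e = v} ⊕ {e : G.E // G.tgt e = v} → G.E × Bool :=
    Sum.elim (fun e => (e.1, false)) fun e => (e.1, true)
  have hφ : Function.Injective φ := by
    rintro (⟨a, ha⟩ | ⟨a, ha⟩) (⟨b, hb⟩ | ⟨b, hb⟩) h <;> simp_all [φ]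
  have hb : ∀ a, base (φ a) = v := by
    rintro (⟨a, ha⟩ | ⟨a, ha⟩) <;> simpa [φ, base] using ha
  exact ⟨φ a, φ b, hφ.ne hab, hb a, hb b⟩

theorem exists_ne_base_eq (hG : ∀ v, 2 ≤ G.valence v) (h : G.E × Bool) :
    ∃ h', base h' = base h ∧ Legal (B := G) id 1 h h' := by
  obtain ⟨h₁, h₂, hne, hb₁, hb₂⟩ := exists_base_eq (hG (base h))
  obtain ⟨h', hb, hne'⟩ : ∃ h', base h' = base h ∧ h ≠ h' := by
    by_cases hh : h = h₁
    · exact ⟨h₂, hb₂, hh ▸ hne⟩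
    · exact ⟨h₁, hb₁, hh⟩
  refine ⟨h', hb, G.rad, G.rad_pos, fun s hs t ht => ?_⟩
  rw [one_mul]
  exact (dist_arm_arm hb.symm ⟨hs.1, hs.2.le⟩ ⟨ht.1, ht.2.le⟩).2 hne'

theorem edgeGeodesic_id : EdgeGeodesic (A := G) (B := G) id fun _ => 1 := by
  intro e t ht
  simp only [NNReal.coe_one, one_mul, id]
  rcases ht.1.eq_or_lt with rfl | h0
  · refine ⟨G.rad, G.rad_pos, fun x hx y hy hxt hyt => ?_⟩
    rw [sub_zero, abs_of_nonneg hx.1] at hxt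
    rw [sub_zero, abs_of_nonneg hy.1] at hyt
    exact (dist_arm_arm (h := (e, false)) rfl ⟨hx.1, hxt.le⟩ ⟨hy.1, hyt.le⟩).1 rfl
  rcases ht.2.eq_or_lt with rfl | h1
  · refine ⟨G.rad, G.rad_pos, fun x hx y hy hxt hyt => ?_⟩
    rw [abs_sub_comm, abs_of_nonneg (by linarith [hx.2])] at hxt
    rw [abs_sub_comm, abs_of_nonneg (by linarith [hy.2])] at hyt
    have := (dist_arm_arm (h := (e, true)) rfl ⟨by linarith [hx.2], hxt.le⟩
      ⟨by linarith [hy.2], hyt.le⟩).1 rfl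
    simpa [arm, abs_sub_comm] using this
  · set m := min t (G.len e - t)
    have hm : 0 < m := lt_min h0 (sub_pos.2 h1)
    have hm1 : m ≤ t := min_le_left _ _
    have hm2 : m ≤ G.len e - t := min_le_right _ _
    refine ⟨m / 3, by positivity, fun x hx y hy hxt hyt => ?_⟩
    rw [abs_lt] at hxt hyt
    refine dist_pt_eq ⟨by linarith, by linarith⟩ hy (abs_lt.2 ⟨?_, ?_⟩)
    · rw [neg_lt, lt_min_iff]; constructor <;> linarith
    · rw [lt_min_iff]; constructor <;> linarith

theorem nonempty_path (x y : G.Space) : Nonempty (Path x y) := by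
  obtain ⟨q, h0, h1, hq⟩ := G.geodesicMetric x y
  have hc : ContinuousOn q (Icc 0 (dist x y)) :=
    (LipschitzOnWith.of_dist_le_mul (K := 1) fun s hs t ht => by
      simpa [Real.dist_eq] using hq s hs t ht).continuousOn
  refine ⟨⟨⟨fun t => q (t * dist x y), hc.comp_continuous (by fun_prop) fun t =>
    ⟨by have := t.2.1; positivity, mul_le_of_le_one_left dist_nonneg t.2.2⟩⟩, ?_, ?_⟩⟩
  · simpa using h0
  · simpa using h1

/-- The restriction of a one-periodic map to the unit interval. -/
def loopOf {X : Type*} [TopologicalSpace X] (p : ℝ → X) (hp : Continuous p)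
    (hper : ∀ t, p (t + 1) = p t) : Path (p 0) (p 0) where
  toFun t := p t
  source' := by simp
  target' := by simpa using hper 0

theorem not_homotopic_const [Nonempty G.E] (hG : ∀ v, 2 ≤ G.valence v) {f : C(G.Space, G.Space)}
    (hf : ∀ x y, f x = f y) : ¬ (ContinuousMap.id G.Space).Homotopic f := by
  intro H
  obtain ⟨ℓ, p, hℓ, hp, hper, -, hgeo, -⟩ := exists_legal_loop (A := G) (M := fun _ => True)
    (f := (id : G.Space → G.Space)) (S := 1) ⟨Classical.arbitrary _, trivial⟩
    (fun h _ => by simpa using edgeGeodesic_id.armGeodesic h) (fun h _ => by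
      obtain ⟨h', hb, hl⟩ := exists_ne_base_eq hG h
      exact ⟨h', trivial, hb, hl⟩)
  rw [one_mul] at hgeo
  have := le_pathLength_of_freelyHomotopic hℓ hp hper hgeo (loopOf p hp hper) (fun _ => rfl) _
    (freelyHomotopic_map (loopOf p hp hper) H)
  rw [pathLength_of_const fun t => hf _ _] at this
  exact absurd hℓ (not_lt.2 (ENNReal.ofReal_eq_zero.1 (le_zero_iff.1 this)))

end MetricGraph

open MetricGraph

namespace MarkedMetricGraph

variable {n : ℕ} {A B : MarkedMetricGraph n}

instance (A : MarkedMetricGraph n) : Nonempty A.E := by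
  cases A.marking.toFun (roseBase n) with
  | vertex v =>
    obtain ⟨h, -⟩ := exists_base_eq (A.two_le_valence v)
    exact ⟨h.1⟩
  | inner e t => exact ⟨e⟩

theorem RespectsMarkings.of_homotopic {f g : C(A.Space, B.Space)} (h : f.Homotopic g)
    (hf : A.RespectsMarkings B f) : A.RespectsMarkings B g :=
  (ContinuousMap.Homotopic.comp h.symm (.refl _)).trans hf

theorem exists_respectsMarkings (A B : MarkedMetricGraph n) :
    ∃ f : C(A.Space, B.Space), A.RespectsMarkings B f := by
  refine ⟨B.marking.toFun.comp A.marking.invFun, ?_⟩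
  have := ContinuousMap.Homotopic.comp (.refl B.marking.toFun) A.marking.left_inv
  exact this

theorem RespectsMarkings.homotopic_comp_inv {f : C(A.Space, B.Space)}
    (hf : A.RespectsMarkings B f) : f.Homotopic (B.marking.toFun.comp A.marking.invFun) :=
  have h1 : (f.comp (A.marking.toFun.comp A.marking.invFun)).Homotopic f :=
    ContinuousMap.Homotopic.comp (.refl f) A.marking.right_inv
  have h2 : ((f.comp A.marking.toFun).comp A.marking.invFun).Homotopic
      (B.marking.toFun.comp A.marking.invFun) :=
    ContinuousMap.Homotopic.comp hf (.refl _)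
  h1.symm.trans h2

theorem RespectsMarkings.not_edgeLip_zero {f : C(A.Space, B.Space)}
    (hf : A.RespectsMarkings B f) : ¬ EdgeLip f 0 := by
  intro h
  have hc : ∀ x y, f x = f y := fun x y => dist_le_zero.1 <| by
    simpa using h.dist_le (K := 0) (fun _ => le_rfl) x y
  refine not_homotopic_const B.two_le_valence
    (f := (f.comp A.marking.toFun).comp B.marking.invFun) (fun x y => hc _ _) ?_
  exact B.marking.right_inv.symm.trans (ContinuousMap.Homotopic.comp hf.symm (.refl _))

theorem translationLength_one (A : MarkedMetricGraph n) : A.translationLength 1 = 0 :=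
  le_zero_iff.1 <| iInf_le_of_le (Path.refl _) <| iInf_le_of_le rfl <| iInf_le_of_le _ <|
    iInf_le_of_le _ <| iInf_le_of_le (freelyHomotopic_of_homotopic (.refl _)) <|
    (pathLength_of_const fun _ => rfl).le

theorem translationLength_le_mul {K : ℝ≥0} {g : C(A.Space, B.Space)}
    (hg : A.RespectsMarkings B g) (hK : LipschitzWith K g) (w : RoseGroup n) :
    B.translationLength w ≤ K * A.translationLength w := by
  have key : ∀ (p : Path (roseBase n) (roseBase n))
      (_ : FundamentalGroup.fromPath (Path.Homotopic.Quotient.mk p) = w)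
      (y : A.Space) (q : Path y y)
      (_ : FreelyHomotopic (p.map A.marking.toFun.continuous) q),
      B.translationLength w ≤ K * pathLength q := fun p hp y q hq => by
    refine le_trans ?_ (pathLength_map_le hK q)
    exact iInf_le_of_le p <| iInf_le_of_le hp <| iInf_le_of_le _ <| iInf_le_of_le _ <|
      iInf_le _ ((freelyHomotopic_map p hg.symm).trans (hq.map g))
  obtain ⟨p₀, hp₀⟩ : ∃ p : Path (roseBase n) (roseBase n),
      FundamentalGroup.fromPath (Path.Homotopic.Quotient.mk p) = w := by
    obtain ⟨p, hp⟩ := Path.Homotopic.Quotient.mk_surjective (FundamentalGroup.toPath w)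
    exact ⟨p, by rw [hp]⟩
  have hmul := key p₀ hp₀ _ _ (freelyHomotopic_of_homotopic (.refl _))
  rcases eq_or_ne K 0 with rfl | hK0
  · simpa using hmul
  · have hK0' : (K : ℝ≥0∞) ≠ 0 := by simpa using hK0
    rw [← ENNReal.div_le_iff' hK0' ENNReal.coe_ne_top]
    exact le_iInf fun p => le_iInf fun hp => le_iInf fun y => le_iInf fun q => le_iInf fun hq =>
      ENNReal.div_le_of_le_mul' (key p hp y q hq)

theorem rightFactor_le {K : ℝ≥0} {g : C(A.Space, B.Space)}
    (hg : A.RespectsMarkings B g) (hK : LipschitzWith K g) : A.rightFactor B ≤ K :=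
  iSup₂_le fun w _ => ENNReal.div_le_of_le_mul (translationLength_le_mul hg hK w)

end MarkedMetricGraph

section Circle

/-- The map on the circle of length one that a one-periodic map descends to. -/
def loopMap {X : Type*} [TopologicalSpace X] (p : ℝ → X) (hp : Continuous p)
    (hper : ∀ t, p (t + 1) = p t) : C(AddCircle (1 : ℝ), X) where
  toFun := Function.Periodic.lift (f := p) (c := 1) hper
  continuous_toFun := continuous_coinduced_dom.mpr hp

theorem LocalGeodesic.isLocallyInjective {X : Type*} [MetricSpace X] {S : ℝ} (hS : 0 < S)
    {p : ℝ → X} (hg : LocalGeodesic S p) {γ : AddCircle (1 : ℝ) → X} (hγ : ∀ t : ℝ, γ t = p t) :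
    IsLocallyInjective γ := by
  intro z
  induction z using QuotientAddGroup.induction_on with
  | H t =>
    obtain ⟨ε, hε, h⟩ := hg t
    refine ⟨((↑) : ℝ → AddCircle (1 : ℝ)) '' Metric.ball t ε,
      QuotientAddGroup.isOpenMap_coe _ Metric.isOpen_ball, ⟨t, Metric.mem_ball_self hε, rfl⟩, ?_⟩
    rintro _ ⟨x, hx, rfl⟩ _ ⟨y, hy, rfl⟩ hxy
    rw [hγ, hγ] at hxy
    have := h x y hx hy
    rw [hxy, dist_self, eq_comm, mul_eq_zero, or_iff_right hS.ne', abs_eq_zero, sub_eq_zero] at this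
    rw [this]

end Circle

theorem IsLocallyInjective.of_comp {X Y Z : Type*} [TopologicalSpace X] {f : Y → Z} {g : X → Y}
    (h : IsLocallyInjective (f ∘ g)) : IsLocallyInjective g := fun x =>
  let ⟨U, hU, hx, hi⟩ := h x
  ⟨U, hU, hx, hi.of_comp⟩

namespace MarkedMetricGraph

variable {n : ℕ} {A B : MarkedMetricGraph n}

/-- A loop of length `ℓ` whose image is a closed geodesic of length `S * ℓ` bounds the right hand
factor from below. -/
theorem le_rightFactor {f : C(A.Space, B.Space)} (hf : A.RespectsMarkings B f) {S ℓ : ℝ}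
    (hS : 0 < S) (hℓ : 0 < ℓ) {p : ℝ → A.Space} (hp : Continuous p) (hper : ∀ t, p (t + 1) = p t)
    (hlip : LipPath ℓ 1 p) (hgeo : LocalGeodesic (S * ℓ) fun t => f (p t)) :
    ENNReal.ofReal S ≤ A.rightFactor B := by
  have hSℓ : 0 < S * ℓ := mul_pos hS hℓ
  set c := loopOf p hp hper
  obtain ⟨δ⟩ := nonempty_path (roseBase n) (A.marking.invFun (p 0))
  set p₀ := δ.trans ((c.map A.marking.invFun.continuous).trans δ.symm)
  have hp₀ : FreelyHomotopic p₀ (c.map A.marking.invFun.continuous) := freelyHomotopic_conj _ _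
  set w : RoseGroup n := FundamentalGroup.fromPath (Path.Homotopic.Quotient.mk p₀)
  have hA : A.translationLength w ≤ ENNReal.ofReal ℓ := by
    refine le_trans ?_ (hlip.pathLength_le hℓ.le (c := c) fun _ => rfl)
    exact iInf_le_of_le p₀ <| iInf_le_of_le rfl <| iInf_le_of_le _ <| iInf_le_of_le _ <|
      iInf_le _ ((hp₀.map A.marking.toFun).trans (freelyHomotopic_map c A.marking.right_inv))
  have hB : ENNReal.ofReal (S * ℓ) ≤ B.translationLength w := by
    refine le_iInf fun p₁ => le_iInf fun hp₁ => le_iInf fun y => le_iInf fun q => le_iInf fun hq =>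
      ?_
    have h1 : p₁.Homotopic p₀ := Path.Homotopic.Quotient.eq.1 hp₁
    refine le_pathLength_of_freelyHomotopic hSℓ (f.continuous.comp hp)
      (fun t => congrArg f (hper t)) hgeo (c.map f.continuous) (fun _ => rfl) q ?_
    exact (freelyHomotopic_map c hf.homotopic_comp_inv).trans
      ((hp₀.symm.trans (freelyHomotopic_of_homotopic h1.symm)).map B.marking.toFun |>.trans hq)
  have hw : w ≠ 1 := fun h => by
    rw [h, translationLength_one, nonpos_iff_eq_zero, ENNReal.ofReal_eq_zero] at hB
    exact absurd hSℓ (not_lt.2 hB)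
  refine le_trans ?_ (le_iSup₂ (f := fun (w : RoseGroup n) (_ : w ≠ 1) =>
    B.translationLength w / A.translationLength w) w hw)
  refine le_trans ?_ (ENNReal.div_le_div hB hA)
  rw [ENNReal.ofReal_mul hS.le, ENNReal.mul_div_cancel_right]
  · exact (ENNReal.ofReal_pos.2 hℓ).ne'
  · exact ENNReal.ofReal_ne_top

end MarkedMetricGraph

theorem mainTheorem2 {n : ℕ} (hn : 1 ≤ n) (A B : MarkedMetricGraph n) :
    ∃ f : PLMap A.toMetricGraph B.toMetricGraph,
      A.RespectsMarkings B f.toMap ∧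
      (∃ γ : C(AddCircle (1 : ℝ), A.Space),
        CyclicallyReduced γ ∧ range γ ⊆ f.maxSubgraph ∧ CyclicallyReduced (f.toMap.comp γ)) ∧
      A.rightFactor B = (f.stretch : ℝ≥0∞) ∧
      LipschitzWith f.stretch f.toMap ∧
      (∀ (K : ℝ≥0) (g : C(A.Space, B.Space)),
        A.RespectsMarkings B g → LipschitzWith K g → f.stretch ≤ K) := by
  obtain ⟨f, κ, S, hf, hlip, hgeo, hS, hκS, ⟨e₀, he₀⟩, hleg⟩ :=
    exists_optimal (P := A.RespectsMarkings B) (fun f g h hf => hf.of_homotopic h)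
      (MarkedMetricGraph.exists_respectsMarkings A B) (fun f hf => hf.not_edgeLip_zero)
  obtain ⟨ℓ, p, hℓ, hp, hper, hplip, hpgeo, hpM⟩ := exists_legal_loop (M := fun e => κ e = S)
    (f := f) (S := S) ⟨e₀, he₀⟩ (fun h hh => hh ▸ hgeo.armGeodesic h) hleg
  have hstretch : (⟨f, κ, hgeo⟩ : PLMap A.toMetricGraph B.toMetricGraph).stretch = S :=
    le_antisymm (Finset.sup_le fun e _ => hκS e) (he₀ ▸ Finset.le_sup (Finset.mem_univ e₀))
  have hS' : (0 : ℝ) < S := hS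
  have hfactor : A.rightFactor B = S := le_antisymm
    (MarkedMetricGraph.rightFactor_le hf (hlip.lipschitzWith hκS))
    (by simpa using MarkedMetricGraph.le_rightFactor hf hS' hℓ hp hper hplip hpgeo)
  have hinj : IsLocallyInjective (f ∘ loopMap p hp hper) :=
    hpgeo.isLocallyInjective (mul_pos hS' hℓ) fun _ => rfl
  refine ⟨⟨f, κ, hgeo⟩, hf, ⟨loopMap p hp hper, hinj.of_comp, ?_, hinj⟩, ?_, ?_, ?_⟩
  · rintro _ ⟨z, rfl⟩
    induction z using QuotientAddGroup.induction_on with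
    | H t =>
      obtain ⟨e, he, ht⟩ := hpM t
      exact mem_iUnion₂.2 ⟨e, he.trans hstretch.symm, ht⟩
  · rw [hstretch, hfactor]
  · rw [hstretch]
    exact hlip.lipschitzWith hκS
  · intro K g hg hK
    rw [hstretch, ← ENNReal.coe_le_coe, ← hfactor]
    exact MarkedMetricGraph.rightFactor_le hg hK

end
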